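/- Let $n\ge 0$ and let $\mathfrak g$ be one of the complex Lie algebras $\mathrm{so}(2n)$, $\mathrm{so}(2n+1)$, $\mathrm{sp}(2n)$, realised by the matrices that are skew-adjoint for the split form. Let $\mathfrak h$ be its Cartan subalgebra of diagonal matrices, $\varepsilon_1,\dots,\varepsilon_n$ the usual basis of $\mathfrak h^*$, and $\Delta(\mathfrak g)$ the set of roots. Scalar products are taken with $\varepsilon_1,\dots,\varepsilon_n$ orthonormal, so long and short roots have squared lengths $2,1$ for $\mathrm{so}(2n+1)$ and $4,2$ for $\mathrm{sp}(2n)$, and all roots of $\mathrm{so}(2n)$ have squared length $2$. Fix a system of positive roots $\Delta(\mathfrak b)$, i.e. the roots of a Borel subalgebra $\mathfrak b\supset\mathfrak h$. Let $\mathfrak l\supset\mathfrak h$ be a subalgebra of $\mathfrak g$, with set of roots $\Delta(\mathfrak l)$. Put $\Delta(\mathfrak k)=\Delta(\mathfrak l)\cap-\Delta(\mathfrak l)$, $\Delta(\mathfrak n)=\Delta(\mathfrak l)\setminus\Delta(\mathfrak k)$ and $$\mathrm{Sing}=\{\alpha\in\Delta(\mathfrak g)\setminus\Delta(\mathfrak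 l)\;:\;\alpha+\delta\notin\Delta(\mathfrak g)\text{ for all }\delta\in\Delta(\mathfrak b)\cap\Delta(\mathfrak k)\}.$$ The cone condition says that the $\mathbb Q_{\ge0}$-spans of $\Delta(\mathfrak n)$ and of $\mathrm{Sing}$ meet only in $0$. A relation is an equality $$a_1\alpha_1+\dots+a_p\alpha_p=b_1\beta_1+\dots+b_q\beta_q\neq0$$ with positive integers $a_i,b_j$, pairwise distinct $\alpha_i\in\mathrm{Sing}$ and pairwise distinct $\beta_j\in\Delta(\mathfrak n)$. Its length is $\sum_i a_i$. It is minimal if its length is least among all relations for $\mathfrak l$ and no two of the $\beta_j$ sum up to a root. Suppose that $\mathfrak l$ does not satisfy the cone condition. Then minimal relations exist, each of them has length $2$, and each is of one of the following types (after renumbering). All scalar products of distinct roots of the relation that are not listed are zero. The roots of the relation generate a root subsystem of $\Delta(\mathfrak g)$ of the indicated type. The relation is taken by an automorphism of $\Delta(\mathfrak g)$ to the representative in square brackets. For $\mathrm{so}(2n)$ (all roots of the relation long, i.e. of squared length $2$): 1. $\alpha_1+\alpha_2=\beta_1$, $\langle\alpha_i,\beta_1\rangle=1$, $\langle\alpha_1,\alpha_2\rangle=-1$;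 $A_2$; $[(\varepsilon_1+\varepsilon_2)+(-\varepsilon_2+\varepsilon_3)=\varepsilon_1+\varepsilon_3]$. 2. $\alpha_1+\alpha_2=\beta_1+\beta_2$, $\langle\alpha_i,\beta_j\rangle=1$; $A_3$, contained in a subsystem $A_4$, $n\ge5$; $[(\varepsilon_1+\varepsilon_2)+(\varepsilon_3+\varepsilon_4)=(\varepsilon_1+\varepsilon_3)+(\varepsilon_2+\varepsilon_4)]$. 3. $\alpha_1+\alpha_2=\beta_1+\beta_2+\beta_3$, $\langle\alpha_1,\alpha_2\rangle=\langle\alpha_i,\beta_j\rangle=1$; $D_4$; $[(\varepsilon_1+\varepsilon_2)+(\varepsilon_1+\varepsilon_4)=(\varepsilon_1+\varepsilon_3)+(\varepsilon_1-\varepsilon_3)+(\varepsilon_2+\varepsilon_4)]$. 4. $2\alpha_1=\beta_1+\beta_2+\beta_3+\beta_4$, $\langle\alpha_1,\beta_j\rangle=1$; $D_4$; $[2(\varepsilon_1+\varepsilon_2)=(\varepsilon_1+\varepsilon_3)+(\varepsilon_1-\varepsilon_3)+(\varepsilon_2+\varepsilon_4)+(\varepsilon_2-\varepsilon_4)]$.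 5. $\alpha_1+\alpha_2=\beta_1+\beta_2$, $\langle\alpha_i,\beta_j\rangle=1$; $A_3$, not contained in a subsystem $A_4$; $[(\varepsilon_1+\varepsilon_2)+(\varepsilon_1-\varepsilon_2)=(\varepsilon_1+\varepsilon_3)+(\varepsilon_1-\varepsilon_3)$, or the representative of type 2, which generates such an $A_3$ only when $n=4]$. For $\mathrm{so}(2n+1)$: types 1–5, and the following, where all roots not said to be short are long: 6. $\alpha_1+\alpha_2=\beta_1$, $\alpha_1,\alpha_2$ short, $\langle\alpha_i,\beta_1\rangle=1$; $B_2$; $[\varepsilon_1+\varepsilon_2=(\varepsilon_1+\varepsilon_2)]$. 7. $\alpha_1+\alpha_2=\beta_1$, $\alpha_1,\beta_1$ short, $\langle\alpha_1,\alpha_2\rangle=-1$, $\langle\alpha_2,\beta_1\rangle=1$; $B_2$; $[\varepsilon_1+(-\varepsilon_1+\varepsilon_2)=\varepsilon_2]$. 8. $2\alpha_1=\beta_1+\beta_2$, $\alpha_1$ short, $\langle\alpha_1,\beta_j\rangle=1$; $B_2$; $[2\varepsilon_1=(\varepsilon_1+\varepsilon_2)+(\varepsilon_1-\varepsilon_2)]$.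 9. $\alpha_1+\alpha_2=2\beta_1$, $\beta_1$ short, $\langle\alpha_i,\beta_1\rangle=1$; $B_2$; $[(\varepsilon_1+\varepsilon_2)+(\varepsilon_1-\varepsilon_2)=2\varepsilon_1]$. 10. $\alpha_1+\alpha_2=\beta_1+\beta_2$, $\alpha_1,\beta_2$ short, $\langle\alpha_1,\beta_1\rangle=\langle\alpha_2,\beta_1\rangle=\langle\alpha_2,\beta_2\rangle=1$; $B_3$; $[\varepsilon_1+(\varepsilon_2+\varepsilon_3)=(\varepsilon_1+\varepsilon_2)+\varepsilon_3]$. 11. $\alpha_1+\alpha_2=2\beta_1+\beta_2$, $\beta_1$ short, $\langle\alpha_1,\alpha_2\rangle=\langle\alpha_i,\beta_j\rangle=1$; $B_3$; $[(\varepsilon_1+\varepsilon_2)+(\varepsilon_1+\varepsilon_3)=2\varepsilon_1+(\varepsilon_2+\varepsilon_3)]$. 12. $2\alpha_1=2\beta_1+\beta_2+\beta_3$, $\beta_1$ short, $\langle\alpha_1,\beta_j\rangle=1$; $B_3$; $[2(\varepsilon_1+\varepsilon_2)=2\varepsilon_1+(\varepsilon_2+\varepsilon_3)+(\varepsilon_2-\varepsilon_3)]$.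 13. $\alpha_1+\alpha_2=\beta_1+\beta_2+\beta_3$, $\alpha_1,\beta_3$ short, $\langle\alpha_1,\alpha_2\rangle=\langle\alpha_1,\beta_1\rangle=\langle\alpha_1,\beta_2\rangle=\langle\alpha_2,\beta_1\rangle=\langle\alpha_2,\beta_2\rangle=\langle\alpha_2,\beta_3\rangle=1$; $B_3$; $[\varepsilon_1+(\varepsilon_1+\varepsilon_2)=(\varepsilon_1+\varepsilon_3)+(\varepsilon_1-\varepsilon_3)+\varepsilon_2]$. For $\mathrm{sp}(2n)$, where all roots not said to be long are short: 14. $\alpha_1+\alpha_2=\beta_1$, $\langle\alpha_i,\beta_1\rangle=1$, $\langle\alpha_1,\alpha_2\rangle=-1$; $A_2$; $[$as in type 1$]$. 15. $\alpha_1+\alpha_2=\beta_1$, $\beta_1$ long, $\langle\alpha_i,\beta_1\rangle=2$; $C_2$; $[(\varepsilon_1+\varepsilon_2)+(\varepsilon_1-\varepsilon_2)=2\varepsilon_1]$. 16. $\alpha_1+\alpha_2=2\beta_1$, $\alpha_1,\alpha_2$ long, $\langle\alpha_i,\beta_1\rangle=2$; $C_2$; $[2\varepsilon_1+2\varepsilon_2=2(\varepsilon_1+\varepsilon_2)]$.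 17. $\alpha_1+\alpha_2=\beta_1$, $\alpha_1$ long, $\langle\alpha_1,\beta_1\rangle=2$, $\langle\alpha_1,\alpha_2\rangle=-2$; $C_2$; $[2\varepsilon_1+(-\varepsilon_1+\varepsilon_2)=\varepsilon_1+\varepsilon_2]$. 18. $2\alpha_1=\beta_1+\beta_2$, $\beta_1,\beta_2$ long, $\langle\alpha_1,\beta_j\rangle=2$; $C_2$; $[2(\varepsilon_1+\varepsilon_2)=2\varepsilon_1+2\varepsilon_2]$. 19. $\alpha_1+\alpha_2=\beta_1+\beta_2$, $\langle\alpha_i,\beta_j\rangle=1$; $A_3$; $[$as in type 2$]$, $n\ge4$. 20. $\alpha_1+\alpha_2=\beta_1+\beta_2$, $\alpha_2$ long, $\langle\alpha_2,\beta_j\rangle=2$, $\langle\alpha_1,\beta_j\rangle=\langle\beta_1,\beta_2\rangle=1$; $C_3$; $[(\varepsilon_1+\varepsilon_2)+2\varepsilon_3=(\varepsilon_1+\varepsilon_3)+(\varepsilon_2+\varepsilon_3)]$. 21. $\alpha_1+\alpha_2=\beta_1+\beta_2$, $\beta_2$ long, $\langle\alpha_i,\beta_2\rangle=2$, $\langle\alpha_1,\alpha_2\rangle=\langle\alpha_i,\beta_1\rangle=1$;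 $C_3$; $[(\varepsilon_1+\varepsilon_2)+(\varepsilon_2+\varepsilon_3)=(\varepsilon_1+\varepsilon_3)+2\varepsilon_2]$. -/

import Mathlib

open scoped Matrix

attribute [local instance 100] LieRing.ofAssociativeRing

namespace ConeRelations

/-! ### The classical Lie algebras, their diagonal Cartan subalgebras and their roots -/

/-- The three families `so(2n+1)`, `sp(2n)`, `so(2n)`. -/
inductive ClassicalType
  | B
  | C
  | D

namespace ClassicalType

/-- Index type of the matrices: size `2n+1` for `B`, size `2n` for `C` and `D`. -/
def Idx : ClassicalType → ℕ → Type
  | B, n => Unit ⊕ Fin n ⊕ Fin n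
  | C, n => Fin n ⊕ Fin n
  | D, n => Fin n ⊕ Fin n

instance instFintypeIdx : (X : ClassicalType) → (n : ℕ) → Fintype (X.Idx n)
  | B, n => inferInstanceAs (Fintype (Unit ⊕ Fin n ⊕ Fin n))
  | C, n => inferInstanceAs (Fintype (Fin n ⊕ Fin n))
  | D, n => inferInstanceAs (Fintype (Fin n ⊕ Fin n))

instance instDecidableEqIdx : (X : ClassicalType) → (n : ℕ) → DecidableEq (X.Idx n)
  | B, n => inferInstanceAs (DecidableEq (Unit ⊕ Fin n ⊕ Fin n))
  | C, n => inferInstanceAs (DecidableEq (Fin n ⊕ Fin n))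
  | D, n => inferInstanceAs (DecidableEq (Fin n ⊕ Fin n))

/-- The complex Lie algebra `𝔤`: `so(2n+1)`, `sp(2n)` or `so(2n)`, realised by the matrices that
are skew-adjoint for the split form (Mathlib's `typeB`, `sp`, `typeD`). -/
def algebra : (X : ClassicalType) → (n : ℕ) → LieSubalgebra ℂ (Matrix (X.Idx n) (X.Idx n) ℂ)
  | B, n => LieAlgebra.Orthogonal.typeB (Fin n) ℂ
  | C, n => LieAlgebra.Symplectic.sp (Fin n) ℂ
  | D, n => LieAlgebra.Orthogonal.typeD (Fin n) ℂ

/-- The diagonal position that is read off by the coordinate `ε_i`. -/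
def pos : (X : ClassicalType) → (n : ℕ) → Fin n → X.Idx n
  | B, _, i => Sum.inr (Sum.inl i)
  | C, _, i => Sum.inl i
  | D, _, i => Sum.inl i

/-- The Cartan subalgebra `𝔥` of diagonal matrices in `𝔤`. -/
def cartan (X : ClassicalType) (n : ℕ) : Submodule ℂ (X.algebra n) where
  carrier := {h | (h : Matrix (X.Idx n) (X.Idx n) ℂ).IsDiag}
  zero_mem' := Matrix.isDiag_zero
  add_mem' := fun ha hb => Matrix.IsDiag.add ha hb
  smul_mem' := fun c _ ha => Matrix.IsDiag.smul c ha

/-- The value at `h` of the weight `∑ i, α i • ε_i`. -/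
def weight (X : ClassicalType) (n : ℕ) (α : Fin n → ℚ) (h : X.algebra n) : ℂ :=
  ∑ i, (α i : ℂ) * (h : Matrix (X.Idx n) (X.Idx n) ℂ) (X.pos n i) (X.pos n i)

/-- The weight space `𝔤^α`. -/
def rootSpace (X : ClassicalType) (n : ℕ) (α : Fin n → ℚ) : Submodule ℂ (X.algebra n) where
  carrier := {x | ∀ h ∈ X.cartan n, ⁅h, x⁆ = X.weight n α h • x}
  zero_mem' := fun h _ => by simp
  add_mem' := fun {a b} ha hb h hh => by rw [lie_add, ha h hh, hb h hh, smul_add]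
  smul_mem' := fun c x hx h hh => by rw [lie_smul, hx h hh, smul_comm]

/-- The set of roots `Δ(𝔤)`, in the coordinates given by the basis `ε_1, …, ε_n` of `𝔥*`. (The
roots are integral combinations of the `ε_i`, so rational coordinates lose nothing.) -/
def roots (X : ClassicalType) (n : ℕ) : Set (Fin n → ℚ) :=
  {α | α ≠ 0 ∧ X.rootSpace n α ≠ ⊥}

end ClassicalType

open ClassicalType

/-- `P` is the set of roots of a Borel subalgebra containing `𝔥`: the roots on which some regular
linear functional is positive. -/
def IsPositiveSystem {n : ℕ} (Δ P : Set (Fin n → ℚ)) : Prop :=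
  ∃ f : (Fin n → ℚ) →ₗ[ℚ] ℚ, (∀ α ∈ Δ, f α ≠ 0) ∧ P = {α | α ∈ Δ ∧ 0 < f α}

/-! ### Root subalgebras, the cone condition and cone-intersection relations

Below, `𝔩` is a subalgebra of `𝔤`, used when it contains `𝔥`; then it is `𝔥` plus the root spaces
`𝔤^α`, `α ∈ Δ(𝔩)`. Its reductive part is `𝔨` and its nilradical is `𝔫`. -/

section

variable {X : ClassicalType} {n : ℕ}

/-- `Δ(𝔩)`. -/
def subRoots (𝔩 : LieSubalgebra ℂ (X.algebra n)) : Set (Fin n → ℚ) :=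
  {α | α ∈ X.roots n ∧ X.rootSpace n α ≤ 𝔩.toSubmodule}

/-- `Δ(𝔨)`. -/
def redRoots (𝔩 : LieSubalgebra ℂ (X.algebra n)) : Set (Fin n → ℚ) :=
  {α | α ∈ subRoots 𝔩 ∧ -α ∈ subRoots 𝔩}

/-- `Δ(𝔫)`. -/
def nilRoots (𝔩 : LieSubalgebra ℂ (X.algebra n)) : Set (Fin n → ℚ) :=
  {α | α ∈ subRoots 𝔩 ∧ -α ∉ subRoots 𝔩}

/-- `Sing_{𝔟∩𝔨}(𝔤/𝔩)`, where `P = Δ(𝔟)`. -/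
def singRoots (P : Set (Fin n → ℚ)) (𝔩 : LieSubalgebra ℂ (X.algebra n)) : Set (Fin n → ℚ) :=
  {α | α ∈ X.roots n ∧ α ∉ subRoots 𝔩 ∧ ∀ δ ∈ P ∩ redRoots 𝔩, α + δ ∉ X.roots n}

/-- The cone condition: the `ℚ≥0`-spans of `Δ(𝔫)` and of `Sing_{𝔟∩𝔨}(𝔤/𝔩)` meet only in `0`. -/
def ConeCondition (P : Set (Fin n → ℚ)) (𝔩 : LieSubalgebra ℂ (X.algebra n)) : Prop :=
  (PointedCone.hull ℚ (nilRoots 𝔩) : Set (Fin n → ℚ)) ∩ PointedCone.hull ℚ (singRoots P 𝔩) = {0}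

/-- A relation `a₁α₁ + ⋯ + a_lα_l = b₁β₁ + ⋯ + b_kβ_k ≠ 0` with positive integers `a_i`, `b_j`,
pairwise distinct `α_i ∈ Sing_{𝔟∩𝔨}(𝔤/𝔩)` and pairwise distinct `β_j ∈ Δ(𝔫)`. The left side is the
multiset `A` in which `α_i` has multiplicity `a_i`, likewise `B` for the right side, so equal
summands are always collected. The length `∑ a_i` is the cardinality of `A`. -/
structure IsRelation (P : Set (Fin n → ℚ)) (𝔩 : LieSubalgebra ℂ (X.algebra n))
    (A B : Multiset (Fin n → ℚ)) : Prop where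
  left_mem : ∀ α ∈ A, α ∈ singRoots P 𝔩
  right_mem : ∀ β ∈ B, β ∈ nilRoots 𝔩
  sum_eq : A.sum = B.sum
  sum_ne_zero : A.sum ≠ 0

/-- A minimal relation: its length is least among all relations for `𝔩`, and no two `β`'s sum up
to a root. -/
structure IsMinimalRelation (P : Set (Fin n → ℚ)) (𝔩 : LieSubalgebra ℂ (X.algebra n))
    (A B : Multiset (Fin n → ℚ)) : Prop where
  isRelation : IsRelation P 𝔩 A B
  length_le : ∀ A' B', IsRelation P 𝔩 A' B' → A.card ≤ A'.card
  add_not_root : ∀ β ∈ B, ∀ β' ∈ B, β + β' ∉ X.roots n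

end

/-! ### Root systems -/

/-- The reflection of `β` along `α`. -/
def reflect {n : ℕ} (α β : Fin n → ℚ) : Fin n → ℚ :=
  β - (2 * (α ⬝ᵥ β) / (α ⬝ᵥ α)) • α

/-- Root subsystems of `Δ`. -/
def IsSubsystem {n : ℕ} (Δ Ψ : Set (Fin n → ℚ)) : Prop :=
  Ψ ⊆ Δ ∧ ∀ α ∈ Ψ, ∀ β ∈ Ψ, reflect α β ∈ Ψ

/-- The root subsystem of `Δ` generated by `S ⊆ Δ`. -/
def generated {n : ℕ} (Δ S : Set (Fin n → ℚ)) : Set (Fin n → ℚ) :=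
  {γ | ∀ Ψ, IsSubsystem Δ Ψ → S ⊆ Ψ → γ ∈ Ψ}

/-- Isomorphism of root systems: a linear isomorphism of the spans that matches the roots. -/
def IsoRoots {m n : ℕ} (Φ : Set (Fin m → ℚ)) (Ψ : Set (Fin n → ℚ)) : Prop :=
  ∃ e : Submodule.span ℚ Φ ≃ₗ[ℚ] Submodule.span ℚ Ψ,
    ∀ x : Submodule.span ℚ Φ, (x : Fin m → ℚ) ∈ Φ ↔ (e x : Fin n → ℚ) ∈ Ψ

/-- The roots `ε_i - ε_j`: the standard root system `A_m`. -/
def stdA (m : ℕ) : Set (Fin (m + 1) → ℚ) :=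
  {α | ∃ i j, i ≠ j ∧ α = Pi.single i 1 - Pi.single j 1}

/-- The roots `±ε_i ± ε_j`, `i ≠ j`: the standard root system `D_m`. -/
def stdD (m : ℕ) : Set (Fin m → ℚ) :=
  {α | ∃ i j, i ≠ j ∧ ∃ s t : ℚ, (s = 1 ∨ s = -1) ∧ (t = 1 ∨ t = -1) ∧
    α = Pi.single i s + Pi.single j t}

/-- The roots `±ε_i ± ε_j`, `i ≠ j`, and `±ε_i`: the standard root system `B_m`. -/
def stdB (m : ℕ) : Set (Fin m → ℚ) :=
  stdD m ∪ {α | ∃ i, ∃ s : ℚ, (s = 1 ∨ s = -1) ∧ α = Pi.single i s}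

/-- The roots `±ε_i ± ε_j`, `i ≠ j`, and `±2ε_i`: the standard root system `C_m`. -/
def stdC (m : ℕ) : Set (Fin m → ℚ) :=
  stdD m ∪ {α | ∃ i, ∃ s : ℚ, (s = 1 ∨ s = -1) ∧ α = Pi.single i (2 * s)}

/-- `Φ` lies in a root subsystem of `Δ` of type `A₄`. -/
def ExtendsToA4 {n : ℕ} (Δ Φ : Set (Fin n → ℚ)) : Prop :=
  ∃ Ψ, IsSubsystem Δ Ψ ∧ Φ ⊆ Ψ ∧ IsoRoots Ψ (stdA 4)

/-- The kinds of generated subsystems that occur. `A3inA4` is `A₃ ⊂ A₄`, and `D3` is a subsystem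
of type `A₃` that does not extend to one of type `A₄`. -/
inductive SubsystemKind
  | A2
  | A3
  | A3inA4
  | D3
  | D4
  | B2
  | B3
  | C2
  | C3

/-- The root subsystem `Φ` of `Δ` is of the given kind. -/
def SubsystemKind.Holds {n : ℕ} (Δ Φ : Set (Fin n → ℚ)) : SubsystemKind → Prop
  | A2 => IsoRoots Φ (stdA 2)
  | A3 => IsoRoots Φ (stdA 3)
  | A3inA4 => IsoRoots Φ (stdA 3) ∧ ExtendsToA4 Δ Φ
  | D3 => IsoRoots Φ (stdA 3) ∧ ¬ ExtendsToA4 Δ Φ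
  | D4 => IsoRoots Φ (stdD 4)
  | B2 => IsoRoots Φ (stdB 2)
  | B3 => IsoRoots Φ (stdB 3)
  | C2 => IsoRoots Φ (stdC 2)
  | C3 => IsoRoots Φ (stdC 3)

/-- The automorphisms of `Δ`. -/
def IsAut {n : ℕ} (Δ : Set (Fin n → ℚ)) (φ : (Fin n → ℚ) ≃ₗ[ℚ] (Fin n → ℚ)) : Prop :=
  φ '' Δ = Δ

/-! ### The table -/

/-- A row of the table: a type of relations `∑ i, a i • α_i = ∑ j, b j • β_j`. The scalar product
is the one for which `ε_1, …, ε_n` is orthonormal. So the squared lengths on the diagonals of `αα`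
and `ββ` are `2` for long roots in types `B`, `D` and for short roots in type `C`, they are `1` for
short roots in type `B` and `4` for long roots in type `C`. -/
structure Row where
  /-- number of distinct roots on the left -/
  p : ℕ
  /-- number of distinct roots on the right -/
  q : ℕ
  /-- coefficients on the left -/
  a : Fin p → ℕ
  /-- coefficients on the right -/
  b : Fin q → ℕ
  /-- the scalar products `⟨α_i, α_j⟩` -/
  αα : Matrix (Fin p) (Fin p) ℚ
  /-- the scalar products `⟨α_i, β_j⟩` -/
  αβ : Matrix (Fin p) (Fin q) ℚ
  /-- the scalar products `⟨β_i, β_j⟩` -/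
  ββ : Matrix (Fin q) (Fin q) ℚ
  /-- what the roots of the relation generate -/
  kind : SubsystemKind
  /-- the least `n` for which the row occurs -/
  minRank : ℕ
  /-- representatives up to automorphisms of `Δ(𝔤)`; a root `c₁ε_1 + c₂ε_2 + c₃ε_3 + c₄ε_4` is
  written `![c₁, c₂, c₃, c₄]` -/
  reps : List ((Fin p → Fin 4 → ℤ) × (Fin q → Fin 4 → ℤ))

/-- The vector `c₁ε_1 + c₂ε_2 + c₃ε_3 + c₄ε_4` of `ℚⁿ`. -/
def vec (n : ℕ) (c : Fin 4 → ℤ) : Fin n → ℚ :=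
  fun j => if h : (j : ℕ) < 4 then (c ⟨j, h⟩ : ℚ) else 0

/-- The relation `(A, B)` is of the type described by the row `r`, and an automorphism of `Δ`
takes it to one of the representatives of `r`. -/
def Row.Matches (r : Row) {n : ℕ} (Δ : Set (Fin n → ℚ)) (A B : Multiset (Fin n → ℚ)) : Prop :=
  ∃ (α : Fin r.p → Fin n → ℚ) (β : Fin r.q → Fin n → ℚ),
    A = ∑ i, r.a i • ({α i} : Multiset (Fin n → ℚ)) ∧
    B = ∑ j, r.b j • ({β j} : Multiset (Fin n → ℚ)) ∧
    (∀ i j, α i ⬝ᵥ α j = r.αα i j) ∧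
    (∀ i j, α i ⬝ᵥ β j = r.αβ i j) ∧
    (∀ i j, β i ⬝ᵥ β j = r.ββ i j) ∧
    r.kind.Holds Δ (generated Δ (Set.range α ∪ Set.range β)) ∧
    r.minRank ≤ n ∧
    ∃ ρ ∈ r.reps, ∃ φ, IsAut Δ φ ∧
      (∀ i, φ (α i) = vec n (ρ.1 i)) ∧ (∀ j, φ (β j) = vec n (ρ.2 j))

/-- `α₁ + α₂ = β₁`, all long (`B`, `D`) or all short (`C`), generating `A₂`. -/
def rowA2 : Row where
  p := 2
  q := 1
  a := ![1, 1]
  b := ![1]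
  αα := !![2, -1; -1, 2]
  αβ := !![1; 1]
  ββ := !![2]
  kind := .A2
  minRank := 3
  reps := [(![![1, 1, 0, 0], ![0, -1, 1, 0]], ![![1, 0, 1, 0]])]

/-- `α₁ + α₂ = β₁ + β₂`, all long, generating `A₃ ⊂ A₄`. -/
def rowA3inA4 : Row where
  p := 2
  q := 2
  a := ![1, 1]
  b := ![1, 1]
  αα := !![2, 0; 0, 2]
  αβ := !![1, 1; 1, 1]
  ββ := !![2, 0; 0, 2]
  kind := .A3inA4
  minRank := 5
  reps := [(![![1, 1, 0, 0], ![0, 0, 1, 1]], ![![1, 0, 1, 0], ![0, 1, 0, 1]])]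

/-- `α₁ + α₂ = β₁ + β₂ + β₃`, all long, generating `D₄`. -/
def rowD4 : Row where
  p := 2
  q := 3
  a := ![1, 1]
  b := ![1, 1, 1]
  αα := !![2, 1; 1, 2]
  αβ := !![1, 1, 1; 1, 1, 1]
  ββ := !![2, 0, 0; 0, 2, 0; 0, 0, 2]
  kind := .D4
  minRank := 4
  reps := [(![![1, 1, 0, 0], ![1, 0, 0, 1]],
    ![![1, 0, 1, 0], ![1, 0, -1, 0], ![0, 1, 0, 1]])]

/-- `2α₁ = β₁ + β₂ + β₃ + β₄`, all long, generating `D₄`. -/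
def rowD4' : Row where
  p := 1
  q := 4
  a := ![2]
  b := ![1, 1, 1, 1]
  αα := !![2]
  αβ := !![1, 1, 1, 1]
  ββ := !![2, 0, 0, 0; 0, 2, 0, 0; 0, 0, 2, 0; 0, 0, 0, 2]
  kind := .D4
  minRank := 4
  reps := [(![![1, 1, 0, 0]],
    ![![1, 0, 1, 0], ![1, 0, -1, 0], ![0, 1, 0, 1], ![0, 1, 0, -1]])]

/-- `α₁ + α₂ = β₁ + β₂`, all long, generating an `A₃` that does not extend to an `A₄`. (The second
representative generates such an `A₃` only for `n = 4`.) -/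
def rowD3 : Row where
  p := 2
  q := 2
  a := ![1, 1]
  b := ![1, 1]
  αα := !![2, 0; 0, 2]
  αβ := !![1, 1; 1, 1]
  ββ := !![2, 0; 0, 2]
  kind := .D3
  minRank := 3
  reps := [(![![1, 1, 0, 0], ![1, -1, 0, 0]], ![![1, 0, 1, 0], ![1, 0, -1, 0]]),
    (![![1, 1, 0, 0], ![0, 0, 1, 1]], ![![1, 0, 1, 0], ![0, 1, 0, 1]])]

/-- `α₁ + α₂ = β₁`, with `α₁`, `α₂` short, generating `B₂`. -/
def rowB2 : Row where
  p := 2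
  q := 1
  a := ![1, 1]
  b := ![1]
  αα := !![1, 0; 0, 1]
  αβ := !![1; 1]
  ββ := !![2]
  kind := .B2
  minRank := 2
  reps := [(![![1, 0, 0, 0], ![0, 1, 0, 0]], ![![1, 1, 0, 0]])]

/-- `α₁ + α₂ = β₁`, with `α₁`, `β₁` short, generating `B₂`. -/
def rowB2' : Row where
  p := 2
  q := 1
  a := ![1, 1]
  b := ![1]
  αα := !![1, -1; -1, 2]
  αβ := !![0; 1]
  ββ := !![1]
  kind := .B2
  minRank := 2
  reps := [(![![1, 0, 0, 0], ![-1, 1, 0, 0]], ![![0, 1, 0, 0]])]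

/-- `2α₁ = β₁ + β₂`, with `α₁` short, generating `B₂`. -/
def rowB2'' : Row where
  p := 1
  q := 2
  a := ![2]
  b := ![1, 1]
  αα := !![1]
  αβ := !![1, 1]
  ββ := !![2, 0; 0, 2]
  kind := .B2
  minRank := 2
  reps := [(![![1, 0, 0, 0]], ![![1, 1, 0, 0], ![1, -1, 0, 0]])]

/-- `α₁ + α₂ = 2β₁`, with `β₁` short, generating `B₂`. -/
def rowB2''' : Row where
  p := 2
  q := 1
  a := ![1, 1]
  b := ![2]
  αα := !![2, 0; 0, 2]
  αβ := !![1; 1]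
  ββ := !![1]
  kind := .B2
  minRank := 2
  reps := [(![![1, 1, 0, 0], ![1, -1, 0, 0]], ![![1, 0, 0, 0]])]

/-- `α₁ + α₂ = β₁ + β₂`, with `α₁`, `β₂` short, generating `B₃`. -/
def rowB3 : Row where
  p := 2
  q := 2
  a := ![1, 1]
  b := ![1, 1]
  αα := !![1, 0; 0, 2]
  αβ := !![1, 0; 1, 1]
  ββ := !![2, 0; 0, 1]
  kind := .B3
  minRank := 3
  reps := [(![![1, 0, 0, 0], ![0, 1, 1, 0]], ![![1, 1, 0, 0], ![0, 0, 1, 0]])]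

/-- `α₁ + α₂ = 2β₁ + β₂`, with `β₁` short, generating `B₃`. -/
def rowB3' : Row where
  p := 2
  q := 2
  a := ![1, 1]
  b := ![2, 1]
  αα := !![2, 1; 1, 2]
  αβ := !![1, 1; 1, 1]
  ββ := !![1, 0; 0, 2]
  kind := .B3
  minRank := 3
  reps := [(![![1, 1, 0, 0], ![1, 0, 1, 0]], ![![1, 0, 0, 0], ![0, 1, 1, 0]])]

/-- `2α₁ = 2β₁ + β₂ + β₃`, with `β₁` short, generating `B₃`. -/
def rowB3'' : Row where
  p := 1
  q := 3
  a := ![2]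
  b := ![2, 1, 1]
  αα := !![2]
  αβ := !![1, 1, 1]
  ββ := !![1, 0, 0; 0, 2, 0; 0, 0, 2]
  kind := .B3
  minRank := 3
  reps := [(![![1, 1, 0, 0]], ![![1, 0, 0, 0], ![0, 1, 1, 0], ![0, 1, -1, 0]])]

/-- `α₁ + α₂ = β₁ + β₂ + β₃`, with `α₁`, `β₃` short, generating `B₃`. -/
def rowB3''' : Row where
  p := 2
  q := 3
  a := ![1, 1]
  b := ![1, 1, 1]
  αα := !![1, 1; 1, 2]
  αβ := !![1, 1, 0; 1, 1, 1]
  ββ := !![2, 0, 0; 0, 2, 0; 0, 0, 1]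
  kind := .B3
  minRank := 3
  reps := [(![![1, 0, 0, 0], ![1, 1, 0, 0]],
    ![![1, 0, 1, 0], ![1, 0, -1, 0], ![0, 1, 0, 0]])]

/-- `α₁ + α₂ = β₁`, with `β₁` long, generating `C₂`. -/
def rowC2 : Row where
  p := 2
  q := 1
  a := ![1, 1]
  b := ![1]
  αα := !![2, 0; 0, 2]
  αβ := !![2; 2]
  ββ := !![4]
  kind := .C2
  minRank := 2
  reps := [(![![1, 1, 0, 0], ![1, -1, 0, 0]], ![![2, 0, 0, 0]])]

/-- `α₁ + α₂ = 2β₁`, with `α₁`, `α₂` long, generating `C₂`. -/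
def rowC2' : Row where
  p := 2
  q := 1
  a := ![1, 1]
  b := ![2]
  αα := !![4, 0; 0, 4]
  αβ := !![2; 2]
  ββ := !![2]
  kind := .C2
  minRank := 2
  reps := [(![![2, 0, 0, 0], ![0, 2, 0, 0]], ![![1, 1, 0, 0]])]

/-- `α₁ + α₂ = β₁`, with `α₁` long, generating `C₂`. -/
def rowC2'' : Row where
  p := 2
  q := 1
  a := ![1, 1]
  b := ![1]
  αα := !![4, -2; -2, 2]
  αβ := !![2; 0]
  ββ := !![2]
  kind := .C2
  minRank := 2
  reps := [(![![2, 0, 0, 0], ![-1, 1, 0, 0]], ![![1, 1, 0, 0]])]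

/-- `2α₁ = β₁ + β₂`, with `β₁`, `β₂` long, generating `C₂`. -/
def rowC2''' : Row where
  p := 1
  q := 2
  a := ![2]
  b := ![1, 1]
  αα := !![2]
  αβ := !![2, 2]
  ββ := !![4, 0; 0, 4]
  kind := .C2
  minRank := 2
  reps := [(![![1, 1, 0, 0]], ![![2, 0, 0, 0], ![0, 2, 0, 0]])]

/-- `α₁ + α₂ = β₁ + β₂`, all short, generating `A₃`. -/
def rowA3 : Row where
  p := 2
  q := 2
  a := ![1, 1]
  b := ![1, 1]
  αα := !![2, 0; 0, 2]
  αβ := !![1, 1; 1, 1]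
  ββ := !![2, 0; 0, 2]
  kind := .A3
  minRank := 4
  reps := [(![![1, 1, 0, 0], ![0, 0, 1, 1]], ![![1, 0, 1, 0], ![0, 1, 0, 1]])]

/-- `α₁ + α₂ = β₁ + β₂`, with `α₂` long, generating `C₃`. -/
def rowC3 : Row where
  p := 2
  q := 2
  a := ![1, 1]
  b := ![1, 1]
  αα := !![2, 0; 0, 4]
  αβ := !![1, 1; 2, 2]
  ββ := !![2, 1; 1, 2]
  kind := .C3
  minRank := 3
  reps := [(![![1, 1, 0, 0], ![0, 0, 2, 0]], ![![1, 0, 1, 0], ![0, 1, 1, 0]])]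

/-- `α₁ + α₂ = β₁ + β₂`, with `β₂` long, generating `C₃`. -/
def rowC3' : Row where
  p := 2
  q := 2
  a := ![1, 1]
  b := ![1, 1]
  αα := !![2, 1; 1, 2]
  αβ := !![1, 2; 1, 2]
  ββ := !![2, 0; 0, 4]
  kind := .C3
  minRank := 3
  reps := [(![![1, 1, 0, 0], ![0, 1, 1, 0]], ![![1, 0, 1, 0], ![0, 2, 0, 0]])]

/-- The rows for `so(2n)`; they occur for `so(2n+1)` as well. -/
def tableD : List Row := [rowA2, rowA3inA4, rowD4, rowD4', rowD3]

/-- The table of all types of minimal relations. -/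
def ClassicalType.table : ClassicalType → List Row
  | B => tableD ++ [rowB2, rowB2', rowB2'', rowB2''', rowB3, rowB3', rowB3'', rowB3''']
  | C => [rowA2, rowC2, rowC2', rowC2'', rowC2''', rowA3, rowC3, rowC3']
  | D => tableD

end ConeRelations

namespace ConeRelations

/-! ### Signed indices and pairs of them -/

/-- The weights `0`, `ε_i`, `-ε_i` of the natural representation. -/
inductive Node (n : ℕ)
  | zero
  | pos (i : Fin n)
  | neg (i : Fin n)
  deriving DecidableEq

namespace Node

variable {n : ℕ}

/-- The weight as a vector. -/
def wt : Node n → Fin n → ℚ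
  | zero => 0
  | pos i => Pi.single i 1
  | neg i => Pi.single i (-1)

/-- The opposite weight. -/
def bar : Node n → Node n
  | zero => zero
  | pos i => neg i
  | neg i => pos i

@[simp] theorem bar_bar (x : Node n) : x.bar.bar = x := by cases x <;> rfl

@[simp] theorem bar_zero : (zero : Node n).bar = zero := rfl

@[simp] theorem wt_zero : (zero : Node n).wt = 0 := rfl

@[simp] theorem wt_bar (x : Node n) : x.bar.wt = -x.wt := by
  cases x <;> simp [bar, wt, Pi.single_neg]

theorem bar_eq_comm {x y : Node n} : x.bar = y ↔ x = y.bar := by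
  constructor <;> rintro rfl <;> simp

@[simp] theorem bar_inj {x y : Node n} : x.bar = y.bar ↔ x = y := by
  rw [bar_eq_comm, bar_bar]

@[simp] theorem bar_eq_zero {x : Node n} : x.bar = zero ↔ x = zero := by
  rw [bar_eq_comm, bar_zero]

theorem bar_ne_self {x : Node n} (h : x ≠ zero) : x.bar ≠ x := by
  cases x <;> simp_all [bar]

/-- The scalar product of two weights. -/
def dot (x y : Node n) : ℚ := x.wt ⬝ᵥ y.wt

theorem dot_comm (x y : Node n) : x.dot y = y.dot x := dotProduct_comm _ _

@[simp] theorem dot_zero (x : Node n) : x.dot zero = 0 := by simp [dot]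

@[simp] theorem zero_dot (x : Node n) : zero.dot x = 0 := by simp [dot]

@[simp] theorem dot_bar (x y : Node n) : x.dot y.bar = -x.dot y := by simp [dot]

@[simp] theorem bar_dot (x y : Node n) : x.bar.dot y = -x.dot y := by simp [dot]

theorem dot_self {x : Node n} (h : x ≠ zero) : x.dot x = 1 := by
  cases x <;> simp_all [dot, wt]

theorem dot_of_ne {x y : Node n} (h : y ≠ x) (h' : y ≠ x.bar) : x.dot y = 0 := by
  rcases x with _ | i | i <;> rcases y with _ | j | j <;>
    simp_all [dot, wt, bar]

theorem dot_nonneg {x y : Node n} (h : y ≠ x.bar) : 0 ≤ x.dot y := by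
  by_cases hx : x = zero
  · simp [hx]
  by_cases hy : y = x
  · rw [hy, dot_self hx]; norm_num
  · rw [dot_of_ne hy h]

theorem dot_nonpos {x y : Node n} (h : y ≠ x) : x.dot y ≤ 0 := by
  have := dot_nonneg (x := x) (y := y.bar) (by simpa using h)
  simpa using this

theorem dot_le_one (x y : Node n) : x.dot y ≤ 1 := by
  by_cases hx : x = zero
  · simp [hx]
  by_cases hy : y = x
  · rw [hy, dot_self hx]
  · linarith [dot_nonpos hy]

/-- This is how weights are detected throughout: a positive product with a sum of weights exhibits
the weight among the summands. -/
theorem eq_of_dot_pos {x y : Node n} (h : 0 < x.dot y) : y = x := by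
  by_contra hne
  exact absurd (dot_nonpos hne) (not_le.2 h)

theorem wt_injective : Function.Injective (wt (n := n)) := by
  intro x y h
  by_cases hx : x = zero
  · subst hx
    by_contra hy
    have := dot_self (Ne.symm hy)
    rw [dot, ← h] at this
    simp at this
  · refine (eq_of_dot_pos ?_).symm
    rw [dot, ← h]
    have := dot_self hx
    rw [dot] at this
    rw [this]; norm_num

/-- The sum of two weights. -/
def pr (x y : Node n) : Fin n → ℚ := x.wt + y.wt

theorem pr_comm (x y : Node n) : x.pr y = y.pr x := add_comm _ _

theorem pr_bar (x y : Node n) : x.bar.pr y.bar = -x.pr y := by simp [pr]; abel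

theorem pr_add_pr (x y z : Node n) : x.pr y + y.bar.pr z = x.pr z := by simp [pr]

theorem wt_dot_pr (x y z : Node n) : x.wt ⬝ᵥ y.pr z = x.dot y + x.dot z := by
  simp [pr, dot]

theorem pr_dot_pr (x y z w : Node n) :
    x.pr y ⬝ᵥ z.pr w = x.dot z + x.dot w + y.dot z + y.dot w := by
  simp [pr, dot]; ring

/-- The product of the sum with a nonzero x is at least 1 when y is not opposite to x, so x is one
of z, w; cancel it. If x = 0, the same applies to y. -/
theorem pr_eq_pr {x y z w : Node n} (hxy : y ≠ x.bar) (h : x.pr y = z.pr w) :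
    (z = x ∧ w = y) ∨ (z = y ∧ w = x) := by
  have key : ∀ {x y : Node n}, x ≠ zero → y ≠ x.bar → x.pr y = z.pr w →
      (z = x ∧ w = y) ∨ (z = y ∧ w = x) := by
    intro x y hx hxy h
    have h1 : x.dot x + x.dot y = x.dot z + x.dot w := by
      rw [← wt_dot_pr, ← wt_dot_pr, h]
    have h2 := dot_nonneg hxy
    have h3 : 0 < x.dot z + x.dot w := by rw [← h1, dot_self hx]; linarith
    have h4 : 0 < x.dot z ∨ 0 < x.dot w := by
      by_contra hcon
      push Not at hcon
      linarith
    rcases h4 with h4 | h4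
    · have := eq_of_dot_pos h4
      subst this
      left
      refine ⟨rfl, wt_injective ?_⟩
      simpa [pr] using h.symm
    · have := eq_of_dot_pos h4
      subst this
      right
      refine ⟨wt_injective ?_, rfl⟩
      rw [pr_comm z] at h
      simpa [pr] using h.symm
  by_cases hx : x = zero
  · have hy : y ≠ zero := by
      rintro rfl
      exact hxy (by simp [hx])
    have hyx : x ≠ y.bar := by rw [hx]; exact fun h => hy (bar_eq_zero.1 h.symm)
    rcases key hy hyx (by rw [pr_comm, h]) with h | h
    · exact Or.inr h
    · exact Or.inl h
  · exact key hx hxy h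

theorem pr_eq_zero {x y : Node n} : x.pr y = 0 ↔ y = x.bar := by
  constructor
  · intro h
    apply wt_injective
    rw [wt_bar]
    exact (neg_eq_of_add_eq_zero_right h).symm
  · rintro rfl
    simp [pr]

/-- Three weights of which no two are opposite do not sum up to a weight. -/
theorem pr_add_wt_ne {x y z w : Node n} (h1 : y ≠ x.bar) (h2 : z ≠ x.bar) (h3 : z ≠ y.bar) :
    x.pr y + z.wt ≠ w.wt := by
  have key : ∀ {x y z : Node n}, x ≠ zero → y ≠ x.bar → z ≠ x.bar → z ≠ y.bar →
      x.pr y + z.wt ≠ w.wt := by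
    intro x y z hx h1 h2 h3 h
    -- The right side is at least 1, which forces w = x; cancelling x makes y and z opposite.
    have h4 : x.dot w = x.dot x + x.dot y + x.dot z := by
      rw [← wt_dot_pr, dot, ← h, dotProduct_add]; rfl
    rw [dot_self hx] at h4
    have h5 := dot_nonneg h1
    have h6 := dot_nonneg h2
    have h7 : w = x := eq_of_dot_pos (by linarith)
    subst h7
    have : y.pr z = 0 := by
      have e : w.wt + y.pr z = w.pr y + z.wt := by simp only [pr]; abel
      rw [h] at e
      simpa using e
    exact h3 (pr_eq_zero.1 this)
  by_cases hx : x = zero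
  · have hy : y ≠ zero := by
      rintro rfl
      exact h1 (by simp [hx])
    rw [pr_comm]
    exact key hy (by rw [hx]; exact fun h => hy (bar_eq_zero.1 h.symm)) h3 h2
  · exact key hx h1 h2 h3

/-- If two pairs sum up to a pair, then they contain opposite weights. -/
theorem exists_bar_of_pr_add_pr {x y z w u v : Node n} (hxy : y ≠ x.bar) (hzw : w ≠ z.bar)
    (h : x.pr y + z.pr w = u.pr v) : z = x.bar ∨ w = x.bar ∨ z = y.bar ∨ w = y.bar := by
  have key : ∀ {x y z w u v : Node n}, x ≠ zero → y ≠ x.bar → w ≠ z.bar →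
      x.pr y + z.pr w = u.pr v → z = x.bar ∨ w = x.bar ∨ z = y.bar ∨ w = y.bar := by
    intro x y z w u v hx hxy hzw h
    by_contra! hcon
    obtain ⟨h1, h2, h3, h4⟩ := hcon
    -- Without opposite weights the right side is at least 1, so x is u or v. Cancelling it leaves
    -- three weights with a weight as their sum.
    have h5 : x.dot u + x.dot v = x.dot x + x.dot y + (x.dot z + x.dot w) := by
      rw [← wt_dot_pr, ← wt_dot_pr, ← wt_dot_pr, ← h, dotProduct_add]
    rw [dot_self hx] at h5
    have h6 := dot_nonneg hxy
    have h7 := dot_nonneg h1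
    have h8 := dot_nonneg h2
    have h9 : 0 < x.dot u ∨ 0 < x.dot v := by
      by_contra hcon
      push Not at hcon
      linarith
    rcases h9 with h9 | h9 <;> have := eq_of_dot_pos h9 <;> subst this
    · refine pr_add_wt_ne (w := v) h3 h4 hzw ?_
      have e : u.wt + (y.pr z + w.wt) = u.pr y + z.pr w := by simp only [pr]; abel
      exact add_left_cancel (e.trans h)
    · refine pr_add_wt_ne (w := u) h3 h4 hzw ?_
      have e : v.wt + (y.pr z + w.wt) = v.pr y + z.pr w := by simp only [pr]; abel
      exact add_left_cancel (e.trans (h.trans (pr_comm u v)))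
  by_cases hx : x = zero
  · have hy : y ≠ zero := by
      rintro rfl
      exact hxy (by simp [hx])
    have := key hy (by rw [hx]; exact fun h => hy (bar_eq_zero.1 h.symm)) hzw
      ((congrArg (· + z.pr w) (pr_comm y x)).trans h)
    tauto
  · exact key hx hxy hzw h

end Node

open Node

/-! ### Admissible pairs of weights -/

namespace ClassicalType

variable {n : ℕ}

/-- The pairs of weights whose sum is a root. -/
def Adm : ClassicalType → Node n → Node n → Prop
  | B, x, y => y ≠ x.bar ∧ x ≠ y
  | C, x, y => y ≠ x.bar ∧ x ≠ zero ∧ y ≠ zero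
  | D, x, y => y ≠ x.bar ∧ x ≠ y ∧ x ≠ zero ∧ y ≠ zero

variable {X : ClassicalType} {x y z w : Node n}

theorem Adm.ne_bar (h : X.Adm x y) : y ≠ x.bar := by
  cases X <;> exact h.1

theorem Adm.symm (h : X.Adm x y) : X.Adm y x := by
  have h' : x ≠ y.bar := fun hx => h.ne_bar (by simp [hx])
  cases X
  · exact ⟨h', h.2.symm⟩
  · exact ⟨h', h.2.2, h.2.1⟩
  · exact ⟨h', h.2.1.symm, h.2.2.2, h.2.2.1⟩

theorem Adm.bar (h : X.Adm x y) : X.Adm x.bar y.bar := by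
  have h' : y.bar ≠ x := fun e => h.ne_bar (by simp [← e])
  cases X <;> simp_all [Adm]

/-- For distinct weights that are not opposite, admissibility only asks that each of them occurs in
some root; the partners y and w serve to rule out 0 in types C and D. -/
theorem Adm.trans (h : X.Adm x y) (h' : X.Adm z w) (h1 : z ≠ x.bar) (h2 : z ≠ x) : X.Adm x z := by
  cases X <;> simp_all [Adm, eq_comm]

/-- One loop forces type C, where every nonzero weight has a loop. -/
theorem Adm.loop (h : X.Adm x x) (h' : X.Adm z w) : X.Adm z z := by
  cases X
  · exact absurd rfl h.2
  · exact ⟨(bar_ne_self h'.2.1).symm, h'.2.1, h'.2.1⟩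
  · exact absurd rfl h.2.1

theorem Adm.not_zero_zero : ¬ X.Adm (zero : Node n) zero := fun h => h.ne_bar rfl

theorem Adm.self_ne_zero (h : X.Adm x x) : x ≠ zero := by
  rintro rfl
  exact Adm.not_zero_zero h

end ClassicalType

end ConeRelations

namespace ConeRelations

open Node

namespace ClassicalType

/-! ### Root vectors -/

/-- The involution of the matrix indices given by the form. -/
def barIdx : (X : ClassicalType) → (n : ℕ) → X.Idx n → X.Idx n
  | B, n => (Sum.map id Sum.swap : Unit ⊕ Fin n ⊕ Fin n → Unit ⊕ Fin n ⊕ Fin n)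
  | C, n => (Sum.swap : Fin n ⊕ Fin n → Fin n ⊕ Fin n)
  | D, n => (Sum.swap : Fin n ⊕ Fin n → Fin n ⊕ Fin n)

/-- The weight of a basis vector of the natural representation. -/
def node : (X : ClassicalType) → (n : ℕ) → X.Idx n → Node n
  | B, n => (Sum.elim (fun _ => .zero) (Sum.elim .pos .neg) : Unit ⊕ Fin n ⊕ Fin n → Node n)
  | C, n => (Sum.elim .pos .neg : Fin n ⊕ Fin n → Node n)
  | D, n => (Sum.elim .pos .neg : Fin n ⊕ Fin n → Node n)

/-- The nonzero entries of the form. -/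
def coeff : (X : ClassicalType) → (n : ℕ) → X.Idx n → ℂ
  | B, n => (Sum.elim (fun _ => 2) (fun _ => 1) : Unit ⊕ Fin n ⊕ Fin n → ℂ)
  | C, n => (Sum.elim (fun _ => -1) (fun _ => 1) : Fin n ⊕ Fin n → ℂ)
  | D, n => (fun _ => 1 : Fin n ⊕ Fin n → ℂ)

/-- The sign of the form. -/
def formSign : ClassicalType → ℂ
  | B => 1
  | C => -1
  | D => 1

section

variable {X : ClassicalType} {n : ℕ}

theorem node_barIdx (a : X.Idx n) : X.node n (X.barIdx n a) = (X.node n a).bar := by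
  cases X
  · rcases a with _ | _ | _ <;> rfl
  · rcases a with _ | _ <;> rfl
  · rcases a with _ | _ <;> rfl

theorem node_injective : Function.Injective (X.node n) := by
  intro a b h
  cases X
  · rcases a with _ | _ | _ <;> rcases b with _ | _ | _ <;> simp_all [node] <;> rfl
  · rcases a with _ | _ <;> rcases b with _ | _ <;> simp_all [node] <;> rfl
  · rcases a with _ | _ <;> rcases b with _ | _ <;> simp_all [node] <;> rfl

@[simp] theorem barIdx_barIdx (a : X.Idx n) : X.barIdx n (X.barIdx n a) = a := by
  apply node_injective
  simp [node_barIdx]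

theorem node_pos (i : Fin n) : X.node n (X.pos n i) = .pos i := by
  cases X <;> rfl

theorem coeff_ne_zero (a : X.Idx n) : X.coeff n a ≠ 0 := by
  cases X
  · rcases a with _ | _ <;> simp [coeff]
  · rcases a with _ | _ <;> simp [coeff]
  · simp [coeff]

theorem coeff_barIdx (a : X.Idx n) : X.coeff n (X.barIdx n a) = X.formSign * X.coeff n a := by
  cases X
  · rcases a with _ | _ | _ <;> simp [coeff, barIdx, formSign]
  · rcases a with _ | _ <;> simp [coeff, barIdx, formSign]
  · simp [coeff, formSign]

theorem formSign_mul_self : X.formSign * X.formSign = 1 := by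
  cases X <;> simp [formSign]

/-- All three forms are monomial matrices supported on the graph of an involution. Skew-adjointness
therefore ties the entries of M together in pairs, which treats the three types uniformly. -/
theorem mem_skewAdjoint_iff {ι : Type} [Fintype ι] [DecidableEq ι] (J : Matrix ι ι ℂ)
    (bar : ι → ι) (hbar : ∀ a, bar (bar a) = a) (s : ι → ℂ)
    (hJ : ∀ a b, J a b = if a = bar b then s a else 0) (M : Matrix ι ι ℂ) :
    M ∈ skewAdjointMatricesLieSubalgebra J ↔
      ∀ a b, s b * M b a = -(s a * M (bar a) (bar b)) := by
  rw [mem_skewAdjointMatricesLieSubalgebra, mem_skewAdjointMatricesSubmodule]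
  change Mᵀ * J = J * (-M) ↔ _
  have h1 : ∀ a b, (Mᵀ * J) a b = s (bar b) * M (bar b) a := by
    intro a b
    simp [Matrix.mul_apply, hJ, mul_comm]
  have h2 : ∀ a b, (J * (-M)) a b = -(s a * M (bar a) b) := by
    intro a b
    have : ∀ c, (a = bar c) ↔ (c = bar a) := fun c =>
      ⟨fun h => by rw [h, hbar], fun h => by rw [h, hbar]⟩
    simp [Matrix.mul_apply, hJ, this]
  constructor
  · intro h a b
    have := congrFun (congrFun h a) (bar b)
    rwa [h1, h2, hbar] at this
  · intro h
    ext a b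
    rw [h1, h2, h, hbar]

theorem mem_algebra_iff (M : Matrix (X.Idx n) (X.Idx n) ℂ) :
    M ∈ X.algebra n ↔
      ∀ a b, X.coeff n b * M b a = -(X.coeff n a * M (X.barIdx n a) (X.barIdx n b)) := by
  cases X
  · refine mem_skewAdjoint_iff (ι := Unit ⊕ Fin n ⊕ Fin n) (LieAlgebra.Orthogonal.JB (Fin n) ℂ)
      (B.barIdx n) (barIdx_barIdx (X := B)) (B.coeff n) ?_ M
    rintro (a | a | a) (b | b | b) <;>
      simp [LieAlgebra.Orthogonal.JB, LieAlgebra.Orthogonal.JD, barIdx, coeff, Matrix.one_apply]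
  · refine mem_skewAdjoint_iff (ι := Fin n ⊕ Fin n) (Matrix.J (Fin n) ℂ)
      (C.barIdx n) (barIdx_barIdx (X := C)) (C.coeff n) ?_ M
    rintro (a | a) (b | b) <;>
      simp [Matrix.J, barIdx, coeff, Matrix.one_apply]
    split_ifs <;> simp
  · refine mem_skewAdjoint_iff (ι := Fin n ⊕ Fin n) (LieAlgebra.Orthogonal.JD (Fin n) ℂ)
      (D.barIdx n) (barIdx_barIdx (X := D)) (D.coeff n) ?_ M
    rintro (a | a) (b | b) <;>
      simp [LieAlgebra.Orthogonal.JD, barIdx, coeff, Matrix.one_apply]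

theorem apply_barIdx (M : X.algebra n) (a b : X.Idx n) :
    X.coeff n b * M.1 b a = -(X.coeff n a * M.1 (X.barIdx n a) (X.barIdx n b)) :=
  (mem_algebra_iff M.1).1 M.2 a b

theorem weight_node (h : X.algebra n) (a : X.Idx n) :
    X.weight n (X.node n a).wt h = h.1 a a := by
  have key : ∀ i, X.weight n (Node.pos i).wt h = h.1 (X.pos n i) (X.pos n i) := by
    intro i
    simp [weight, wt, Pi.single_apply, apply_ite (Rat.cast : ℚ → ℂ)]
  rcases hx : X.node n a with _ | i | i
  · have h1 : X.barIdx n a = a := by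
      apply node_injective
      rw [node_barIdx, hx]; rfl
    have h2 := apply_barIdx h a a
    rw [h1] at h2
    -- The index of weight 0 is fixed by the involution, so its diagonal entry is its own negative.
    have h3 : X.coeff n a * h.1 a a = 0 := by linear_combination h2 / 2
    have h4 := (mul_eq_zero.1 h3).resolve_left (coeff_ne_zero a)
    simp [weight, h4]
  · have h1 : a = X.pos n i := node_injective (by rw [hx, node_pos])
    rw [key, h1]
  · have h1 : X.barIdx n a = X.pos n i := by
      apply node_injective
      rw [node_barIdx, hx, node_pos]; rfl
    have h2 := apply_barIdx h a a
    rw [h1] at h2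
    have h3 := key i
    have h4 : X.weight n (Node.neg i).wt h = -X.weight n (Node.pos i).wt h := by
      rw [show (Node.neg i).wt = -(Node.pos i).wt from wt_bar (Node.pos i)]
      simp [weight]
    rw [h4, h3]
    have h5 : X.coeff n a * (-h.1 (X.pos n i) (X.pos n i) - h.1 a a) = 0 := by
      linear_combination -h2
    linear_combination (mul_eq_zero.1 h5).resolve_left (coeff_ne_zero a)

theorem weight_sub (α β : Fin n → ℚ) (h : X.algebra n) :
    X.weight n (α - β) h = X.weight n α h - X.weight n β h := by
  simp [weight, sub_mul]

/-- The diagonal matrix of the `i`-th coordinates of the weights. -/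
def diagElt (X : ClassicalType) (n : ℕ) (i : Fin n) : X.algebra n :=
  ⟨Matrix.diagonal fun a => (((X.node n a).wt i : ℚ) : ℂ), by
    rw [mem_algebra_iff]
    intro a b
    by_cases hab : a = b
    · subst hab
      simp [node_barIdx]
    · have : X.barIdx n a ≠ X.barIdx n b := fun h => hab (by
        rw [← barIdx_barIdx a, h, barIdx_barIdx])
      rw [Matrix.diagonal_apply_ne _ (Ne.symm hab), Matrix.diagonal_apply_ne _ this]
      simp⟩

theorem diagElt_mem (i : Fin n) : diagElt X n i ∈ X.cartan n :=
  Matrix.isDiag_diagonal _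

theorem bracket_apply_of_isDiag {h : X.algebra n} (hh : h ∈ X.cartan n) (M : X.algebra n)
    (a b : X.Idx n) : (⁅h, M⁆ : X.algebra n).1 b a = (h.1 b b - h.1 a a) * M.1 b a := by
  have h1 : (⁅h, M⁆ : X.algebra n).1 = h.1 * M.1 - M.1 * h.1 := by
    rw [LieSubalgebra.coe_bracket]; rfl
  obtain ⟨d, hd⟩ : ∃ d, h.1 = Matrix.diagonal d :=
    ⟨h.1.diag, ((Matrix.isDiag_iff_diagonal_diag _).1 hh).symm⟩
  rw [h1, hd]
  simp only [Matrix.sub_apply, Matrix.diagonal_mul, Matrix.mul_diagonal, Matrix.diagonal_apply_eq]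
  ring

/-- A diagonal h scales the entry in position (b, a) by the difference of two of its diagonal
entries, which are values of weights. The elements `diagElt` read off the coordinates of α one at a
time. -/
theorem mem_rootSpace_iff (α : Fin n → ℚ) (M : X.algebra n) :
    M ∈ X.rootSpace n α ↔ ∀ a b, M.1 b a ≠ 0 → α = (X.node n b).wt - (X.node n a).wt := by
  constructor
  · intro hM a b hab
    ext i
    have h1 := congrArg (fun N : X.algebra n => N.1 b a) (hM (diagElt X n i) (diagElt_mem i))
    simp only [bracket_apply_of_isDiag (diagElt_mem i)] at h1
    have h2 : X.weight n α (diagElt X n i) = (α i : ℂ) := by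
      simp only [weight, diagElt, Matrix.diagonal_apply_eq, node_pos]
      simp [wt, Pi.single_apply, apply_ite (Rat.cast : ℚ → ℂ)]
    rw [h2] at h1
    have h3 : ((diagElt X n i).1 b b - (diagElt X n i).1 a a - (α i : ℂ)) * M.1 b a = 0 := by
      rw [sub_mul, h1]; simp
    have h4 := (mul_eq_zero.1 h3).resolve_right hab
    simp only [diagElt, Matrix.diagonal_apply_eq] at h4
    have h5 : (((X.node n b).wt i - (X.node n a).wt i - α i : ℚ) : ℂ) = 0 := by
      push_cast; exact h4
    have h6 : (X.node n b).wt i - (X.node n a).wt i - α i = 0 := by exact_mod_cast h5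
    simp only [Pi.sub_apply]
    linarith
  · intro hM h hh
    apply Subtype.ext
    ext b a
    rw [bracket_apply_of_isDiag hh]
    change _ = X.weight n α h * M.1 b a
    by_cases hab : M.1 b a = 0
    · simp [hab]
    · rw [hM a b hab, weight_sub, weight_node, weight_node]

open Classical in
/-- The root vector with an entry in position `(b, a)`. -/
noncomputable def rootVector (X : ClassicalType) (n : ℕ) (b a : X.Idx n) : X.algebra n :=
  ⟨Matrix.of fun i j => (if i = b ∧ j = a then X.coeff n a else 0) -
      if i = X.barIdx n a ∧ j = X.barIdx n b then X.coeff n b else 0, by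
    rw [mem_algebra_iff]
    intro i j
    simp only [Matrix.of_apply]
    have e1 : ∀ x y : X.Idx n, (X.barIdx n x = y) ↔ (x = X.barIdx n y) := fun x y =>
      ⟨fun h => by rw [← h, barIdx_barIdx], fun h => by rw [h, barIdx_barIdx]⟩
    simp only [e1, barIdx_barIdx]
    by_cases h1 : j = b ∧ i = a <;>
      by_cases h2 : j = X.barIdx n a ∧ i = X.barIdx n b
    -- The two positions coincide. Then b is the partner of a, and the coefficients differ by the
    -- sign of the form.
    · rw [if_pos h1, if_pos h2, if_pos ⟨h2.2, h2.1⟩, if_pos ⟨h1.2, h1.1⟩]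
      have h3 : X.coeff n b = X.formSign * X.coeff n a := by
        rw [← coeff_barIdx, ← h2.1, h1.1]
      rw [h1.1, h1.2]
      linear_combination -(X.coeff n b + X.formSign * X.coeff n a) * h3 -
        X.coeff n a ^ 2 * formSign_mul_self (X := X)
    · rw [if_pos h1, if_neg h2, if_neg (fun h => h2 ⟨h.2, h.1⟩), if_pos ⟨h1.2, h1.1⟩]
      rw [h1.1, h1.2]; ring
    · rw [if_neg h1, if_pos h2, if_pos ⟨h2.2, h2.1⟩, if_neg (fun h => h1 ⟨h.2, h.1⟩)]
      rw [h2.1, h2.2, coeff_barIdx, coeff_barIdx]; ring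
    · rw [if_neg h1, if_neg h2, if_neg (fun h => h2 ⟨h.2, h.1⟩),
        if_neg (fun h => h1 ⟨h.2, h.1⟩)]
      ring⟩

open Classical in
theorem rootVector_apply (b a i j : X.Idx n) : (rootVector X n b a).1 i j =
    (if i = b ∧ j = a then X.coeff n a else 0) -
      if i = X.barIdx n a ∧ j = X.barIdx n b then X.coeff n b else 0 := rfl

theorem rootVector_mem (b a : X.Idx n) :
    rootVector X n b a ∈ X.rootSpace n ((X.node n b).wt - (X.node n a).wt) := by
  rw [mem_rootSpace_iff]
  intro j i hij
  rw [rootVector_apply] at hij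
  by_cases h1 : i = b ∧ j = a
  · rw [h1.1, h1.2]
  by_cases h2 : i = X.barIdx n a ∧ j = X.barIdx n b
  · rw [h2.1, h2.2, node_barIdx, node_barIdx, wt_bar, wt_bar]; abel
  · simp [h1, h2] at hij

theorem coeff_of_eq_barIdx {a b : X.Idx n} (h : a = X.barIdx n b) :
    X.coeff n a = X.formSign * X.coeff n b := by rw [h, coeff_barIdx]

theorem eq_barIdx_comm {a b : X.Idx n} : a = X.barIdx n b ↔ b = X.barIdx n a :=
  ⟨fun h => by rw [h, barIdx_barIdx], fun h => by rw [h, barIdx_barIdx]⟩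

open Classical in
theorem rootVector_apply_self (b a : X.Idx n) : (rootVector X n b a).1 b a =
    X.coeff n a * (1 - X.formSign * if b = X.barIdx n a then 1 else 0) := by
  rw [rootVector_apply, if_pos ⟨rfl, rfl⟩]
  by_cases h : b = X.barIdx n a
  · rw [if_pos ⟨h, eq_barIdx_comm.1 h⟩, if_pos h, coeff_of_eq_barIdx h]; ring
  · rw [if_neg (fun h' => h h'.1), if_neg h]; ring

open Classical in
-- In the entry (b, a) only the middle index c contributes to the first product and only its partner
-- to the second. The indicator terms record loops among the three roots.
theorem bracket_rootVector_apply {a b c : X.Idx n} (hbc : b ≠ c) (hca : c ≠ a) :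
    (⁅rootVector X n b c, rootVector X n c a⁆ : X.algebra n).1 b a =
      X.coeff n c * X.coeff n a *
        ((1 - X.formSign * if b = X.barIdx n c then 1 else 0) *
          (1 - X.formSign * if c = X.barIdx n a then 1 else 0) -
          X.formSign * if b = X.barIdx n a then 1 else 0) := by
  have h0 : (⁅rootVector X n b c, rootVector X n c a⁆ : X.algebra n).1 =
      (rootVector X n b c).1 * (rootVector X n c a).1 -
        (rootVector X n c a).1 * (rootVector X n b c).1 := by
    rw [LieSubalgebra.coe_bracket]; rfl
  rw [h0, Matrix.sub_apply, Matrix.mul_apply, Matrix.mul_apply, Finset.sum_eq_single c,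
    Finset.sum_eq_single (X.barIdx n c), rootVector_apply_self, rootVector_apply_self]
  · have h1 : (rootVector X n c a).1 b (X.barIdx n c) =
        -(X.coeff n c * if b = X.barIdx n a then 1 else 0) := by
      rw [rootVector_apply, if_neg (fun h => hbc h.1)]
      simp
    have h2 : (rootVector X n b c).1 (X.barIdx n c) a =
        -(X.coeff n b * if b = X.barIdx n a then 1 else 0) := by
      rw [rootVector_apply, if_neg (fun h => hca h.2.symm)]
      simp [eq_barIdx_comm (a := a)]
    rw [h1, h2]
    by_cases h : b = X.barIdx n a
    · simp only [if_pos h, coeff_of_eq_barIdx h]; ring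
    · simp only [if_neg h]; ring
  · intro k _ hk
    have : (rootVector X n c a).1 b k = 0 := by
      rw [rootVector_apply, if_neg (fun h => hbc h.1), if_neg (fun h => hk h.2), sub_zero]
    rw [this, zero_mul]
  · exact fun h => absurd (Finset.mem_univ _) h
  · intro k _ hk
    have : (rootVector X n b c).1 b k = 0 := by
      rw [rootVector_apply, if_neg (fun h => hk h.2), if_neg, sub_zero]
      rintro ⟨h1, h2⟩
      exact hk (by rw [h2, ← eq_barIdx_comm.1 h1])
    rw [this, zero_mul]
  · exact fun h => absurd (Finset.mem_univ _) h

/-! ### The roots -/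

theorem Adm.exists_idx {x y : Node n} (h : X.Adm x y) : ∃ a, X.node n a = x := by
  rcases x with _ | i | i
  · cases X
    · exact ⟨(Sum.inl () : Unit ⊕ Fin n ⊕ Fin n), rfl⟩
    · exact absurd rfl h.2.1
    · exact absurd rfl h.2.2.1
  · exact ⟨X.pos n i, node_pos i⟩
  · exact ⟨X.barIdx n (X.pos n i), by rw [node_barIdx, node_pos]; rfl⟩

theorem Adm.exists_idx_bar {x y : Node n} (h : X.Adm x y) : ∃ a, X.node n a = y.bar := by
  obtain ⟨a, ha⟩ := h.symm.exists_idx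
  exact ⟨X.barIdx n a, by rw [node_barIdx, ha]⟩

/-- The condition p can hold only at a loop, hence in type C, where the sign is −1. So the loop
terms in the entries of root vectors and brackets reinforce the main term and never cancel it. -/
theorem Adm.formSign_mul {a b : X.Idx n} (h : X.Adm (X.node n b) (X.node n a).bar) {p : Prop}
    [Decidable p] (hp : p → b = X.barIdx n a) :
    X.formSign * (if p then (1 : ℂ) else 0) = -if p then 1 else 0 := by
  by_cases hp' : p
  · rw [if_pos hp']
    have := congrArg (X.node n) (hp hp')
    rw [node_barIdx] at this
    cases X
    · exact absurd this h.2
    · simp [formSign]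
    · exact absurd this h.2.1
  · simp [hp']

/-- Root spaces are one-dimensional: by `pr_eq_pr` only two positions carry a given root, and
skew-adjointness ties their entries together. -/
theorem eq_zero_of_mem_rootSpace {a b : X.Idx n} (h : (X.node n a).bar ≠ (X.node n b).bar)
    {M : X.algebra n} (hM : M ∈ X.rootSpace n ((X.node n b).pr (X.node n a).bar))
    (h0 : M.1 b a = 0) : M = 0 := by
  rw [mem_rootSpace_iff] at hM
  apply Subtype.ext
  ext j i
  by_contra hij
  have h1 := hM i j hij
  have h2 : (X.node n b).pr (X.node n a).bar = (X.node n j).pr (X.node n i).bar := by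
    rw [h1, sub_eq_add_neg, ← wt_bar]; rfl
  rcases pr_eq_pr h h2 with ⟨h3, h4⟩ | ⟨h3, h4⟩
  · rw [bar_inj] at h4
    rw [node_injective h3, node_injective h4] at hij
    exact hij h0
  · have h5 : j = X.barIdx n a := node_injective (by rw [h3, node_barIdx])
    have h6 : i = X.barIdx n b := node_injective (by rw [node_barIdx, ← h4, bar_bar])
    have h7 := apply_barIdx M a b
    rw [h0, mul_zero, ← h5, ← h6] at h7
    have h8 := mul_eq_zero.1 (neg_eq_zero.1 h7.symm)
    exact hij (h8.resolve_left (coeff_ne_zero a))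

/-- A nonzero entry of a root element exhibits the pair. For a symmetric form an entry in a position
exchanged with itself is its own negative, which excludes loops. Conversely `rootVector` has a
nonzero entry. -/
theorem mem_roots_iff (α : Fin n → ℚ) :
    α ∈ X.roots n ↔ ∃ x y, X.Adm x y ∧ α = x.pr y := by
  classical
  constructor
  · rintro ⟨h0, h1⟩
    obtain ⟨M, hM, hM0⟩ := (Submodule.ne_bot_iff _).1 h1
    obtain ⟨b, a, hba⟩ : ∃ b a, M.1 b a ≠ 0 := by
      by_contra! hcon
      exact hM0 (Subtype.ext (by ext b a; exact hcon b a))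
    have h2 := (mem_rootSpace_iff α M).1 hM a b hba
    refine ⟨X.node n b, (X.node n a).bar, ?_, by rw [h2, sub_eq_add_neg, ← wt_bar]; rfl⟩
    have h3 : (X.node n a).bar ≠ (X.node n b).bar := by
      intro h
      rw [bar_inj] at h
      rw [h, sub_self] at h2
      exact h0 h2
    have h4 : X.formSign = 1 → X.node n b ≠ (X.node n a).bar := by
      intro hX h
      rw [← node_barIdx] at h
      have h := node_injective h
      have h5 := apply_barIdx M a b
      rw [← eq_barIdx_comm.1 h, ← h, coeff_of_eq_barIdx h, hX, one_mul] at h5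
      have h6 : X.coeff n a * M.1 b a = 0 := by linear_combination h5 / 2
      exact (mul_ne_zero (coeff_ne_zero a) hba) h6
    have h5 : ∀ a : Fin n ⊕ Fin n, (Sum.elim Node.pos Node.neg a : Node n) ≠ zero := by
      rintro (a | a) <;> simp
    cases X
    · exact ⟨h3, h4 rfl⟩
    · exact ⟨h3, h5 b, fun h => h5 a (bar_eq_zero.1 h)⟩
    · exact ⟨h3, h4 rfl, h5 b, fun h => h5 a (bar_eq_zero.1 h)⟩
  · rintro ⟨x, y, h, rfl⟩
    refine ⟨fun h0 => h.ne_bar (pr_eq_zero.1 h0), ?_⟩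
    obtain ⟨b, hb⟩ := h.exists_idx
    obtain ⟨a, ha⟩ := h.exists_idx_bar
    rw [Submodule.ne_bot_iff]
    have h1 := rootVector_mem (X := X) b a
    rw [hb, ha, wt_bar, sub_neg_eq_add] at h1
    refine ⟨_, h1, fun h2 => ?_⟩
    have h3 := rootVector_apply_self (X := X) b a
    rw [h2, Adm.formSign_mul (by rw [hb, ha, bar_bar]; exact h) id] at h3
    have h4 : (0 : X.algebra n).1 b a = 0 := rfl
    rw [h4] at h3
    refine absurd h3.symm (mul_ne_zero (coeff_ne_zero a) ?_)
    split_ifs <;> norm_num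

theorem pr_mem_roots {x y : Node n} : x.pr y ∈ X.roots n ↔ X.Adm x y := by
  rw [mem_roots_iff]
  constructor
  · rintro ⟨u, v, h, e⟩
    rcases pr_eq_pr h.ne_bar e.symm with ⟨rfl, rfl⟩ | ⟨rfl, rfl⟩
    · exact h
    · exact h.symm
  · exact fun h => ⟨x, y, h, rfl⟩

/-- The normal form for addition of roots: they compose like arrows, with the opposite weights y and
−y cancelling. -/
theorem exists_pr_of_add_mem {α β : Fin n → ℚ} (hα : α ∈ X.roots n) (hβ : β ∈ X.roots n)
    (h : α + β ∈ X.roots n) :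
    ∃ x y z, X.Adm x y ∧ X.Adm y.bar z ∧ X.Adm x z ∧ α = x.pr y ∧ β = y.bar.pr z := by
  obtain ⟨x, y, hxy, rfl⟩ := (mem_roots_iff _).1 hα
  obtain ⟨z, w, hzw, rfl⟩ := (mem_roots_iff _).1 hβ
  obtain ⟨u, v, -, e⟩ := (mem_roots_iff _).1 h
  rcases exists_bar_of_pr_add_pr hxy.ne_bar hzw.ne_bar e with rfl | rfl | rfl | rfl
  · refine ⟨y, x, w, hxy.symm, hzw, ?_, pr_comm _ _, rfl⟩
    rwa [pr_comm x, pr_add_pr, pr_mem_roots] at h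
  · refine ⟨y, x, z, hxy.symm, hzw.symm, ?_, pr_comm _ _, pr_comm _ _⟩
    rwa [pr_comm x, pr_comm z, pr_add_pr, pr_mem_roots] at h
  · refine ⟨x, y, w, hxy, hzw, ?_, rfl, rfl⟩
    rwa [pr_add_pr, pr_mem_roots] at h
  · refine ⟨x, y, z, hxy, hzw.symm, ?_, rfl, pr_comm _ _⟩
    rwa [pr_comm z, pr_add_pr, pr_mem_roots] at h

theorem lie_mem_rootSpace {α β : Fin n → ℚ} {x y : X.algebra n} (hx : x ∈ X.rootSpace n α)
    (hy : y ∈ X.rootSpace n β) : ⁅x, y⁆ ∈ X.rootSpace n (α + β) := by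
  intro h hh
  have : X.weight n (α + β) h = X.weight n α h + X.weight n β h := by
    simp [weight, add_mul, Finset.sum_add_distrib]
  rw [leibniz_lie, hx h hh, hy h hh, this, smul_lie, lie_smul, add_smul]

/-- The bracket of two root vectors is nonzero and the root space of the sum is a line, so the
bracket spans it. All later use of 𝔩 goes through this closedness. -/
theorem add_mem_subRoots {𝔩 : LieSubalgebra ℂ (X.algebra n)} {α β : Fin n → ℚ}
    (hα : α ∈ subRoots 𝔩) (hβ : β ∈ subRoots 𝔩) (h : α + β ∈ X.roots n) :
    α + β ∈ subRoots 𝔩 := by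
  classical
  refine ⟨h, fun M hM => ?_⟩
  obtain ⟨x, y, z, hxy, hyz, hxz, rfl, rfl⟩ := exists_pr_of_add_mem hα.1 hβ.1 h
  obtain ⟨b, rfl⟩ := hxy.exists_idx
  obtain ⟨c, hc⟩ := hxy.exists_idx_bar
  obtain ⟨a, ha⟩ := hyz.exists_idx_bar
  obtain rfl : y = (X.node n c).bar := by rw [hc, bar_bar]
  obtain rfl : z = (X.node n a).bar := by rw [ha, bar_bar]
  rw [bar_bar] at *
  have e : ∀ i j : X.Idx n, (X.node n i).pr (X.node n j).bar = (X.node n i).wt - (X.node n j).wt :=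
    fun i j => by rw [sub_eq_add_neg, ← wt_bar]; rfl
  have ne : ∀ {i j : X.Idx n}, X.Adm (X.node n i) (X.node n j).bar → i ≠ j := by
    rintro i j hij rfl
    exact hij.ne_bar rfl
  have hsum : (X.node n b).pr (X.node n c).bar + (X.node n c).pr (X.node n a).bar =
      (X.node n b).pr (X.node n a).bar := by simp only [e]; abel
  have h1 : rootVector X n b c ∈ X.rootSpace n ((X.node n b).pr (X.node n c).bar) := by
    rw [e]; exact rootVector_mem b c
  have h2 : rootVector X n c a ∈ X.rootSpace n ((X.node n c).pr (X.node n a).bar) := by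
    rw [e]; exact rootVector_mem c a
  have h3 : ⁅rootVector X n b c, rootVector X n c a⁆ ∈ 𝔩 :=
    𝔩.lie_mem (hα.2 h1) (hβ.2 h2)
  have h4 := lie_mem_rootSpace h1 h2
  rw [hsum] at h4 hM
  set Y := ⁅rootVector X n b c, rootVector X n c a⁆ with hY
  -- Up to nonzero coefficients the entry is (1 + i)(1 + j) + k with i, j, k ∈ {0, 1}.
  have h5 : Y.1 b a ≠ 0 := by
    rw [hY, bracket_rootVector_apply (ne hxy) (ne hyz), hxy.formSign_mul id, hyz.formSign_mul id,
      hxz.formSign_mul id]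
    refine mul_ne_zero (mul_ne_zero (coeff_ne_zero c) (coeff_ne_zero a)) ?_
    split_ifs <;> norm_num
  have h6 : M - (M.1 b a / Y.1 b a) • Y = 0 := by
    refine eq_zero_of_mem_rootSpace (fun h => ne hxz (node_injective (bar_inj.1 h)).symm)
      (sub_mem hM (Submodule.smul_mem _ _ h4)) ?_
    change M.1 b a - (M.1 b a / Y.1 b a) * Y.1 b a = 0
    rw [div_mul_cancel₀ _ h5, sub_self]
  rw [sub_eq_zero.1 h6]
  exact 𝔩.smul_mem _ h3

end

end ClassicalType

end ConeRelations

namespace ConeRelations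

open Node ClassicalType

/-! ### Scalar products with sums over multisets -/

section

variable {n : ℕ}

theorem dot_sum_nonneg {v : Fin n → ℚ} {B : Multiset (Fin n → ℚ)} (h : ∀ β ∈ B, 0 ≤ v ⬝ᵥ β) :
    0 ≤ v ⬝ᵥ B.sum := by
  induction B using Multiset.induction_on with
  | empty => simp
  | cons β B ih =>
    rw [Multiset.sum_cons, dotProduct_add]
    exact add_nonneg (h β (Multiset.mem_cons_self _ _))
      (ih fun γ hγ => h γ (Multiset.mem_cons_of_mem hγ))

theorem dot_le_dot_sum {v β : Fin n → ℚ} {B : Multiset (Fin n → ℚ)} (hβ : β ∈ B)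
    (h : ∀ γ ∈ B, 0 ≤ v ⬝ᵥ γ) : v ⬝ᵥ β ≤ v ⬝ᵥ B.sum := by
  obtain ⟨B', rfl⟩ := Multiset.exists_cons_of_mem hβ
  rw [Multiset.sum_cons, dotProduct_add]
  linarith [dot_sum_nonneg fun γ hγ => h γ (Multiset.mem_cons_of_mem hγ)]

theorem exists_dot_pos {v : Fin n → ℚ} {B : Multiset (Fin n → ℚ)} (h : 0 < v ⬝ᵥ B.sum) :
    ∃ β ∈ B, 0 < v ⬝ᵥ β := by
  by_contra! hcon
  have := dot_sum_nonneg (v := -v) (B := B) fun β hβ => by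
    rw [neg_dotProduct]; linarith [hcon β hβ]
  rw [neg_dotProduct] at this
  linarith

theorem exists_dot_neg {v : Fin n → ℚ} {B : Multiset (Fin n → ℚ)} (h : v ⬝ᵥ B.sum < 0) :
    ∃ β ∈ B, v ⬝ᵥ β < 0 := by
  by_contra! hcon
  exact absurd (dot_sum_nonneg hcon) (not_le.2 h)

theorem dot_self_pos {v : Fin n → ℚ} (h : v ≠ 0) : 0 < v ⬝ᵥ v := by
  have h1 : 0 ≤ v ⬝ᵥ v := Finset.sum_nonneg fun i _ => mul_self_nonneg _
  exact lt_of_le_of_ne h1 fun h2 => h (dotProduct_self_eq_zero.1 h2.symm)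

theorem card_mul_le_dot_sum {v : Fin n → ℚ} {B : Multiset (Fin n → ℚ)} {m : ℚ}
    (h : ∀ β ∈ B, m ≤ v ⬝ᵥ β) : B.card * m ≤ v ⬝ᵥ B.sum := by
  induction B using Multiset.induction_on with
  | empty => simp
  | cons β B ih =>
    rw [Multiset.sum_cons, dotProduct_add, Multiset.card_cons]
    have h1 := h β (Multiset.mem_cons_self _ _)
    have h2 := ih fun γ hγ => h γ (Multiset.mem_cons_of_mem hγ)
    push_cast
    linarith

/-- The square of the sum of vectors of square at least `m` that have no negative scalar
products. -/
theorem card_mul_le_sum_dot_sum {B : Multiset (Fin n → ℚ)} {m : ℚ} (h : ∀ β ∈ B, m ≤ β ⬝ᵥ β)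
    (h' : ∀ β γ B', B = β ::ₘ γ ::ₘ B' → 0 ≤ β ⬝ᵥ γ) : B.card * m ≤ B.sum ⬝ᵥ B.sum := by
  refine card_mul_le_dot_sum fun β hβ => ?_
  obtain ⟨B', rfl⟩ := Multiset.exists_cons_of_mem hβ
  rw [dotProduct_comm, Multiset.sum_cons, dotProduct_add]
  have h1 := h β hβ
  have h2 : 0 ≤ β ⬝ᵥ B'.sum := dot_sum_nonneg fun γ hγ => by
    obtain ⟨B'', rfl⟩ := Multiset.exists_cons_of_mem hγ
    exact h' β γ B'' rfl
  linarith

theorem exists_cons_cons {S : Type*} {A : Multiset S} {a b : S} (ha : a ∈ A) (hb : b ∈ A)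
    (h : a ≠ b) : ∃ A', A = a ::ₘ b ::ₘ A' := by
  obtain ⟨A', rfl⟩ := Multiset.exists_cons_of_mem ha
  obtain ⟨A'', rfl⟩ := Multiset.exists_cons_of_mem
    ((Multiset.mem_cons.1 hb).resolve_left (Ne.symm h))
  exact ⟨A'', rfl⟩

end

/-! ### Strings of roots -/

section

variable {X : ClassicalType} {n : ℕ} {α β : Fin n → ℚ}

theorem neg_mem_roots (h : α ∈ X.roots n) : -α ∈ X.roots n := by
  obtain ⟨x, y, hxy, rfl⟩ := (mem_roots_iff _).1 h
  rw [← pr_bar, pr_mem_roots]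
  exact hxy.bar

theorem exists_pr_of_dot_pos {x : Node n} (h : α ∈ X.roots n) (hx : 0 < x.wt ⬝ᵥ α) :
    ∃ y, X.Adm x y ∧ α = x.pr y := by
  obtain ⟨u, v, huv, rfl⟩ := (mem_roots_iff _).1 h
  rw [wt_dot_pr] at hx
  have : 0 < x.dot u ∨ 0 < x.dot v := by
    by_contra hcon
    push Not at hcon
    linarith
  rcases this with h1 | h1 <;> have := eq_of_dot_pos h1 <;> subst this
  · exact ⟨v, huv, rfl⟩
  · exact ⟨u, huv.symm, pr_comm _ _⟩

theorem exists_pr_of_dot_neg {x : Node n} (h : α ∈ X.roots n) (hx : x.wt ⬝ᵥ α < 0) :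
    ∃ y, X.Adm x.bar y ∧ α = x.bar.pr y :=
  exists_pr_of_dot_pos h (by rw [wt_bar, neg_dotProduct]; linarith)

theorem ClassicalType.Adm.wt_dot_pr_pos {x y : Node n} (h : X.Adm x y) (hx : x ≠ zero) :
    0 < x.wt ⬝ᵥ x.pr y := by
  rw [wt_dot_pr, dot_self hx]
  linarith [dot_nonneg h.ne_bar]

/-- The form in which admissibility is used most: when x + z is neither 0 nor a root, the two
weights coincide and have no loop. -/
theorem ClassicalType.Adm.trans' {x y z w : Node n} (h : X.Adm x y) (h' : X.Adm z w)
    (h1 : ¬ X.Adm x z) (h2 : z ≠ x.bar) : z = x := by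
  by_contra h3
  exact h1 (h.trans h' h2 h3)

theorem add_mem_roots_of_dot_neg (hα : α ∈ X.roots n) (hβ : β ∈ X.roots n) (h : α ⬝ᵥ β < 0) :
    α + β ∈ X.roots n ∨ α + β = 0 := by
  obtain ⟨x, y, hxy, rfl⟩ := (mem_roots_iff _).1 hα
  have key : ∀ {x y : Node n}, X.Adm x y → x.pr y ⬝ᵥ β < 0 → x.wt ⬝ᵥ β < 0 →
      x.pr y + β ∈ X.roots n ∨ x.pr y + β = 0 := by
    intro x y hxy h hx
    obtain ⟨z, hz, rfl⟩ := exists_pr_of_dot_neg hβ hx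
    rw [pr_comm x, pr_add_pr, pr_mem_roots]
    by_cases h1 : z = y.bar
    · right; rw [h1]; simp [pr]
    · left
      by_contra h2
      -- The roots are now x + z and −x + z, with product |z|² − |x|². It is negative only for z =
      -- 0, and then their sum vanishes.
      obtain rfl := hxy.symm.trans' hz.symm h2 h1
      rw [pr_dot_pr] at h
      simp only [dot_bar, dot_comm z x] at h
      by_cases hx0 : x = zero
      · subst hx0; simp at h
        rw [dot_self] at h
        · linarith
        · rintro rfl; exact h1 rfl
      · rw [dot_self hx0] at h
        by_cases hz0 : z = zero
        · exact h1 (by simp [hz0])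
        · rw [dot_self hz0] at h; linarith
  have h1 : x.wt ⬝ᵥ β < 0 ∨ y.wt ⬝ᵥ β < 0 := by
    by_contra hcon
    push Not at hcon
    rw [pr, add_dotProduct] at h
    linarith
  rcases h1 with h1 | h1
  · exact key hxy h h1
  · rw [pr_comm] at h ⊢
    exact key hxy.symm h h1

theorem sub_mem_roots_of_dot_pos (hα : α ∈ X.roots n) (hβ : β ∈ X.roots n) (h : 0 < α ⬝ᵥ β) :
    α - β ∈ X.roots n ∨ α = β := by
  rw [← sub_eq_zero (a := α), sub_eq_add_neg]
  exact add_mem_roots_of_dot_neg hα (neg_mem_roots hβ) (by rw [dotProduct_neg]; linarith)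

theorem ne_zero_of_mem_roots (h : α ∈ X.roots n) : α ≠ 0 := h.1

variable (X n) in
-- Here m is a lower bound for the squared lengths, twice which bounds them above. Three or more
-- roots without negative mutual products have a sum of square at least 3m, so the sum is not a
-- root.
theorem exists_norm_bounds :
    ∃ m : ℚ, 0 < m ∧ ∀ α ∈ X.roots n, m ≤ α ⬝ᵥ α ∧ α ⬝ᵥ α ≤ 2 * m := by
  have key : ∀ {x y : Node n}, x.pr y ⬝ᵥ x.pr y = x.dot x + y.dot y + 2 * x.dot y := by
    intro x y
    rw [pr_dot_pr, dot_comm y x]; ring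
  cases X
  · refine ⟨1, one_pos, fun α hα => ?_⟩
    obtain ⟨x, y, hxy, rfl⟩ := (mem_roots_iff _).1 hα
    rw [key, dot_of_ne hxy.2.symm hxy.1]
    by_cases hx : x = zero
    · subst hx
      rw [dot_self (Ne.symm hxy.2)]; simp
    · rw [dot_self hx]
      by_cases hy : y = zero
      · subst hy; simp
      · rw [dot_self hy]; norm_num
  · refine ⟨2, two_pos, fun α hα => ?_⟩
    obtain ⟨x, y, hxy, rfl⟩ := (mem_roots_iff _).1 hα
    rw [key, dot_self hxy.2.1, dot_self hxy.2.2]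
    have h1 := dot_nonneg hxy.1
    have h2 := dot_le_one x y
    constructor <;> linarith
  · refine ⟨2, two_pos, fun α hα => ?_⟩
    obtain ⟨x, y, hxy, rfl⟩ := (mem_roots_iff _).1 hα
    rw [key, dot_of_ne hxy.2.1.symm hxy.1, dot_self hxy.2.2.1, dot_self hxy.2.2.2]
    norm_num

theorem add_self_not_mem_roots (hα : α ∈ X.roots n) : α + α ∉ X.roots n := by
  intro h
  obtain ⟨m, hm, hb⟩ := exists_norm_bounds X n
  have h1 := (hb α hα).1
  have h2 := (hb _ h).2
  simp only [add_dotProduct, dotProduct_add] at h2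
  linarith

/-! ### Roots of a subalgebra -/

variable {𝔩 : LieSubalgebra ℂ (X.algebra n)} {P : Set (Fin n → ℚ)}

/-- Δ(𝔫) is an ideal: if −(α + β) were in Δ(𝔩), adding β would put −α there. -/
theorem nilRoots_add (hα : α ∈ nilRoots 𝔩) (hβ : β ∈ subRoots 𝔩) (h : α + β ∈ X.roots n) :
    α + β ∈ nilRoots 𝔩 := by
  refine ⟨add_mem_subRoots hα.1 hβ h, fun h' => hα.2 ?_⟩
  have e : β + -(α + β) = -α := by abel
  rw [← e]
  exact add_mem_subRoots hβ h' (by rw [e]; exact neg_mem_roots hα.1.1)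

theorem nilRoots_ne_neg (hα : α ∈ nilRoots 𝔩) (hβ : β ∈ nilRoots 𝔩) : α + β ≠ 0 := by
  intro h
  exact hα.2 (by rw [neg_eq_of_add_eq_zero_right h]; exact hβ.1)

/-- In a vanishing sum every β has a negative product with some other member. Their sum is again in
Δ(𝔫), and merging them gives a shorter vanishing sum. -/
theorem sum_nilRoots_ne_zero (B : Multiset (Fin n → ℚ)) (hB : ∀ β ∈ B, β ∈ nilRoots 𝔩)
    (h0 : B ≠ 0) : B.sum ≠ 0 := by
  induction hk : B.card using Nat.strong_induction_on generalizing B with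
  | _ k ih =>
    intro hsum
    obtain ⟨β, hβ⟩ := Multiset.exists_mem_of_ne_zero h0
    obtain ⟨B', rfl⟩ := Multiset.exists_cons_of_mem hβ
    rw [Multiset.sum_cons] at hsum
    have hβN := hB β hβ
    have h1 : β ⬝ᵥ B'.sum < 0 := by
      rw [← neg_eq_of_add_eq_zero_right hsum, dotProduct_neg]
      linarith [dot_self_pos (ne_zero_of_mem_roots hβN.1.1)]
    obtain ⟨γ, hγ, h2⟩ := exists_dot_neg h1
    obtain ⟨B'', rfl⟩ := Multiset.exists_cons_of_mem hγ
    have hγN := hB γ (Multiset.mem_cons_of_mem hγ)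
    have h3 := (add_mem_roots_of_dot_neg hβN.1.1 hγN.1.1 h2).resolve_right
      (nilRoots_ne_neg hβN hγN)
    refine ih _ ?_ ((β + γ) ::ₘ B'') ?_ (Multiset.cons_ne_zero) rfl ?_
    · rw [← hk]; simp
    · intro δ hδ
      rcases Multiset.mem_cons.1 hδ with rfl | hδ
      · exact nilRoots_add hβN hγN.1 h3
      · exact hB δ (by simp [hδ])
    · rw [← hsum]; simp [add_assoc]

/-- Some β in such a sum has positive product with α. Then α − β is a root, still outside Δ(𝔩), and
a sum of fewer roots of Δ(𝔫). This excludes relations of length one. -/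
theorem ne_sum_nilRoots (B : Multiset (Fin n → ℚ)) (hB : ∀ β ∈ B, β ∈ nilRoots 𝔩)
    (hα : α ∈ X.roots n) (hα' : α ∉ subRoots 𝔩) : α ≠ B.sum := by
  induction hk : B.card using Nat.strong_induction_on generalizing B α with
  | _ k ih =>
    intro hsum
    have h1 := dot_self_pos (ne_zero_of_mem_roots hα)
    nth_rw 2 [hsum] at h1
    obtain ⟨β, hβ, h2⟩ := exists_dot_pos h1
    have hβN := hB β hβ
    obtain ⟨B', rfl⟩ := Multiset.exists_cons_of_mem hβ
    have h3 := (sub_mem_roots_of_dot_pos hα hβN.1.1 h2).resolve_right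
      fun h => hα' (h ▸ hβN.1)
    refine ih B'.card (by rw [← hk]; simp) B' (fun γ hγ => hB γ (by simp [hγ])) h3 ?_ rfl ?_
    · intro h
      apply hα'
      have e : α - β + β = α := by abel
      rw [← e]
      exact add_mem_subRoots h hβN.1 (by rwa [e])
    · rw [hsum]; simp

theorem redRoots_neg (hα : α ∈ redRoots 𝔩) : -α ∈ redRoots 𝔩 :=
  ⟨hα.2, by rw [neg_neg]; exact hα.1⟩

theorem nilRoots_not_red (hα : α ∈ nilRoots 𝔩) : α ∉ redRoots 𝔩 := fun h => hα.2 h.2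

theorem red_or_nil (hα : α ∈ subRoots 𝔩) : α ∈ redRoots 𝔩 ∨ α ∈ nilRoots 𝔩 := by
  by_cases h : -α ∈ subRoots 𝔩
  · exact Or.inl ⟨hα, h⟩
  · exact Or.inr ⟨hα, h⟩

theorem singRoots_ne_neg (hα : α ∈ singRoots P 𝔩) (hβ : β ∈ redRoots 𝔩) : α + β ≠ 0 := by
  intro h
  rw [add_eq_zero_iff_eq_neg] at h
  exact hα.2.1 (h ▸ hβ.2)

theorem singRoots_dot_nonneg (hα : α ∈ singRoots P 𝔩) (hβ : β ∈ P ∩ redRoots 𝔩) :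
    0 ≤ α ⬝ᵥ β := by
  by_contra! h
  rcases add_mem_roots_of_dot_neg hα.1 hβ.2.1.1 h with h1 | h1
  · exact hα.2.2 β hβ h1
  · exact singRoots_ne_neg hα hβ.2 h1

/-- A sum of two singular roots that is a root outside of `Δ(𝔩)` is singular. -/
theorem singRoots_add (hα : α ∈ singRoots P 𝔩) (hβ : β ∈ singRoots P 𝔩)
    (h : α + β ∈ X.roots n) (h' : α + β ∉ subRoots 𝔩) : α + β ∈ singRoots P 𝔩 := by
  refine ⟨h, h', fun δ hδ hroot => ?_⟩
  obtain ⟨x, y, z, hxy, hyz, hxz, rfl, rfl⟩ := exists_pr_of_add_mem hα.1 hβ.1 h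
  -- The roots are x + y and −y + z, and δ = −x + w cancels x. Singularity of the first forces w =
  -- y. Then singularity of the second makes z − x a nonroot, so z = −x, or z = x and there would be
  -- a loop at y; both are impossible.
  have key : ∀ {x y z w : Node n}, X.Adm x y → X.Adm y.bar z → X.Adm x z →
      x.pr y ∈ singRoots P 𝔩 → y.bar.pr z ∈ singRoots P 𝔩 → X.Adm x.bar w →
      x.bar.pr w ∈ P ∩ redRoots 𝔩 → False := by
    intro x y z w hxy hyz hxz hα hβ hw hδ
    have h1 := hα.2.2 _ hδ
    rw [pr_comm x, pr_add_pr, pr_mem_roots] at h1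
    have h2 : w ≠ y.bar := by
      rintro rfl
      apply singRoots_ne_neg hα hδ.2
      simp only [pr, wt_bar]; abel
    obtain rfl := hxy.symm.trans' hw.symm h1 h2
    have h3 := hβ.2.2 _ hδ
    have e : w.bar.pr z + x.bar.pr w = z.pr x.bar := by simp only [pr, wt_bar]; abel
    rw [e, pr_mem_roots] at h3
    have h4 := hyz.symm.trans' hw h3 (fun h4 => h1 ?_)
    · exact hxz.ne_bar h4.symm
    · rw [bar_inj] at h4
      subst h4
      exact hxz.loop hxy.symm
  rw [pr_add_pr] at hroot
  have hs : x.pr z ∈ X.roots n := pr_mem_roots.2 hxz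
  obtain ⟨u, v, w, huv, hvw, huw, e, rfl⟩ := exists_pr_of_add_mem hs hδ.2.1.1 hroot
  rcases pr_eq_pr hxz.ne_bar e with ⟨rfl, rfl⟩ | ⟨rfl, rfl⟩
  · refine key hyz.symm (y := y.bar) (z := u) ?_ hxz.symm ?_ ?_ hvw hδ
    · rw [bar_bar]; exact hxy.symm
    · rwa [pr_comm]
    · rwa [bar_bar, pr_comm]
  · exact key hxy hyz hxz hα hβ hvw hδ

end

/-! ### Minimal relations -/

namespace IsMinimalRelation

variable {X : ClassicalType} {n : ℕ} {P : Set (Fin n → ℚ)} {𝔩 : LieSubalgebra ℂ (X.algebra n)}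
  {A B : Multiset (Fin n → ℚ)} {α β β' : Fin n → ℚ} {x y z u w v w₁ w₂ : Node n}

theorem not_mem_right (h : IsMinimalRelation P 𝔩 A B) (hα : α ∈ A) : α ∉ B := fun hα' =>
  (h.isRelation.left_mem _ hα).2.1 (h.isRelation.right_mem _ hα').1

theorem adm_left (h : IsMinimalRelation P 𝔩 A B) (hα : x.pr y ∈ A) : X.Adm x y :=
  pr_mem_roots.1 (h.isRelation.left_mem _ hα).1

theorem adm_right (h : IsMinimalRelation P 𝔩 A B) (hα : x.pr y ∈ B) : X.Adm x y :=
  pr_mem_roots.1 (h.isRelation.right_mem _ hα).1.1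

theorem add_ne_zero_right (h : IsMinimalRelation P 𝔩 A B) (hβ : β ∈ B) (hβ' : β' ∈ B) :
    β + β' ≠ 0 :=
  nilRoots_ne_neg (h.isRelation.right_mem _ hβ) (h.isRelation.right_mem _ hβ')

theorem dot_nonneg_right (h : IsMinimalRelation P 𝔩 A B) (hβ : β ∈ B) (hβ' : β' ∈ B) :
    0 ≤ β ⬝ᵥ β' := by
  by_contra! hneg
  rcases add_mem_roots_of_dot_neg (h.isRelation.right_mem _ hβ).1.1
    (h.isRelation.right_mem _ hβ').1.1 hneg with h1 | h1
  · exact h.add_not_root _ hβ _ hβ' h1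
  · exact h.add_ne_zero_right hβ hβ' h1

/-- Opposite weights occur on the right in pairs `ε_u + ε_y`, `ε_u - ε_y` only. -/
theorem eq_of_bar_right (h : IsMinimalRelation P 𝔩 A B) (hβ : u.pr y ∈ B)
    (hβ' : y.bar.pr z ∈ B) : z = u ∧ ¬ X.Adm u u := by
  have h4 := h.add_not_root _ hβ _ hβ'
  rw [pr_add_pr, pr_mem_roots] at h4
  have h5 : z ≠ u.bar := by
    rintro rfl
    apply h.add_ne_zero_right hβ hβ'
    simp only [pr, wt_bar]; abel
  obtain rfl := (h.adm_right hβ).trans' (h.adm_right hβ').symm h4 h5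
  exact ⟨rfl, h4⟩

/-- The weight y must be balanced: it occurs on the left, or else its opposite occurs on the right,
and then `eq_of_bar_right` identifies the partner as u. -/
theorem exists_left_or_right (h : IsMinimalRelation P 𝔩 A B) (hβ : u.pr y ∈ B) :
    (∃ v, y.pr v ∈ A) ∨ u.pr y.bar ∈ B := by
  have hadm := h.adm_right hβ
  by_cases hy : y = zero
  · right
    rwa [hy, bar_zero, ← hy]
  by_cases hex : ∃ α ∈ A, 0 < y.wt ⬝ᵥ α
  · obtain ⟨α, hα, h1⟩ := hex
    obtain ⟨v, -, rfl⟩ := exists_pr_of_dot_pos (h.isRelation.left_mem α hα).1 h1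
    exact Or.inl ⟨v, hα⟩
  · right
    push Not at hex
    have h1 : 0 ≤ -y.wt ⬝ᵥ B.sum := by
      rw [← h.isRelation.sum_eq]
      refine dot_sum_nonneg fun α hα => ?_
      rw [neg_dotProduct]
      linarith [hex α hα]
    rw [neg_dotProduct] at h1
    obtain ⟨B', hB⟩ := Multiset.exists_cons_of_mem hβ
    have h2 := hadm.symm.wt_dot_pr_pos hy
    rw [hB, Multiset.sum_cons, dotProduct_add, pr_comm] at h1
    obtain ⟨β, hβ', h3⟩ := exists_dot_neg (v := y.wt) (B := B') (by linarith)
    have hβB : β ∈ B := by simp [hB, hβ']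
    obtain ⟨z, hz, rfl⟩ := exists_pr_of_dot_neg (h.isRelation.right_mem β hβB).1.1 h3
    obtain ⟨rfl, -⟩ := h.eq_of_bar_right hβ hβB
    rwa [pr_comm]

/-- The point is to find two separate occurrences in the multiset A. The given ones can be a single
occurrence only if u = y; then the right side has y-coordinate at least 2, and one left root does
not suffice for it. -/
theorem exists_eq_cons_cons (h : IsMinimalRelation P 𝔩 A B) (hβ : u.pr y ∈ B)
    (hα₁ : u.pr w₁ ∈ A) (hα₂ : y.pr w₂ ∈ A) :
    ∃ v₁ v₂ A', A = u.pr v₁ ::ₘ y.pr v₂ ::ₘ A' := by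
  by_cases hne : u.pr w₁ = y.pr w₂
  · have huw := h.adm_left hα₁
    rcases pr_eq_pr huw.ne_bar hne with ⟨rfl, -⟩ | ⟨rfl, -⟩
    · have hyy := h.adm_right hβ
      have hy := hyy.self_ne_zero
      obtain ⟨A', hA⟩ := Multiset.exists_cons_of_mem hα₁
      have hclean : ∀ β ∈ B, 0 ≤ y.wt ⬝ᵥ β := by
        intro β hβ'
        by_contra! hneg
        obtain ⟨z, hz, rfl⟩ := exists_pr_of_dot_neg (h.isRelation.right_mem β hβ').1.1 hneg
        exact (h.eq_of_bar_right hβ hβ').2 hyy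
      have h2 := dot_le_dot_sum hβ hclean
      have h3 : w₁ ≠ y := by
        rintro rfl
        exact h.not_mem_right hα₁ hβ
      rw [← h.isRelation.sum_eq, hA, Multiset.sum_cons, dotProduct_add, wt_dot_pr, wt_dot_pr,
        dot_self hy] at h2
      have h4 := dot_nonpos h3
      obtain ⟨α, hα, h5⟩ := exists_dot_pos (v := y.wt) (B := A') (by linarith)
      obtain ⟨z, -, rfl⟩ := exists_pr_of_dot_pos
        (h.isRelation.left_mem α (by simp [hA, hα])).1 h5
      obtain ⟨A'', rfl⟩ := Multiset.exists_cons_of_mem hα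
      exact ⟨_, _, _, hA⟩
    · exact (h.not_mem_right hα₁ hβ).elim
  · obtain ⟨A', hA⟩ := exists_cons_cons hα₁ hα₂ hne
    exact ⟨_, _, _, hA⟩

end IsMinimalRelation

/-! ### Minimal relations have length at most two -/

/-- A minimal relation of length at least three. -/
structure IsLongRelation {X : ClassicalType} {n : ℕ} (P : Set (Fin n → ℚ))
    (𝔩 : LieSubalgebra ℂ (X.algebra n)) (A B : Multiset (Fin n → ℚ)) : Prop
    extends IsMinimalRelation P 𝔩 A B where
  three_le : 3 ≤ A.card
  positive : IsPositiveSystem (X.roots n) P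

namespace IsLongRelation

variable {X : ClassicalType} {n : ℕ} {P : Set (Fin n → ℚ)} {𝔩 : LieSubalgebra ℂ (X.algebra n)}
  {A B : Multiset (Fin n → ℚ)} {α α' β κ : Fin n → ℚ} {x y z u w v w₁ w₂ : Node n}

theorem not_shorter (h : IsLongRelation P 𝔩 A B) {A' B' : Multiset (Fin n → ℚ)}
    (hA : ∀ α ∈ A', α ∈ singRoots P 𝔩) (hB : ∀ β ∈ B', β ∈ nilRoots 𝔩) (hs : A'.sum = B'.sum)
    (h0 : B' ≠ 0) (hc : A'.card < A.card) : False := by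
  refine absurd (h.length_le A' B' ⟨hA, hB, hs, ?_⟩) (not_le.2 hc)
  rw [hs]
  exact sum_nilRoots_ne_zero B' hB h0

theorem not_two (h : IsLongRelation P 𝔩 A B) (hα : α ∈ A) (hα' : α' ∈ A)
    {B' : Multiset (Fin n → ℚ)} (hB : ∀ β ∈ B', β ∈ nilRoots 𝔩) (hs : α + α' = B'.sum)
    (h0 : B' ≠ 0) : False := by
  refine h.not_shorter (A' := {α, α'}) ?_ hB (by simpa using hs) h0 ?_
  · intro γ hγ
    simp only [Multiset.insert_eq_cons, Multiset.mem_cons, Multiset.mem_singleton] at hγ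
    rcases hγ with rfl | rfl
    · exact h.isRelation.left_mem _ hα
    · exact h.isRelation.left_mem _ hα'
  · have := h.three_le
    simp only [Multiset.insert_eq_cons, Multiset.card_cons, Multiset.card_singleton]
    omega

theorem ne_zero (h : IsLongRelation P 𝔩 A B) : B ≠ 0 := by
  rintro rfl
  exact h.isRelation.sum_ne_zero (by rw [h.isRelation.sum_eq]; rfl)

theorem pos_or_neg (h : IsLongRelation P 𝔩 A B) (hκ : κ ∈ redRoots 𝔩) :
    κ ∈ P ∩ redRoots 𝔩 ∨ -κ ∈ P ∩ redRoots 𝔩 := by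
  obtain ⟨f, hf, rfl⟩ := h.positive
  rcases lt_or_gt_of_ne (hf κ hκ.1.1) with h1 | h1
  · exact Or.inr ⟨⟨hκ.2.1, by rw [map_neg]; linarith⟩, redRoots_neg hκ⟩
  · exact Or.inl ⟨⟨hκ.1.1, h1⟩, hκ⟩

theorem not_pos_and_neg (h : IsLongRelation P 𝔩 A B) (hκ : κ ∈ P) (hκ' : -κ ∈ P) : False := by
  obtain ⟨f, hf, rfl⟩ := h.positive
  have h1 := hκ.2
  have h2 := hκ'.2
  rw [map_neg] at h2
  linarith

/-- If κ is positive, the other left roots have nonnegative product with it and sum up to B₁ − κ. So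
some β in B₁ has positive product with κ, and absorbing −κ into it gives a shorter relation. If −κ
is positive, singularity of α and α' yields β in B₀ with κ·β < 0, and β + κ on the right gives a
relation of length two. -/
theorem not_red (h : IsLongRelation P 𝔩 A B) {A' B₀ B₁ : Multiset (Fin n → ℚ)}
    (hA : A = α ::ₘ α' ::ₘ A') (hB : B = B₀ + B₁) (hB₀ : B₀ = 0 ∨ ∃ β, B₀ = {β})
    (hκ : κ ∈ redRoots 𝔩) (hs : α + α' = B₀.sum + κ) : False := by
  have hA1 := h.isRelation.left_mem
  have hB1 := h.isRelation.right_mem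
  have hAB := h.isRelation.sum_eq
  have hκ0 := dot_self_pos (ne_zero_of_mem_roots hκ.1.1)
  have hsum : A'.sum = B₁.sum - κ := by
    have : α + α' + A'.sum = B₀.sum + B₁.sum := by
      rw [← Multiset.sum_add, ← hB, ← hAB, hA]; simp [add_assoc]
    rw [hs] at this
    have e : A'.sum = (B₀.sum + κ + A'.sum) - B₀.sum - κ := by abel
    rw [e, this]; abel
  have hdot : κ ⬝ᵥ α + κ ⬝ᵥ α' = κ ⬝ᵥ B₀.sum + κ ⬝ᵥ κ := by
    rw [← dotProduct_add, ← dotProduct_add, hs]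
  have hαA : α ∈ A := by simp [hA]
  have hαA' : α' ∈ A := by simp [hA]
  rcases h.pos_or_neg hκ with hpos | hpos
  · have h1 : 0 ≤ κ ⬝ᵥ A'.sum := dot_sum_nonneg fun γ hγ => by
      rw [dotProduct_comm]
      exact singRoots_dot_nonneg (hA1 γ (by simp [hA, hγ])) hpos
    rw [hsum, dotProduct_sub] at h1
    obtain ⟨β, hβ, h2⟩ := exists_dot_pos (v := κ) (B := B₁) (by linarith)
    have hβN := hB1 β (by simp [hB, hβ])
    obtain ⟨B₂, rfl⟩ := Multiset.exists_cons_of_mem hβ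
    have h3 := (sub_mem_roots_of_dot_pos hβN.1.1 hκ.1.1 (by rwa [dotProduct_comm])).resolve_right
      fun h => nilRoots_not_red hβN (h ▸ hκ)
    refine h.not_shorter (A' := A') (B' := (β - κ) ::ₘ B₂) (fun γ hγ => hA1 γ (by simp [hA, hγ]))
      ?_ ?_ Multiset.cons_ne_zero (by simp [hA])
    · intro γ hγ
      rcases Multiset.mem_cons.1 hγ with rfl | hγ
      · rw [sub_eq_add_neg] at h3 ⊢
        exact nilRoots_add hβN hκ.2 h3
      · exact hB1 γ (by simp [hB, hγ])
    · rw [hsum]; simp only [Multiset.sum_cons]; abel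
  · have h1 : 0 ≤ α ⬝ᵥ (-κ) := singRoots_dot_nonneg (hA1 α hαA) hpos
    have h2 : 0 ≤ α' ⬝ᵥ (-κ) := singRoots_dot_nonneg (hA1 α' hαA') hpos
    rw [dotProduct_neg, dotProduct_comm] at h1 h2
    rcases hB₀ with rfl | ⟨β, rfl⟩
    · simp at hdot
      linarith
    · simp only [Multiset.sum_singleton] at hdot hs
      have hβN := hB1 β (by simp [hB])
      have h3 := (add_mem_roots_of_dot_neg hβN.1.1 hκ.1.1
        (by rw [dotProduct_comm]; linarith)).resolve_right fun h => nilRoots_not_red hβN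
          ((eq_neg_of_add_eq_zero_left h) ▸ redRoots_neg hκ)
      refine h.not_two hαA hαA' (B' := {β + κ}) ?_ (by simpa using hs) (by simp)
      intro γ hγ
      rw [Multiset.mem_singleton.1 hγ]
      exact nilRoots_add hβN hκ.1 h3

theorem add_ne_zero (h : IsLongRelation P 𝔩 A B) {A' : Multiset (Fin n → ℚ)}
    (hA : A = α ::ₘ α' ::ₘ A') : α + α' ≠ 0 := by
  intro h0
  refine h.not_shorter (A' := A') (fun γ hγ => h.isRelation.left_mem γ (by simp [hA, hγ]))
    h.isRelation.right_mem ?_ h.ne_zero (by simp [hA])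
  rw [← h.isRelation.sum_eq, hA, Multiset.sum_cons, Multiset.sum_cons, ← add_assoc, h0, zero_add]

/-- A root α + α' could lie in Δ(𝔨), which `not_red` excludes; in Δ(𝔫), which gives a relation of
length two; or outside Δ(𝔩), where it is singular by `singRoots_add` and replaces the two summands.
-/
theorem add_not_mem_roots (h : IsLongRelation P 𝔩 A B) {A' : Multiset (Fin n → ℚ)}
    (hA : A = α ::ₘ α' ::ₘ A') : α + α' ∉ X.roots n := by
  intro hr
  have hα : α ∈ A := by simp [hA]
  have hα' : α' ∈ A := by simp [hA]
  by_cases hL : α + α' ∈ subRoots 𝔩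
  · rcases red_or_nil hL with hK | hN
    · exact h.not_red (B₀ := 0) (B₁ := B) hA (by simp) (Or.inl rfl) hK (by simp)
    · exact h.not_two hα hα' (B' := {α + α'}) (by simpa using hN) (by simp) (by simp)
  · refine h.not_shorter (A' := (α + α') ::ₘ A') ?_ h.isRelation.right_mem ?_ h.ne_zero
      (by simp [hA])
    · intro γ hγ
      rcases Multiset.mem_cons.1 hγ with rfl | hγ
      · exact singRoots_add (h.isRelation.left_mem _ hα) (h.isRelation.left_mem _ hα') hr hL
      · exact h.isRelation.left_mem γ (by simp [hA, hγ])
    · rw [← h.isRelation.sum_eq, hA]; simp [add_assoc]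

/-- No two left roots have a negative product, for their sum would be 0 or a root. Hence the square
of the left side is at least 3m, too long for a root. -/
theorem two_le_card (h : IsLongRelation P 𝔩 A B) : B ≠ {β} := by
  rintro rfl
  obtain ⟨m, hm, hb⟩ := exists_norm_bounds X n
  have h1 : A.card * m ≤ A.sum ⬝ᵥ A.sum := by
    refine card_mul_le_sum_dot_sum (fun α hα => (hb α (h.isRelation.left_mem α hα).1).1) ?_
    intro α α' A' hA
    by_contra! hneg
    rcases add_mem_roots_of_dot_neg (h.isRelation.left_mem α (by simp [hA])).1
      (h.isRelation.left_mem α' (by simp [hA])).1 hneg with h2 | h2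
    · exact h.add_not_mem_roots hA h2
    · exact h.add_ne_zero hA h2
  rw [h.isRelation.sum_eq, Multiset.sum_singleton] at h1
  have h2 := (hb β (h.isRelation.right_mem β (by simp)).1.1).2
  have h3 : (3 : ℚ) ≤ A.card := by exact_mod_cast h.three_le
  nlinarith

/-- Adding the given root of 𝔟 ∩ 𝔨 to the singular root u + w₁ would give u + r; as this is not a
root, r = u. -/
theorem pr_step_of_not_sing (hu : u.pr w₁ ∈ singRoots P 𝔩) {r : Node n}
    (hr : X.Adm w₁.bar r) (hδ : w₁.bar.pr r ∈ P ∩ redRoots 𝔩) :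
    u.pr w₁.bar ∈ P ∩ redRoots 𝔩 := by
  have h1 := hu.2.2 _ hδ
  rw [pr_add_pr, pr_mem_roots] at h1
  have h2 : r ≠ u.bar := by
    rintro rfl
    apply singRoots_ne_neg hu hδ.2
    simp only [pr, wt_bar]; abel
  obtain rfl := (pr_mem_roots.1 hu.1).trans' hr.symm h1 h2
  rwa [pr_comm]

/-- The exchange step: the two left roots sum up to (u + y) + (w₁ + w₂). If w₁ + w₂ is zero, in
Δ(𝔨), in Δ(𝔫) or singular, a shorter relation results. Otherwise it is a nonsingular root, whose
witness in 𝔟 ∩ 𝔨 gives the last two alternatives, or no root at all. -/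
theorem pr_cases (h : IsLongRelation P 𝔩 A B) {A' : Multiset (Fin n → ℚ)} (hβ : u.pr y ∈ B)
    (hA : A = u.pr w₁ ::ₘ y.pr w₂ ::ₘ A') :
    (w₁ = w₂ ∧ ¬ X.Adm w₁ w₁) ∨ u.pr w₁.bar ∈ P ∩ redRoots 𝔩 ∨
      y.pr w₂.bar ∈ P ∩ redRoots 𝔩 := by
  have hα₁ : u.pr w₁ ∈ A := by simp [hA]
  have hα₂ : y.pr w₂ ∈ A := by simp [hA]
  have hN := h.isRelation.right_mem _ hβ
  have hsum : u.pr w₁ + y.pr w₂ = u.pr y + w₁.pr w₂ := by simp only [pr]; abel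
  obtain ⟨B', hB⟩ := Multiset.exists_cons_of_mem hβ
  by_cases hbar : w₂ = w₁.bar
  · exfalso
    refine h.not_two hα₁ hα₂ (B' := {u.pr y}) (by simpa using hN) ?_ (by simp)
    rw [hsum, hbar, pr_eq_zero.2 rfl]; simp
  by_cases hadm : X.Adm w₁ w₂
  · have hr : w₁.pr w₂ ∈ X.roots n := pr_mem_roots.2 hadm
    by_cases hL : w₁.pr w₂ ∈ subRoots 𝔩
    · exfalso
      rcases red_or_nil hL with hK | hN'
      · exact h.not_red (B₀ := {u.pr y}) (B₁ := B') hA hB (Or.inr ⟨_, rfl⟩) hK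
          (by simpa using hsum)
      · refine h.not_two hα₁ hα₂ (B' := {u.pr y, w₁.pr w₂}) ?_ (by simpa using hsum) (by simp)
        simp only [Multiset.insert_eq_cons, Multiset.mem_cons, Multiset.mem_singleton]
        rintro γ (rfl | rfl)
        · exact hN
        · exact hN'
    · by_cases hS : w₁.pr w₂ ∈ singRoots P 𝔩
      · exfalso
        refine h.not_shorter (A' := w₁.pr w₂ ::ₘ A') (B' := B') ?_ ?_ ?_ ?_ (by simp [hA])
        · intro γ hγ
          rcases Multiset.mem_cons.1 hγ with rfl | hγ
          · exact hS
          · exact h.isRelation.left_mem γ (by simp [hA, hγ])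
        · exact fun γ hγ => h.isRelation.right_mem γ (by simp [hB, hγ])
        · have e := h.isRelation.sum_eq
          rw [hA, hB] at e
          simp only [Multiset.sum_cons] at e ⊢
          rw [← add_assoc, hsum, add_assoc] at e
          exact add_left_cancel e
        -- Cancelling u + y must leave something on the right, which is why one-element right sides
        -- were excluded.
        · rintro rfl
          exact h.two_le_card hB
      · have hex : ∃ δ ∈ P ∩ redRoots 𝔩, w₁.pr w₂ + δ ∈ X.roots n := by
          by_contra! hcon
          exact hS ⟨hr, hL, hcon⟩
        obtain ⟨δ, hδ, hδr⟩ := hex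
        obtain ⟨p, q, r, hpq, hqr, hpr, e, rfl⟩ := exists_pr_of_add_mem hr hδ.2.1.1 hδr
        right
        rcases pr_eq_pr hadm.ne_bar e with ⟨rfl, rfl⟩ | ⟨rfl, rfl⟩
        · exact Or.inr (pr_step_of_not_sing (h.isRelation.left_mem _ hα₂) hqr hδ)
        · exact Or.inl (pr_step_of_not_sing (h.isRelation.left_mem _ hα₁) hqr hδ)
  · left
    obtain rfl : w₂ = w₁ :=
      (h.adm_left hα₁).symm.trans' (h.adm_left hα₂).symm hadm hbar
    exact ⟨rfl, hadm⟩

theorem exists_left_or_nil (h : IsLongRelation P 𝔩 A B) (hβ : u.pr y ∈ B) :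
    (∃ v, y.pr v ∈ A) ∨ u.pr y.bar ∈ nilRoots 𝔩 :=
  (h.exists_left_or_right hβ).imp_right (h.isRelation.right_mem _)

/-- Suppose δ = u − w is positive in Δ(𝔨). Singularity of u + w excludes loops, and −w does not
occur on the left, so some w + y lies on the right and u + y = (w + y) + δ is in Δ(𝔫). If w − y is
in Δ(𝔫), then u + w = (u + y) + (w − y) is in Δ(𝔩), which is absurd. Otherwise some y + v is on the
left; `pr_cases` leaves y − v in Δ(𝔨), and (w + u) + (y + v) = (w + y) + (u + v) is a relation of
length two, the last term being 0 or in Δ(𝔫). -/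
theorem not_pos_red (h : IsLongRelation P 𝔩 A B) (hα : u.pr w ∈ A) :
    u.pr w.bar ∉ P ∩ redRoots 𝔩 := by
  intro hδ
  have hαS := h.isRelation.left_mem _ hα
  have huw := h.adm_left hα
  have hloop : ¬ X.Adm u u := by
    have := hαS.2.2 _ hδ
    have e : u.pr w + u.pr w.bar = u.pr u := by simp only [pr, wt_bar]; abel
    rwa [e, pr_mem_roots] at this
  have hw : w ≠ zero := by
    rintro rfl
    exact hαS.2.1 hδ.2.1
  have hclean : ∀ α ∈ A, 0 ≤ w.wt ⬝ᵥ α := by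
    intro α hα'
    by_contra! hneg
    have hpos := huw.symm.wt_dot_pr_pos hw
    rw [pr_comm] at hpos
    have hne : u.pr w ≠ α := by
      rintro rfl
      linarith
    obtain ⟨A', hA⟩ := exists_cons_cons hα hα' hne
    obtain ⟨z, hz, rfl⟩ := exists_pr_of_dot_neg (h.isRelation.left_mem α hα').1 hneg
    have h1 := h.add_ne_zero hA
    have h2 := h.add_not_mem_roots hA
    rw [pr_add_pr] at h1 h2
    rw [pr_mem_roots] at h2
    obtain rfl := huw.trans' hz.symm h2 fun e => h1 (pr_eq_zero.2 e)
    rw [pr_comm] at hα'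
    exact (h.isRelation.left_mem _ hα').2.1 hδ.2.1
  have h1 : 0 < w.wt ⬝ᵥ B.sum := by
    rw [← h.isRelation.sum_eq]
    refine lt_of_lt_of_le (huw.symm.wt_dot_pr_pos hw) ?_
    rw [pr_comm]
    exact dot_le_dot_sum hα hclean
  obtain ⟨β, hβ, h2⟩ := exists_dot_pos h1
  have hβN := h.isRelation.right_mem β hβ
  obtain ⟨y, hwy, rfl⟩ := exists_pr_of_dot_pos hβN.1.1 h2
  have hyu : y ≠ u := by
    rintro rfl
    rw [pr_comm] at hβ
    exact h.not_mem_right hα hβ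
  have hyu' : y ≠ u.bar := by
    rintro rfl
    apply nilRoots_not_red hβN
    have := redRoots_neg hδ.2
    rwa [← pr_bar, bar_bar, pr_comm] at this
  have huy : X.Adm u y := huw.trans hwy.symm hyu' hyu
  have hLuy : u.pr y ∈ nilRoots 𝔩 := by
    have e : w.pr y + u.pr w.bar = u.pr y := by simp only [pr, wt_bar]; abel
    rw [← e]
    exact nilRoots_add hβN hδ.2.1 (by rw [e]; exact pr_mem_roots.2 huy)
  rcases h.exists_left_or_nil hβ with ⟨v, hv⟩ | hnil
  · have hyv := h.adm_left hv
    have hne : w.pr u ≠ y.pr v := by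
      intro e
      rcases pr_eq_pr huw.symm.ne_bar e with ⟨h3, -⟩ | ⟨h3, -⟩
      · rw [h3] at hwy
        exact hloop (hwy.loop huw)
      · exact hyu h3
    have hα' : w.pr u ∈ A := by rwa [pr_comm]
    obtain ⟨A', hA⟩ := exists_cons_cons hα' hv hne
    have huv : u ≠ v := by
      rintro rfl
      rw [pr_comm] at hv
      exact (h.isRelation.left_mem _ hv).2.1 hLuy.1
    rcases h.pr_cases hβ hA with h3 | h3 | h3
    · exact huv h3.1
    · refine h.not_pos_and_neg hδ.1 ?_
      rw [← pr_bar, bar_bar, pr_comm]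
      exact h3.1
    · have hsum : w.pr u + y.pr v = w.pr y + u.pr v := by simp only [pr]; abel
      by_cases hvu : v = u.bar
      · refine h.not_two hα' hv (B' := {w.pr y}) (by simpa using hβN) ?_ (by simp)
        rw [hsum, hvu, pr_eq_zero.2 rfl]; simp
      · have hadm : X.Adm u v := huw.trans hyv.symm hvu (Ne.symm huv)
        have hN : u.pr v ∈ nilRoots 𝔩 := by
          have e : u.pr y + -y.pr v.bar = u.pr v := by simp only [pr, wt_bar]; abel
          rw [← e]
          exact nilRoots_add hLuy h3.2.2 (by rw [e]; exact pr_mem_roots.2 hadm)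
        refine h.not_two hα' hv (B' := {w.pr y, u.pr v}) ?_ (by simpa using hsum) (by simp)
        simp only [Multiset.insert_eq_cons, Multiset.mem_cons, Multiset.mem_singleton]
        rintro γ (rfl | rfl)
        · exact hβN
        · exact hN
  · apply hαS.2.1
    have e : u.pr y + w.pr y.bar = u.pr w := by simp only [pr, wt_bar]; abel
    rw [← e]
    exact add_mem_subRoots hLuy.1 hnil.1 (by rw [e]; exact hαS.1)

theorem eq_of_pr (h : IsLongRelation P 𝔩 A B) {A' : Multiset (Fin n → ℚ)} (hβ : u.pr y ∈ B)
    (hA : A = u.pr w₁ ::ₘ y.pr w₂ ::ₘ A') : w₁ = w₂ ∧ ¬ X.Adm w₁ w₁ := by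
  rcases h.pr_cases hβ hA with h1 | h1 | h1
  · exact h1
  · exact absurd h1 (h.not_pos_red (by simp [hA]))
  · exact absurd h1 (h.not_pos_red (by simp [hA]))

/-- A left root −u + z sums up with each of x + u and −x + u to neither 0 nor a root, so z would be
both x and −x. -/
theorem dot_nonneg_left_of (h : IsLongRelation P 𝔩 A B) (hα : x.pr u ∈ A)
    (hα' : x.bar.pr u ∈ A) (hx : x ≠ zero) (hα'' : α ∈ A) : 0 ≤ u.wt ⬝ᵥ α := by
  have hxu := h.adm_left hα
  have hxu' := h.adm_left hα'
  by_contra! hneg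
  have hu : u ≠ zero := by
    rintro rfl
    simp at hneg
  obtain ⟨z, hz, rfl⟩ := exists_pr_of_dot_neg (h.isRelation.left_mem α hα'').1 hneg
  have key : ∀ {x}, X.Adm x u → x.pr u ∈ A → z = x := by
    intro x hxu hα
    have hpos := hxu.symm.wt_dot_pr_pos hu
    have hne : x.pr u ≠ u.bar.pr z := by
      intro e
      rw [pr_comm u, e] at hpos
      linarith
    obtain ⟨A', hA⟩ := exists_cons_cons hα hα'' hne
    have h1 := h.add_ne_zero hA
    have h2 := h.add_not_mem_roots hA
    rw [pr_add_pr] at h1 h2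
    rw [pr_mem_roots] at h2
    exact hxu.trans' hz.symm h2 fun e => h1 (pr_eq_zero.2 e)
  have h1 := key hxu hα
  have h2 := key hxu' hα'
  exact bar_ne_self hx (h2.symm.trans h1)

/-- Opposite nonzero weights x, −x on the left must come with the same partner z. Then z occurs
positively on the right, in some z + u. If u occurs on the left, in u + v, exchange forces v = x and
v = −x. If not, (z + x) + (z − x) = (z + u) + (z − u) is a relation of length two. -/
theorem dot_nonneg_left (h : IsLongRelation P 𝔩 A B) (hα : x.pr y ∈ A) (hα' : α ∈ A) :
    0 ≤ x.wt ⬝ᵥ α := by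
  by_cases hx : x = zero
  · simp [hx]
  have hxy := h.adm_left hα
  by_contra! hneg
  have hpos := hxy.wt_dot_pr_pos hx
  obtain ⟨z, hz, rfl⟩ := exists_pr_of_dot_neg (h.isRelation.left_mem α hα').1 hneg
  have hne : y.pr x ≠ x.bar.pr z := by
    intro e
    rw [pr_comm, e] at hpos
    linarith
  obtain ⟨A', hA⟩ := exists_cons_cons (by rwa [pr_comm]) hα' hne
  have h1 := h.add_ne_zero hA
  have h2 := h.add_not_mem_roots hA
  rw [pr_add_pr] at h1 h2
  rw [pr_mem_roots] at h2
  obtain rfl := hxy.symm.trans' hz.symm h2 fun e => h1 (pr_eq_zero.2 e)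
  have hz0 : z ≠ zero := by
    rintro rfl
    exact h1 (by simp [pr])
  have h3 : 0 < z.wt ⬝ᵥ B.sum := by
    rw [← h.isRelation.sum_eq]
    refine lt_of_lt_of_le (hxy.symm.wt_dot_pr_pos hz0) ?_
    rw [pr_comm]
    exact dot_le_dot_sum hα fun α hα'' => h.dot_nonneg_left_of hα hα' hx hα''
  obtain ⟨β, hβ, h4⟩ := exists_dot_pos h3
  have hβN := h.isRelation.right_mem β hβ
  obtain ⟨u, hzu, rfl⟩ := exists_pr_of_dot_pos hβN.1.1 h4
  rcases h.exists_left_or_nil hβ with ⟨v, hv⟩ | hnil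
  · have key : ∀ {x}, X.Adm z x → z.pr x ∈ A → x = v := by
      intro x hzx hx
      have hne : z.pr x ≠ u.pr v := by
        intro e
        rcases pr_eq_pr hzx.ne_bar e with ⟨rfl, -⟩ | ⟨rfl, -⟩
        · exact h2 hzu
        · exact h.not_mem_right hx hβ
      obtain ⟨A', hA⟩ := exists_cons_cons hx hv hne
      exact (h.eq_of_pr hβ hA).1
    have h5 := key hxy.symm (by rwa [pr_comm])
    have h6 := key hz.symm (by rwa [pr_comm])
    exact bar_ne_self hx (h6.trans h5.symm)
  · refine h.not_two hα hα' (B' := {z.pr u, z.pr u.bar}) ?_ ?_ (by simp)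
    · simp only [Multiset.insert_eq_cons, Multiset.mem_cons, Multiset.mem_singleton]
      rintro γ (rfl | rfl)
      · exact hβN
      · exact hnil
    · simp only [Multiset.insert_eq_cons, Multiset.sum_cons, Multiset.sum_singleton, pr, wt_bar]
      abel

theorem exists_right (h : IsLongRelation P 𝔩 A B) (hα : x.pr y ∈ A) (hx : x ≠ zero) :
    ∃ z, X.Adm x z ∧ x.pr z ∈ B := by
  have h3 : 0 < x.wt ⬝ᵥ B.sum := by
    rw [← h.isRelation.sum_eq]
    refine lt_of_lt_of_le ((h.adm_left hα).wt_dot_pr_pos hx) ?_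
    exact dot_le_dot_sum hα fun α hα' => h.dot_nonneg_left hα hα'
  obtain ⟨β, hβ, h4⟩ := exists_dot_pos h3
  obtain ⟨z, hz, rfl⟩ := exists_pr_of_dot_pos (h.isRelation.right_mem β hβ).1.1 h4
  exact ⟨z, hz, hβ⟩

/-- By exchange the left roots are u + w and y + w. For w = 0 they sum up to u + y. Otherwise some w
+ z is on the right. If z is on the left, its partner is u, and (y + w) + (z + u) = (u + y) + (w +
z); if not, w − z is in Δ(𝔫) and u + y, w + z, w − z sum up to the two left roots. -/
theorem not_both_cons (h : IsLongRelation P 𝔩 A B) {A' : Multiset (Fin n → ℚ)}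
    (hβ : u.pr y ∈ B) (hA : A = u.pr w₁ ::ₘ y.pr w₂ ::ₘ A') : False := by
  obtain ⟨rfl, hloop⟩ := h.eq_of_pr hβ hA
  have hα₁ : u.pr w₁ ∈ A := by simp [hA]
  have hα₂ : y.pr w₁ ∈ A := by simp [hA]
  have huw := h.adm_left hα₁
  have hβN := h.isRelation.right_mem _ hβ
  by_cases hw : w₁ = zero
  · refine h.not_two hα₁ hα₂ (B' := {u.pr y}) (by simpa using hβN) ?_ (by simp)
    simp [hw, pr]
  obtain ⟨z, hz, hβ'⟩ := h.exists_right (by rwa [pr_comm] at hα₁) hw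
  have hβN' := h.isRelation.right_mem _ hβ'
  rcases h.exists_left_or_nil hβ' with ⟨v, hv⟩ | hnil
  · have hne : w₁.pr u ≠ z.pr v := by
      intro e
      rcases pr_eq_pr huw.symm.ne_bar e with ⟨rfl, -⟩ | ⟨rfl, -⟩
      · exact hloop hz
      · rw [pr_comm] at hα₁
        exact h.not_mem_right hα₁ hβ'
    obtain ⟨A'', hA'⟩ := exists_cons_cons (by rwa [pr_comm]) hv hne
    obtain ⟨rfl, -⟩ := h.eq_of_pr hβ' hA'
    refine h.not_two hα₂ hv (B' := {u.pr y, w₁.pr z}) ?_ ?_ (by simp)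
    · simp only [Multiset.insert_eq_cons, Multiset.mem_cons, Multiset.mem_singleton]
      rintro γ (rfl | rfl)
      · exact hβN
      · exact hβN'
    · simp only [Multiset.insert_eq_cons, Multiset.sum_cons, Multiset.sum_singleton, pr]
      abel
  · refine h.not_two hα₁ hα₂ (B' := {u.pr y, w₁.pr z, w₁.pr z.bar}) ?_ ?_ (by simp)
    · simp only [Multiset.insert_eq_cons, Multiset.mem_cons, Multiset.mem_singleton]
      rintro γ (rfl | rfl | rfl)
      · exact hβN
      · exact hβN'
      · exact hnil
    · simp only [Multiset.insert_eq_cons, Multiset.sum_cons, Multiset.sum_singleton, pr, wt_bar]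
      abel

theorem not_both (h : IsLongRelation P 𝔩 A B) (hβ : u.pr y ∈ B) (hα₁ : u.pr w₁ ∈ A)
    (hα₂ : y.pr w₂ ∈ A) : False := by
  obtain ⟨v₁, v₂, A', hA⟩ := h.exists_eq_cons_cons hβ hα₁ hα₂
  exact h.not_both_cons hβ hA

/-- A nonzero x occurs on the right in some x + z. Since z is then absent from the left, x − z is in
Δ(𝔫) as well. -/
theorem exists_double (h : IsLongRelation P 𝔩 A B) (hα : x.pr y ∈ A) :
    ∃ B' : Multiset (Fin n → ℚ), (∀ β ∈ B', β ∈ nilRoots 𝔩) ∧ B'.sum = x.wt + x.wt := by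
  by_cases hx : x = zero
  · exact ⟨0, by simp, by simp [hx]⟩
  obtain ⟨z, hz, hβ⟩ := h.exists_right hα hx
  rcases h.exists_left_or_nil hβ with ⟨v, hv⟩ | hnil
  · exact (h.not_both hβ hα hv).elim
  · refine ⟨{x.pr z, x.pr z.bar}, ?_, ?_⟩
    · simp only [Multiset.insert_eq_cons, Multiset.mem_cons, Multiset.mem_singleton]
      rintro γ (rfl | rfl)
      · exact h.isRelation.right_mem _ hβ
      · exact hnil
    · simp only [Multiset.insert_eq_cons, Multiset.sum_cons, Multiset.sum_singleton, pr, wt_bar]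
      abel

/-- For x + y on the left, 2x and 2y are both sums of roots of Δ(𝔫), so twice x + y gives a relation
of length two. -/
theorem false (h : IsLongRelation P 𝔩 A B) : False := by
  have hA : A ≠ 0 := by
    rintro rfl
    exact h.isRelation.sum_ne_zero rfl
  obtain ⟨α, hα⟩ := Multiset.exists_mem_of_ne_zero hA
  obtain ⟨x, y, hxy, rfl⟩ := (mem_roots_iff _).1 (h.isRelation.left_mem α hα).1
  obtain ⟨B₁, h1, e1⟩ := h.exists_double hα
  obtain ⟨B₂, h2, e2⟩ := h.exists_double (by rwa [pr_comm] at hα)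
  have hs : x.pr y + x.pr y = (B₁ + B₂).sum := by
    rw [Multiset.sum_add, e1, e2]; simp only [pr]; abel
  refine h.not_two hα hα (B' := B₁ + B₂) ?_ hs ?_
  · intro β hβ
    rcases Multiset.mem_add.1 hβ with hβ | hβ
    · exact h1 β hβ
    · exact h2 β hβ
  · intro h0
    rw [h0, Multiset.sum_zero, ← two_nsmul] at hs
    exact (h.isRelation.left_mem _ hα).1.1 ((smul_eq_zero.1 hs).resolve_left (by norm_num))

end IsLongRelation

section

variable {X : ClassicalType} {n : ℕ} {P : Set (Fin n → ℚ)} {𝔩 : LieSubalgebra ℂ (X.algebra n)}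

theorem IsMinimalRelation.card_eq_two (hP : IsPositiveSystem (X.roots n) P)
    {A B : Multiset (Fin n → ℚ)} (h : IsMinimalRelation P 𝔩 A B) : A.card = 2 := by
  by_contra hcard
  have h0 : A.card ≠ 0 := by
    intro h0
    rw [Multiset.card_eq_zero.1 h0] at h
    exact h.isRelation.sum_ne_zero rfl
  have h1 : A.card ≠ 1 := by
    intro h1
    obtain ⟨α, rfl⟩ := Multiset.card_eq_one.1 h1
    have hα := h.isRelation.left_mem α (by simp)
    refine ne_sum_nilRoots B h.isRelation.right_mem hα.1 hα.2.1 ?_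
    simpa using h.isRelation.sum_eq
  exact IsLongRelation.false (P := P) (𝔩 := 𝔩) (A := A) (B := B) ⟨h, by omega, hP⟩

/-! ### Existence of minimal relations -/

theorem exists_nsmul_eq_sum {S : Set (Fin n → ℚ)} {v : Fin n → ℚ}
    (hv : v ∈ PointedCone.hull ℚ S) :
    ∃ k : ℕ, 0 < k ∧ ∃ B : Multiset (Fin n → ℚ), (∀ β ∈ B, β ∈ S) ∧ k • v = B.sum := by
  induction hv using Submodule.span_induction with
  | mem x hx => exact ⟨1, one_pos, {x}, by simpa using hx, by simp⟩
  | zero => exact ⟨1, one_pos, 0, by simp, by simp⟩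
  | add x y _ _ hx hy =>
    obtain ⟨k, hk, B, hB, e⟩ := hx
    obtain ⟨k', hk', B', hB', e'⟩ := hy
    refine ⟨k * k', Nat.mul_pos hk hk', k' • B + k • B', ?_, ?_⟩
    · intro β hβ
      rcases Multiset.mem_add.1 hβ with hβ | hβ
      · exact hB β (Multiset.mem_of_mem_nsmul hβ)
      · exact hB' β (Multiset.mem_of_mem_nsmul hβ)
    · rw [Multiset.sum_add, Multiset.sum_nsmul, Multiset.sum_nsmul, ← e, ← e', smul_add, mul_comm,
        mul_smul, mul_comm, mul_smul]
  | smul c x _ hx =>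
    obtain ⟨k, hk, B, hB, e⟩ := hx
    obtain ⟨c, hc⟩ := c
    refine ⟨k * c.den, Nat.mul_pos hk c.den_pos, c.num.toNat • B,
      fun β hβ => hB β (Multiset.mem_of_mem_nsmul hβ), ?_⟩
    rw [Multiset.sum_nsmul, ← e]
    have h1 : (c.num.toNat : ℚ) = c * c.den := by
      rw [Rat.mul_den_eq_num]
      exact_mod_cast Int.toNat_of_nonneg (Rat.num_nonneg.2 hc)
    change (k * c.den) • (c • x) = _
    rw [← Nat.cast_smul_eq_nsmul ℚ, ← Nat.cast_smul_eq_nsmul ℚ, ← Nat.cast_smul_eq_nsmul ℚ,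
      smul_smul, smul_smul, h1]
    congr 1
    push_cast; ring

theorem exists_isRelation (h : ¬ ConeCondition P 𝔩) : ∃ A B, IsRelation P 𝔩 A B := by
  have : ∃ v, v ∈ PointedCone.hull ℚ (nilRoots 𝔩) ∧ v ∈ PointedCone.hull ℚ (singRoots P 𝔩) ∧
      v ≠ 0 := by
    by_contra! hcon
    apply h
    refine Set.Subset.antisymm (fun v hv => hcon v hv.1 hv.2) ?_
    rintro _ rfl
    exact ⟨zero_mem _, zero_mem _⟩
  obtain ⟨v, h1, h2, h0⟩ := this
  obtain ⟨k, hk, B, hB, e⟩ := exists_nsmul_eq_sum h1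
  obtain ⟨k', hk', A, hA, e'⟩ := exists_nsmul_eq_sum h2
  refine ⟨k • A, k' • B, fun α hα => hA α (Multiset.mem_of_mem_nsmul hα),
    fun β hβ => hB β (Multiset.mem_of_mem_nsmul hβ), ?_, ?_⟩
  · rw [Multiset.sum_nsmul, Multiset.sum_nsmul, ← e, ← e', smul_comm]
  · rw [Multiset.sum_nsmul, ← e']
    exact smul_ne_zero hk.ne' (smul_ne_zero hk'.ne' h0)

/-- Among the relations of least length take one with the fewest roots on the right, counted with
multiplicity. -/
theorem exists_isMinimalRelation (h : ¬ ConeCondition P 𝔩) :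
    ∃ A B, IsMinimalRelation P 𝔩 A B := by
  classical
  have hex : ∃ k, ∃ A B, IsRelation P 𝔩 A B ∧ A.card = k := by
    obtain ⟨A, B, hAB⟩ := exists_isRelation h
    exact ⟨_, A, B, hAB, rfl⟩
  have hex' : ∃ j, ∃ A B, IsRelation P 𝔩 A B ∧ A.card = Nat.find hex ∧ B.card = j := by
    obtain ⟨A, B, hAB, hk⟩ := Nat.find_spec hex
    exact ⟨_, A, B, hAB, hk, rfl⟩
  obtain ⟨A, B, hAB, hA, hB⟩ := Nat.find_spec hex'
  refine ⟨A, B, hAB, fun A' B' h' => hA ▸ Nat.find_min' hex ⟨A', B', h', rfl⟩, ?_⟩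
  intro β hβ β' hβ' hr
  have hne : β ≠ β' := by
    rintro rfl
    exact add_self_not_mem_roots (hAB.right_mem β hβ).1.1 hr
  obtain ⟨B', rfl⟩ := exists_cons_cons hβ hβ' hne
  have hrel : IsRelation P 𝔩 A ((β + β') ::ₘ B') := by
    refine ⟨hAB.left_mem, ?_, ?_, hAB.sum_ne_zero⟩
    · intro γ hγ
      rcases Multiset.mem_cons.1 hγ with rfl | hγ
      · exact nilRoots_add (hAB.right_mem β hβ) (hAB.right_mem β' hβ').1 hr
      · exact hAB.right_mem γ (by simp [hγ])
    · rw [hAB.sum_eq]; simp [add_assoc]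
  have := Nat.find_min' hex' ⟨A, _, hrel, hA, rfl⟩
  rw [← hB] at this
  simp at this

end

/-! ### The shapes of the relations of length two -/

/-- The relations of length two in terms of the weights of the natural representation. -/
inductive Shape {n : ℕ} : Multiset (Fin n → ℚ) → Multiset (Fin n → ℚ) → Prop
  | path (a b c : Node n) : Shape {a.pr b, b.bar.pr c} {a.pr c}
  | square (a b c d : Node n) : Shape {a.pr b, c.pr d} {a.pr c, b.pr d}
  | cross (a b c : Node n) : Shape {a.pr b, a.pr b.bar} {a.pr c, a.pr c.bar}
  | fork (a b c d : Node n) : Shape {a.pr b, a.pr d} {a.pr c, a.pr c.bar, b.pr d}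
  | double (a b c d : Node n) :
    Shape {a.pr b, a.pr b} {a.pr c, a.pr c.bar, b.pr d, b.pr d.bar}

/-- Vectors with even coordinate sum. -/
def evenVectors (n : ℕ) : AddSubgroup (Fin n → ℚ) where
  carrier := {v | ∃ k : ℤ, ∑ i, v i = 2 * k}
  zero_mem' := ⟨0, by simp⟩
  add_mem' := by
    rintro v w ⟨k, hk⟩ ⟨l, hl⟩
    exact ⟨k + l, by simp [Finset.sum_add_distrib, hk, hl, mul_add]⟩
  neg_mem' := by
    rintro v ⟨k, hk⟩
    exact ⟨-k, by simp [hk]⟩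

theorem sum_wt {n : ℕ} {x : Node n} (hx : x ≠ zero) :
    ∑ i, x.wt i = 1 ∨ ∑ i, x.wt i = -1 := by
  cases x <;> simp_all [wt, Pi.single_apply]

theorem pr_mem_evenVectors {n : ℕ} {x y : Node n} (hx : x ≠ zero) (hy : y ≠ zero) :
    x.pr y ∈ evenVectors n := by
  have e : ∑ i, x.pr y i = ∑ i, x.wt i + ∑ i, y.wt i := by simp [pr, Finset.sum_add_distrib]
  change ∃ k : ℤ, ∑ i, x.pr y i = 2 * k
  rw [e]
  rcases sum_wt hx with h1 | h1 <;> rcases sum_wt hy with h2 | h2 <;> rw [h1, h2]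
  · exact ⟨1, by norm_num⟩
  · exact ⟨0, by norm_num⟩
  · exact ⟨0, by norm_num⟩
  · exact ⟨-1, by norm_num⟩

theorem pr_zero_not_mem_evenVectors {n : ℕ} {x : Node n} (hx : x ≠ zero) :
    x.pr zero ∉ evenVectors n := by
  rintro ⟨k, hk⟩
  have e : ∑ i, x.pr zero i = ∑ i, x.wt i := by simp [pr]
  rw [e] at hk
  rcases sum_wt hx with h1 | h1 <;> rw [h1] at hk
  · have : (1 : ℤ) = 2 * k := by exact_mod_cast hk
    omega
  · have : (-1 : ℤ) = 2 * k := by exact_mod_cast hk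
    omega

namespace IsMinimalRelation

variable {X : ClassicalType} {n : ℕ} {P : Set (Fin n → ℚ)} {𝔩 : LieSubalgebra ℂ (X.algebra n)}
  {A B B₀ B₁ : Multiset (Fin n → ℚ)} {α β β' : Fin n → ℚ} {x y z u w v w₁ w₂ : Node n}

theorem eq_zero_of_sum (h : IsMinimalRelation P 𝔩 A B) (hB : B = B₀ + B₁) (hs : B₁.sum = 0) :
    B₁ = 0 := by
  by_contra h0
  exact sum_nilRoots_ne_zero B₁ (fun β hβ => h.isRelation.right_mem β (by simp [hB, hβ])) h0 hs

/-- The β's have nonnegative mutual products, so comparing squares leaves at most two of them; two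
β's never sum up to a root. -/
theorem eq_singleton_of_sum (h : IsMinimalRelation P 𝔩 A B) (hB : B = B₀ + B₁)
    (hs : B₁.sum ∈ X.roots n) : B₁ = {B₁.sum} := by
  obtain ⟨m, hm, hb⟩ := exists_norm_bounds X n
  have hB₁ : ∀ β ∈ B₁, β ∈ B := fun β hβ => by simp [hB, hβ]
  have h1 : B₁.card * m ≤ B₁.sum ⬝ᵥ B₁.sum := by
    refine card_mul_le_sum_dot_sum
      (fun β hβ => (hb β (h.isRelation.right_mem β (hB₁ β hβ)).1.1).1) ?_
    intro β β' B' hB'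
    exact h.dot_nonneg_right (hB₁ β (by simp [hB'])) (hB₁ β' (by simp [hB']))
  have h2 := (hb _ hs).2
  have h3 : (B₁.card : ℚ) ≤ 2 := by
    by_contra! hcon
    nlinarith
  have h4 : B₁.card ≤ 2 := by exact_mod_cast h3
  have h5 : B₁.card ≠ 0 := by
    intro h0
    rw [Multiset.card_eq_zero.1 h0] at hs
    exact hs.1 rfl
  have h6 : B₁.card ≠ 2 := by
    intro h0
    obtain ⟨β, β', rfl⟩ := Multiset.card_eq_two.1 h0
    apply h.add_not_root β (hB₁ β (by simp)) β' (hB₁ β' (by simp))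
    simpa using hs
  obtain ⟨β, rfl⟩ := Multiset.card_eq_one.1 (by omega : B₁.card = 1)
  simp

/-- Each β in B₁ has positive product with the sum 2w, hence contains w, with coordinate 1 as there
is no loop. So there are exactly two, and their other weights cancel. -/
theorem eq_pair_of_sum (h : IsMinimalRelation P 𝔩 A B) (hB : B = B₀ + B₁) (hw : w ≠ zero)
    (hloop : ¬ X.Adm w w) (hs : B₁.sum = w.wt + w.wt) : ∃ y, B₁ = {w.pr y, w.pr y.bar} := by
  have hB₁ : ∀ β ∈ B₁, β ∈ B := fun β hβ => by simp [hB, hβ]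
  have h1 : ∀ β ∈ B₁, ∃ y, β = w.pr y ∧ w.wt ⬝ᵥ β = 1 := by
    intro β hβ
    have hβR := (h.isRelation.right_mem β (hB₁ β hβ)).1.1
    have h2 : β ⬝ᵥ β ≤ β ⬝ᵥ B₁.sum :=
      dot_le_dot_sum hβ fun γ hγ => h.dot_nonneg_right (hB₁ β hβ) (hB₁ γ hγ)
    have h3 := dot_self_pos (ne_zero_of_mem_roots hβR)
    rw [hs, dotProduct_add, dotProduct_comm] at h2
    obtain ⟨y, hy, rfl⟩ := exists_pr_of_dot_pos hβR (x := w) (by rw [dotProduct_comm]; linarith)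
    refine ⟨y, rfl, ?_⟩
    rw [wt_dot_pr, dot_self hw, dot_of_ne _ hy.ne_bar, add_zero]
    rintro rfl
    exact hloop hy
  have h2 : w.wt ⬝ᵥ B₁.sum = B₁.card := by
    have h3 : ∀ C : Multiset (Fin n → ℚ), (∀ β ∈ C, w.wt ⬝ᵥ β = 1) → w.wt ⬝ᵥ C.sum = C.card := by
      intro C
      induction C using Multiset.induction_on with
      | empty => simp
      | cons β C ih =>
        intro hC
        rw [Multiset.sum_cons, dotProduct_add, hC β (by simp), ih fun γ hγ => hC γ (by simp [hγ])]
        simp [add_comm]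
    exact h3 B₁ fun β hβ => (h1 β hβ).choose_spec.2
  have h3 : B₁.card = 2 := by
    have h4 : w.wt ⬝ᵥ w.wt = 1 := dot_self hw
    rw [hs, dotProduct_add, h4] at h2
    have : (B₁.card : ℚ) = (2 : ℕ) := by rw [← h2]; norm_num
    exact_mod_cast this
  obtain ⟨β, β', rfl⟩ := Multiset.card_eq_two.1 h3
  obtain ⟨y, rfl, -⟩ := h1 β (by simp)
  obtain ⟨y', rfl, -⟩ := h1 β' (by simp)
  refine ⟨y, ?_⟩
  have h4 : y' = y.bar := by
    apply wt_injective
    rw [wt_bar]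
    simp only [Multiset.insert_eq_cons, Multiset.sum_cons, Multiset.sum_singleton, pr] at hs
    have e : y'.wt = (w.wt + y.wt + (w.wt + y'.wt)) - (w.wt + w.wt) - y.wt := by abel
    rw [e, hs]; abel
  rw [h4]

/-- Removing u + y leaves w₁ + w₂ on the right. According as this is 0, a root, or twice a weight
without loop, the shape is a path, a square or a fork. -/
theorem shape_of_cons_cons (h : IsMinimalRelation P 𝔩 A B) (hβ : u.pr y ∈ B)
    (hA : A = {u.pr w₁, y.pr w₂}) : Shape A B := by
  have hα₁ : u.pr w₁ ∈ A := by simp [hA]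
  have hα₂ : y.pr w₂ ∈ A := by simp [hA]
  obtain ⟨B', hB⟩ := Multiset.exists_cons_of_mem hβ
  have hB' : B = {u.pr y} + B' := by rw [hB, Multiset.singleton_add]
  have hs : B'.sum = w₁.pr w₂ := by
    have e := h.isRelation.sum_eq
    rw [hA, hB] at e
    simp only [Multiset.insert_eq_cons, Multiset.sum_cons, Multiset.sum_singleton] at e
    have e' : u.pr w₁ + y.pr w₂ = u.pr y + w₁.pr w₂ := by simp only [pr]; abel
    rw [e'] at e
    exact (add_left_cancel e).symm
  by_cases hbar : w₂ = w₁.bar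
  · obtain rfl := h.eq_zero_of_sum hB' (by rw [hs, hbar, pr_eq_zero.2 rfl])
    rw [hA, hB', hbar, pr_comm y]
    exact Shape.path u w₁ y
  by_cases hadm : X.Adm w₁ w₂
  · have h1 := h.eq_singleton_of_sum hB' (by rw [hs, pr_mem_roots]; exact hadm)
    rw [hs] at h1
    rw [hA, hB, h1]
    exact Shape.square u w₁ y w₂
  · obtain rfl : w₂ = w₁ :=
      (h.adm_left hα₁).symm.trans' (h.adm_left hα₂).symm hadm hbar
    have hw : w₂ ≠ zero := by
      rintro rfl
      exact hbar rfl
    obtain ⟨z, rfl⟩ := h.eq_pair_of_sum hB' hw hadm hs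
    rw [hA, hB', add_comm, pr_comm u w₂, pr_comm y w₂]
    exact Shape.fork w₂ u z y

theorem dot_pos_or (h : IsMinimalRelation P 𝔩 A B) (hβ : u.pr y ∈ B) :
    0 < u.wt ⬝ᵥ A.sum ∨ 0 < y.wt ⬝ᵥ A.sum := by
  have h1 : u.pr y ⬝ᵥ u.pr y ≤ u.pr y ⬝ᵥ B.sum :=
    dot_le_dot_sum hβ fun γ hγ => h.dot_nonneg_right hβ hγ
  have h2 := dot_self_pos (ne_zero_of_mem_roots (h.isRelation.right_mem _ hβ).1.1)
  rw [← h.isRelation.sum_eq] at h1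
  have h3 : u.pr y ⬝ᵥ A.sum = u.wt ⬝ᵥ A.sum + y.wt ⬝ᵥ A.sum := by rw [pr, add_dotProduct]
  by_contra! hcon
  linarith [hcon.1, hcon.2]

/-- If the weight `0` does not occur on the left, then a short root occurs twice on the right. -/
theorem exists_cons_cons_zero (h : IsMinimalRelation P 𝔩 A B) (hβ : u.pr zero ∈ B)
    (hA : ∀ v, zero.pr v ∉ A) : ∃ B', B = u.pr zero ::ₘ u.pr zero ::ₘ B' := by
  have hadm := h.adm_right hβ
  have hu : u ≠ zero := by
    rintro rfl
    exact Adm.not_zero_zero hadm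
  obtain ⟨B', hB⟩ := Multiset.exists_cons_of_mem hβ
  suffices hmem : u.pr zero ∈ B' by
    obtain ⟨B'', rfl⟩ := Multiset.exists_cons_of_mem hmem
    exact ⟨B'', hB⟩
  -- The coordinate sum of a root is odd exactly when the weight 0 is involved. So the number of
  -- such roots on the right is even, and any second one has the same nonzero weight u.
  have hAeven : A.sum ∈ evenVectors n := by
    refine AddSubgroup.multiset_sum_mem _ _ fun α hα => ?_
    obtain ⟨x, y, hxy, rfl⟩ := (mem_roots_iff _).1 (h.isRelation.left_mem α hα).1
    refine pr_mem_evenVectors ?_ ?_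
    · rintro rfl; exact hA _ hα
    · rintro rfl; rw [pr_comm] at hα; exact hA _ hα
  have hex : ∃ β ∈ B', β ∉ evenVectors n := by
    by_contra! hcon
    have h1 := AddSubgroup.multiset_sum_mem _ _ hcon
    rw [h.isRelation.sum_eq, hB, Multiset.sum_cons] at hAeven
    exact pr_zero_not_mem_evenVectors hu ((AddSubgroup.add_mem_cancel_right _ h1).1 hAeven)
  obtain ⟨β, hβ', hodd⟩ := hex
  have hβB : β ∈ B := by simp [hB, hβ']
  obtain ⟨x, y, hxy, rfl⟩ := (mem_roots_iff _).1 (h.isRelation.right_mem β hβB).1.1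
  have key : ∀ {x}, zero.pr x ∈ B → x = u := by
    intro x hx
    exact (h.eq_of_bar_right hβ (z := x) (by rwa [bar_zero])).1
  by_cases hx : x = zero
  · subst hx
    obtain rfl := key hβB
    rwa [pr_comm]
  · by_cases hy : y = zero
    · subst hy
      rw [pr_comm] at hβB
      obtain rfl := key hβB
      exact hβ'
    · exact absurd (pr_mem_evenVectors hx hy) hodd

/-- The right side has u-coordinate at least 2 and each left root at most 1, so both left roots
contain u. The remainder w₁ + w₂ is 0, a root or 2w₁: a cross, a fork or a double. -/
theorem shape_of_pair (h : IsMinimalRelation P 𝔩 A B) (hA2 : A.card = 2)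
    (hB : B = u.pr y ::ₘ u.pr y.bar ::ₘ B₁) (hu : u ≠ zero) (hloop : ¬ X.Adm u u) :
    Shape A B := by
  have hβ : u.pr y ∈ B := by simp [hB]
  have hβ' : u.pr y.bar ∈ B := by simp [hB]
  have hadm := h.adm_right hβ
  have hclean : ∀ β ∈ B, 0 ≤ u.wt ⬝ᵥ β := by
    intro β hβ''
    by_contra! hneg
    obtain ⟨z, hz, rfl⟩ := exists_pr_of_dot_neg (h.isRelation.right_mem β hβ'').1.1 hneg
    rw [pr_comm] at hβ hβ'
    have h1 := (h.eq_of_bar_right hβ hβ'').1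
    have h2 := (h.eq_of_bar_right hβ' hβ'').1
    have hy : y = zero := by
      by_contra hy
      exact bar_ne_self hy (h2.symm.trans h1)
    subst hy h1
    apply h.add_ne_zero_right hβ hβ''
    simp [pr]
  have hone : ∀ {x}, X.Adm u x → u.wt ⬝ᵥ u.pr x = 1 := by
    intro x hx
    rw [wt_dot_pr, dot_self hu, dot_of_ne _ hx.ne_bar, add_zero]
    rintro rfl
    exact hloop hx
  have h2 : 2 ≤ u.wt ⬝ᵥ A.sum := by
    rw [h.isRelation.sum_eq, hB, Multiset.sum_cons, Multiset.sum_cons, dotProduct_add,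
      dotProduct_add, hone hadm, hone (h.adm_right hβ')]
    have := dot_sum_nonneg (v := u.wt) (B := B₁) fun β hβ'' => hclean β (by simp [hB, hβ''])
    linarith
  have hle : ∀ α ∈ A, u.wt ⬝ᵥ α ≤ 1 := by
    intro α hα
    by_contra! hcon
    obtain ⟨x, hx, rfl⟩ := exists_pr_of_dot_pos (h.isRelation.left_mem α hα).1
      (one_pos.trans hcon)
    rw [hone hx] at hcon
    exact lt_irrefl _ hcon
  obtain ⟨α₁, α₂, hA⟩ := Multiset.card_eq_two.1 hA2
  have hα₁ : α₁ ∈ A := by simp [hA]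
  have hα₂ : α₂ ∈ A := by simp [hA]
  have h3 : u.wt ⬝ᵥ A.sum = u.wt ⬝ᵥ α₁ + u.wt ⬝ᵥ α₂ := by rw [hA]; simp
  have h4 := hle _ hα₁
  have h5 := hle _ hα₂
  obtain ⟨w₁, hw₁, rfl⟩ := exists_pr_of_dot_pos (x := u) (h.isRelation.left_mem _ hα₁).1
    (by linarith)
  obtain ⟨w₂, hw₂, rfl⟩ := exists_pr_of_dot_pos (x := u) (h.isRelation.left_mem _ hα₂).1
    (by linarith)
  have hB' : B = {u.pr y, u.pr y.bar} + B₁ := by rw [hB]; simp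
  have hs : B₁.sum = w₁.pr w₂ := by
    have e := h.isRelation.sum_eq
    rw [hA, hB] at e
    simp only [Multiset.insert_eq_cons, Multiset.sum_cons, Multiset.sum_singleton] at e
    have e' : u.pr w₁ + u.pr w₂ = u.pr y + (u.pr y.bar + w₁.pr w₂) := by
      simp only [pr, wt_bar]; abel
    rw [e'] at e
    exact (add_left_cancel (add_left_cancel e)).symm
  by_cases hbar : w₂ = w₁.bar
  · obtain rfl := h.eq_zero_of_sum hB' (by rw [hs, hbar, pr_eq_zero.2 rfl])
    rw [hA, hB', hbar]
    exact Shape.cross u w₁ y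
  by_cases hadm : X.Adm w₁ w₂
  · have h1 := h.eq_singleton_of_sum hB' (by rw [hs, pr_mem_roots]; exact hadm)
    rw [hs] at h1
    rw [hA, hB, h1]
    exact Shape.fork u w₁ y w₂
  · obtain rfl : w₂ = w₁ := hw₁.symm.trans' hw₂.symm hadm hbar
    have hw : w₂ ≠ zero := by
      rintro rfl
      exact hbar rfl
    obtain ⟨z, rfl⟩ := h.eq_pair_of_sum hB' hw hadm hs
    rw [hA, hB']
    exact Shape.double u w₂ y z

/-- Take a right root u + y with u occurring on the left. If y also occurs there, the exchange
argument applies. If not, u − y is on the right too; for y = 0 this is the same root, and parity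
supplies its second occurrence. -/
theorem shape (h : IsMinimalRelation P 𝔩 A B) (hA2 : A.card = 2) : Shape A B := by
  have hB0 : B ≠ 0 := by
    rintro rfl
    exact h.isRelation.sum_ne_zero (by rw [h.isRelation.sum_eq]; rfl)
  obtain ⟨β, hβ⟩ := Multiset.exists_mem_of_ne_zero hB0
  obtain ⟨u, y, hadm, hpos, rfl⟩ : ∃ u y, X.Adm u y ∧ 0 < u.wt ⬝ᵥ A.sum ∧ β = u.pr y := by
    obtain ⟨x, y, hxy, rfl⟩ := (mem_roots_iff _).1 (h.isRelation.right_mem β hβ).1.1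
    rcases h.dot_pos_or hβ with h1 | h1
    · exact ⟨x, y, hxy, h1, rfl⟩
    · exact ⟨y, x, hxy.symm, h1, pr_comm _ _⟩
  have hu : u ≠ zero := by
    rintro rfl
    simp at hpos
  obtain ⟨α, hα, h1⟩ := exists_dot_pos hpos
  obtain ⟨w, -, rfl⟩ := exists_pr_of_dot_pos (h.isRelation.left_mem α hα).1 h1
  by_cases hy : ∃ v, y.pr v ∈ A
  · obtain ⟨v, hv⟩ := hy
    obtain ⟨v₁, v₂, A', hA⟩ := h.exists_eq_cons_cons hβ hα hv
    obtain rfl : A' = 0 := by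
      rw [hA] at hA2
      simpa using hA2
    exact h.shape_of_cons_cons hβ hA
  · have hβ' := (h.exists_left_or_right hβ).resolve_left hy
    by_cases hy0 : y = zero
    · subst hy0
      push Not at hy
      obtain ⟨B', hB⟩ := h.exists_cons_cons_zero hβ hy
      refine h.shape_of_pair (y := zero) hA2 hB hu fun hloop => ?_
      exact Adm.not_zero_zero (hloop.loop hadm.symm)
    · have hne : u.pr y ≠ u.pr y.bar := by
        intro e
        exact bar_ne_self hy0 (wt_injective (add_left_cancel e)).symm
      obtain ⟨B', hB⟩ := exists_cons_cons hβ hβ' hne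
      refine h.shape_of_pair hA2 hB hu ?_
      rw [pr_comm u y.bar] at hβ'
      exact (h.eq_of_bar_right hβ hβ').2

end IsMinimalRelation

/-! ### Linear maps that permute the weights -/

section

variable {X : ClassicalType} {m n : ℕ}

/-- A linear injection that permutes the weights of the natural representation takes roots to
roots. -/
theorem map_mem_roots {r : (Fin m → ℚ) →ₗ[ℚ] (Fin n → ℚ)} (hr : Function.Injective r)
    (h : ∀ z : Node m, ∃ w : Node n, r z.wt = w.wt) {α : Fin m → ℚ} (hα : α ∈ X.roots m) :
    r α ∈ X.roots n := by
  choose σ hσ using h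
  obtain ⟨x, y, hxy, rfl⟩ := (mem_roots_iff _).1 hα
  have e : r (x.pr y) = (σ x).pr (σ y) := by simp only [pr, map_add, hσ]
  rw [e, pr_mem_roots]
  have hinj : ∀ {x y}, σ x = σ y → x = y := fun {x y} h =>
    wt_injective (hr (by rw [hσ, hσ, h]))
  have h0 : σ zero = zero := by
    apply wt_injective
    rw [← hσ]; simp
  have hbar : ∀ x, σ x.bar = (σ x).bar := by
    intro x
    apply wt_injective
    rw [← hσ, wt_bar, wt_bar, map_neg, hσ]
  have h1 : ∀ {x}, x ≠ zero → σ x ≠ zero := fun hx h => hx (hinj (h.trans h0.symm))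
  have h2 : σ y ≠ (σ x).bar := fun h => hxy.ne_bar (hinj (h.trans (hbar x).symm))
  cases X
  · exact ⟨h2, fun h => hxy.2 (hinj h)⟩
  · exact ⟨h2, h1 hxy.2.1, h1 hxy.2.2⟩
  · exact ⟨h2, fun h => hxy.2.1 (hinj h), h1 hxy.2.2.1, h1 hxy.2.2.2⟩

/-- The reflection as a linear map. -/
def reflectₗ (α : Fin n → ℚ) : (Fin n → ℚ) →ₗ[ℚ] (Fin n → ℚ) where
  toFun := reflect α
  map_add' x y := by
    simp only [reflect, dotProduct_add, mul_add, add_div, add_smul]; abel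
  map_smul' c x := by
    simp only [reflect, dotProduct_smul, smul_eq_mul, RingHom.id_apply, smul_sub, smul_smul]
    congr 2; ring

theorem reflect_reflect {α : Fin n → ℚ} (hα : α ≠ 0) (x : Fin n → ℚ) :
    reflect α (reflect α x) = x := by
  have h := (dot_self_pos hα).ne'
  have e : 2 * (α ⬝ᵥ reflect α x) / (α ⬝ᵥ α) = -(2 * (α ⬝ᵥ x) / (α ⬝ᵥ α)) := by
    simp only [reflect, dotProduct_sub, dotProduct_smul, smul_eq_mul]
    field_simp; ring
  rw [reflect, e, reflect]
  simp

/-- The image of the weight `z` under the reflection along `±x`. -/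
def Node.reflectLoop (x z : Node n) : Node n :=
  if z = x then x.bar else if z = x.bar then x else z

/-- The image of the weight `z` under the reflection along `x + y`. -/
def Node.reflectPair (x y z : Node n) : Node n :=
  if x = zero then y.reflectLoop z else if y = zero ∨ y = x then x.reflectLoop z
  else if z = x then y.bar else if z = x.bar then y else if z = y then x.bar
  else if z = y.bar then x else z

/-- The factor c = 1 serves the short roots of type B, c = 2 the long roots of type C. -/
theorem reflect_smul_wt {x : Node n} {c : ℚ} (hx : x ≠ zero) (hc : c ≠ 0) (z : Node n) :
    reflect (c • x.wt) z.wt = (x.reflectLoop z).wt := by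
  have e1 : c • x.wt ⬝ᵥ z.wt = c * x.dot z := by simp [dot]
  have e2 : c • x.wt ⬝ᵥ c • x.wt = c * c := by
    have := dot_self hx
    rw [dot] at this
    simp [this]
  have e3 : reflect (c • x.wt) z.wt = z.wt - (2 * x.dot z) • x.wt := by
    rw [reflect, e1, e2, smul_smul]
    congr 2
    field_simp
  rw [e3, reflectLoop]
  split_ifs with h1 h2
  · rw [h1, dot_self hx, wt_bar, mul_one, two_smul]; abel
  · rw [h2, dot_bar, dot_self hx, wt_bar, mul_neg, mul_one, neg_smul, two_smul]; abel
  · simp [dot_of_ne h1 h2]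

theorem reflect_pr_wt {x y : Node n} (hxy : y ≠ x.bar) (z : Node n) :
    reflect (x.pr y) z.wt = (x.reflectPair y z).wt := by
  rw [reflectPair]
  split_ifs with hx hyx h1 h2 h3 h4
  · have hy : y ≠ zero := by
      rintro rfl
      exact hxy (by simp [hx])
    have := reflect_smul_wt hy one_ne_zero z
    simpa [hx, pr] using this
  · rcases hyx with hy | hyx
    · have := reflect_smul_wt hx one_ne_zero z
      simpa [hy, pr] using this
    · have := reflect_smul_wt hx two_ne_zero z
      rwa [two_smul, show x.wt + x.wt = x.pr y by rw [hyx, pr]] at this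
  all_goals
    push Not at hyx
    have hy := hyx.1
    have hxy' : x.dot y = 0 := dot_of_ne hyx.2 hxy
    have e : reflect (x.pr y) z.wt = z.wt - (x.dot z + y.dot z) • (x.wt + y.wt) := by
      have h2 : x.pr y ⬝ᵥ x.pr y = 2 := by
        rw [pr_dot_pr, dot_self hx, dot_self hy, hxy', dot_comm y x, hxy']; norm_num
      rw [reflect, show x.pr y ⬝ᵥ z.wt = x.dot z + y.dot z by simp [pr, dot], h2, pr]
      congr 2; ring
    rw [e]
  · rw [h1, dot_self hx, dot_comm y x, hxy', wt_bar]; simp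
  · rw [h2, dot_bar, dot_self hx, dot_bar, dot_comm y x, hxy']; simp
  · rw [h3, dot_self hy, hxy', wt_bar]; simp
  · rw [h4, dot_bar, dot_bar, dot_self hy, hxy']; simp
  · simp [dot_of_ne h1 h2, dot_of_ne h3 h4]

theorem reflect_pr_pr {x y : Node n} (hxy : y ≠ x.bar) (z w : Node n) :
    reflect (x.pr y) (z.pr w) = (x.reflectPair y z).pr (x.reflectPair y w) :=
  (map_add (reflectₗ (x.pr y)) z.wt w.wt).trans
    (congrArg₂ (· + ·) (reflect_pr_wt hxy z) (reflect_pr_wt hxy w))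

theorem reflect_mem_roots {α β : Fin n → ℚ} (hα : α ∈ X.roots n) (hβ : β ∈ X.roots n) :
    reflect α β ∈ X.roots n := by
  have hinj : Function.Injective (reflectₗ α) := fun x y h => by
    rw [← reflect_reflect hα.1 x, ← reflect_reflect hα.1 y]
    exact congrArg (reflect α) h
  obtain ⟨x, y, hxy, rfl⟩ := (mem_roots_iff _).1 hα
  exact map_mem_roots hinj (fun z => ⟨_, reflect_pr_wt hxy.ne_bar z⟩) hβ

/-! ### Orthonormal families of weights -/

/-- A family of nonzero weights that are pairwise neither equal nor opposite. -/
def Frame (u : Fin m → Node n) : Prop :=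
  ∀ i j, (u i).dot (u j) = if i = j then 1 else 0

variable {u : Fin m → Node n}

theorem frame_of_ne (h0 : ∀ i, u i ≠ zero) (h : ∀ i j, i < j → u j ≠ u i ∧ u j ≠ (u i).bar) :
    Frame u := by
  intro i j
  rcases lt_trichotomy i j with hij | rfl | hij
  · rw [if_neg hij.ne, dot_of_ne (h i j hij).1 (h i j hij).2]
  · rw [if_pos rfl, dot_self (h0 i)]
  · rw [if_neg hij.ne', dot_comm, dot_of_ne (h j i hij).1 (h j i hij).2]

theorem Frame.ne_zero (hu : Frame u) (i : Fin m) : u i ≠ zero := by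
  intro h
  have := hu i i
  rw [h] at this
  simp at this

theorem Frame.ne (hu : Frame u) {i j : Fin m} (hij : i ≠ j) : u j ≠ u i ∧ u j ≠ (u i).bar := by
  have h1 := hu i j
  rw [if_neg hij] at h1
  constructor <;> intro h <;> rw [h] at h1
  · rw [dot_self (hu.ne_zero i)] at h1
    exact one_ne_zero h1
  · rw [dot_bar, dot_self (hu.ne_zero i)] at h1
    norm_num at h1

theorem Frame.exists_index (hu : Frame u) :
    ∃ k : Fin m → Fin n, Function.Injective k ∧ ∀ i, u i = .pos (k i) ∨ u i = .neg (k i) := by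
  have h : ∀ i, ∃ k, u i = .pos k ∨ u i = .neg k := by
    intro i
    have := hu.ne_zero i
    rcases hi : u i with _ | k | k
    · exact absurd hi this
    · exact ⟨k, Or.inl rfl⟩
    · exact ⟨k, Or.inr rfl⟩
  choose k hk using h
  refine ⟨k, fun i j hij => ?_, hk⟩
  by_contra hne
  have h1 := hu.ne hne
  rcases hk i with h2 | h2 <;> rcases hk j with h3 | h3 <;> rw [h2, h3, hij] at h1
  · exact h1.1 rfl
  · exact h1.2 rfl
  · exact h1.2 rfl
  · exact h1.1 rfl

theorem Frame.le (hu : Frame u) : m ≤ n := by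
  obtain ⟨k, hk, -⟩ := hu.exists_index
  simpa using Fintype.card_le_of_injective k hk

/-- The linear map that takes the standard basis to a family of weights. -/
def lin (u : Fin m → Node n) : (Fin m → ℚ) →ₗ[ℚ] (Fin n → ℚ) :=
  Fintype.linearCombination ℚ fun i => (u i).wt

theorem lin_apply (x : Fin m → ℚ) : lin u x = ∑ i, x i • (u i).wt := rfl

theorem lin_single (i : Fin m) (c : ℚ) : lin u (Pi.single i c) = c • (u i).wt := by
  rw [lin, Fintype.linearCombination_apply_single]

theorem Frame.lin_dot (hu : Frame u) (x y : Fin m → ℚ) : lin u x ⬝ᵥ lin u y = x ⬝ᵥ y := by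
  have : ∀ i j, (u i).wt ⬝ᵥ (u j).wt = if i = j then 1 else 0 := hu
  simp only [lin_apply, sum_dotProduct, dotProduct_sum, smul_dotProduct, dotProduct_smul, this]
  simp only [dotProduct, smul_eq_mul, mul_ite, mul_one, mul_zero, Finset.sum_ite_eq',
    Finset.mem_univ, if_true]
  exact Finset.sum_congr rfl fun i _ => mul_comm _ _

theorem Frame.lin_injective (hu : Frame u) : Function.Injective (lin u) := by
  rw [← LinearMap.ker_eq_bot, LinearMap.ker_eq_bot']
  intro x hx
  rw [← dotProduct_self_eq_zero, ← hu.lin_dot, hx]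
  simp

theorem Frame.lin_reflect (hu : Frame u) (x y : Fin m → ℚ) :
    lin u (reflect x y) = reflect (lin u x) (lin u y) := by
  simp only [reflect, map_sub, map_smul, hu.lin_dot]

/-- There is an automorphism of the root system that takes a given orthonormal family of weights to
the first basis vectors. -/
theorem Frame.exists_aut (hu : Frame u) (X : ClassicalType) :
    ∃ φ : (Fin n → ℚ) ≃ₗ[ℚ] (Fin n → ℚ), IsAut (X.roots n) φ ∧
      ∀ i j, φ (u i).wt j = if (j : ℕ) = i then 1 else 0 := by
  classical
  obtain ⟨k, hk, huk⟩ := hu.exists_index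
  -- The automorphism is a signed permutation: e extends the matching of k i with i, and s changes
  -- the sign where the family contains −ε_a.
  let e₁ : {x // x ∈ Set.range k} ≃ {x // x ∈ Set.range (Fin.castLE hu.le)} :=
    (Equiv.ofInjective k hk).symm.trans (Equiv.ofInjective _ (Fin.castLE_injective hu.le))
  let e : Equiv.Perm (Fin n) := e₁.extendSubtype
  have he : ∀ i, e (k i) = Fin.castLE hu.le i := by
    intro i
    have h1 := e₁.extendSubtype_apply_of_mem (k i) ⟨i, rfl⟩
    rw [h1]
    simp [e₁]
  let s : Fin n → ℚˣ := fun a => if Node.neg a ∈ Set.range u then -1 else 1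
  have hs : ∀ a, s a = 1 ∨ s a = -1 := by
    intro a
    by_cases h : Node.neg a ∈ Set.range u
    · right; simp only [s, if_pos h]
    · left; simp only [s, if_neg h]
  let φ : (Fin n → ℚ) ≃ₗ[ℚ] (Fin n → ℚ) :=
    (LinearEquiv.piCongrRight fun a => LinearEquiv.smulOfUnit (s a)).trans
      (LinearEquiv.funCongrLeft ℚ ℚ e.symm)
  have hφ : ∀ x j, φ x j = s (e.symm j) * x (e.symm j) := fun x j => rfl
  have hφpos : ∀ a, φ (Node.pos a).wt = Pi.single (e a) (s a : ℚ) := by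
    intro a
    ext j
    rw [hφ]
    by_cases h : e.symm j = a
    · have h' : j = e a := by rw [← h]; simp
      rw [h, h']; simp [wt]
    · have h' : j ≠ e a := fun h' => h (by simp [h'])
      simp [wt, h, h']
  have hnode : ∀ z : Node n, ∃ w : Node n, φ z.wt = w.wt := by
    have hpos : ∀ a, ∃ w : Node n, φ (Node.pos a).wt = w.wt := by
      intro a
      rw [hφpos]
      rcases hs a with h | h
      · exact ⟨.pos (e a), by rw [h]; rfl⟩
      · exact ⟨.neg (e a), by rw [h]; rfl⟩
    intro z
    rcases z with _ | a | a
    · exact ⟨zero, by simp⟩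
    · exact hpos a
    · obtain ⟨w, hw⟩ := hpos a
      refine ⟨w.bar, ?_⟩
      rw [wt_bar, ← hw, show (Node.neg a).wt = -(Node.pos a).wt from wt_bar (.pos a), map_neg]
  have hnode' : ∀ z : Node n, ∃ w : Node n, φ.symm z.wt = w.wt := by
    have hpos : ∀ a, ∃ w : Node n, φ.symm (Node.pos a).wt = w.wt := by
      intro a
      rcases hs (e.symm a) with h | h
      · refine ⟨.pos (e.symm a), ?_⟩
        rw [LinearEquiv.symm_apply_eq, hφpos, h]; simp [wt]
      · refine ⟨.neg (e.symm a), ?_⟩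
        rw [LinearEquiv.symm_apply_eq, show (Node.neg (e.symm a)).wt = -(Node.pos (e.symm a)).wt
          from wt_bar (.pos _), map_neg, hφpos, h]
        simp [wt, ← Pi.single_neg]
    intro z
    rcases z with _ | a | a
    · exact ⟨zero, by simp⟩
    · exact hpos a
    · obtain ⟨w, hw⟩ := hpos a
      refine ⟨w.bar, ?_⟩
      rw [wt_bar, ← hw, show (Node.neg a).wt = -(Node.pos a).wt from wt_bar (.pos a), map_neg]
  refine ⟨φ, ?_, ?_⟩
  · refine Set.Subset.antisymm ?_ ?_
    · rintro _ ⟨α, hα, rfl⟩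
      exact map_mem_roots (r := φ.toLinearMap) φ.injective hnode hα
    · intro α hα
      exact ⟨φ.symm α, map_mem_roots (r := φ.symm.toLinearMap) φ.symm.injective hnode' hα,
        φ.apply_symm_apply α⟩
  · intro i j
    have hval : φ (u i).wt = Pi.single (e (k i)) 1 := by
      rcases huk i with h | h
      · have h1 : Node.neg (k i) ∉ Set.range u := by
          rintro ⟨i', hi'⟩
          by_cases hii : i' = i
          · rw [hii, h] at hi'
            exact absurd hi' (by simp)
          · refine (hu.ne hii).2 ?_
            rw [h, hi']; rfl
        rw [h, hφpos]
        simp only [s, if_neg h1]; rfl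
      · have h1 : Node.neg (k i) ∈ Set.range u := ⟨i, h⟩
        rw [h, show (Node.neg (k i)).wt = -(Node.pos (k i)).wt from wt_bar (.pos _), map_neg,
          hφpos]
        simp only [s, if_pos h1, ← Pi.single_neg]
        simp
    rw [hval, he, Pi.single_apply]
    simp [Fin.ext_iff]

/-! ### Subsystems spanned by orthonormal families of weights -/

theorem Frame.isSubsystem (hu : Frame u) {Φ : Set (Fin m → ℚ)}
    (hΦ : ∀ x ∈ Φ, lin u x ∈ X.roots n) (hr : ∀ x ∈ Φ, ∀ y ∈ Φ, reflect x y ∈ Φ) :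
    IsSubsystem (X.roots n) (lin u '' Φ) := by
  refine ⟨?_, ?_⟩
  · rintro _ ⟨x, hx, rfl⟩
    exact hΦ x hx
  · rintro _ ⟨x, hx, rfl⟩ _ ⟨y, hy, rfl⟩
    exact ⟨_, hr x hx y hy, hu.lin_reflect x y⟩

/-- `S` generates `Φ` by reflections. -/
def Generates (S Φ : Set (Fin m → ℚ)) : Prop :=
  ∀ T : Set (Fin m → ℚ), (∀ x ∈ T, ∀ y ∈ T, reflect x y ∈ T) → S ⊆ T → Φ ⊆ T

theorem Frame.generated_eq (hu : Frame u) {S Φ : Set (Fin m → ℚ)}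
    (hΦ : ∀ x ∈ Φ, lin u x ∈ X.roots n) (hr : ∀ x ∈ Φ, ∀ y ∈ Φ, reflect x y ∈ Φ)
    (hS : S ⊆ Φ) (hgen : Generates S Φ) :
    generated (X.roots n) (lin u '' S) = lin u '' Φ := by
  refine Set.Subset.antisymm ?_ ?_
  · intro γ hγ
    exact hγ _ (hu.isSubsystem hΦ hr) (Set.image_mono hS)
  · rintro _ ⟨x, hx, rfl⟩ Ψ hΨ hSΨ
    refine hgen (lin u ⁻¹' Ψ) ?_ ?_ hx
    · intro x hx y hy
      change lin u (reflect x y) ∈ Ψ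
      rw [hu.lin_reflect]
      exact hΨ.2 _ hx _ hy
    · intro x hx
      exact hSΨ ⟨x, hx, rfl⟩

/-- Injectivity is asked on the span only, because `mapAD` kills the vector with all coordinates
equal. -/
theorem isoRoots_image (L : (Fin m → ℚ) →ₗ[ℚ] (Fin n → ℚ)) {Φ : Set (Fin m → ℚ)}
    (hL : ∀ x ∈ Submodule.span ℚ Φ, L x = 0 → x = 0) : IsoRoots (L '' Φ) Φ := by
  have hmem : ∀ x ∈ Submodule.span ℚ Φ, L x ∈ Submodule.span ℚ (L '' Φ) := by
    intro x hx
    rw [Submodule.span_image]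
    exact ⟨x, hx, rfl⟩
  let f : Submodule.span ℚ Φ →ₗ[ℚ] Submodule.span ℚ (L '' Φ) := L.restrict hmem
  have hf : Function.Bijective f := by
    constructor
    · rw [← LinearMap.ker_eq_bot, LinearMap.ker_eq_bot']
      intro x hx
      exact Subtype.ext (hL x x.2 (congrArg Subtype.val hx))
    · rintro ⟨y, hy⟩
      rw [Submodule.span_image] at hy
      obtain ⟨x, hx, rfl⟩ := hy
      exact ⟨⟨x, hx⟩, rfl⟩
  let e := LinearEquiv.ofBijective f hf
  refine ⟨e.symm, fun y => ?_⟩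
  obtain ⟨x, rfl⟩ := e.surjective y
  rw [LinearEquiv.symm_apply_apply]
  change L x ∈ L '' Φ ↔ _
  constructor
  · rintro ⟨z, hz, hzx⟩
    have : z - x = 0 := hL _ (sub_mem (Submodule.subset_span hz) x.2) (by rw [map_sub, hzx, sub_self])
    rwa [← sub_eq_zero.1 this]
  · exact fun h => ⟨x, h, rfl⟩

theorem Frame.isoRoots (hu : Frame u) (Φ : Set (Fin m → ℚ)) : IsoRoots (lin u '' Φ) Φ :=
  isoRoots_image _ fun x _ hx => hu.lin_injective (by rw [hx, map_zero])

end

/-! ### Finite families of roots given by pairs of weights -/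

section

variable {X : ClassicalType} {m n : ℕ} {u : Fin m → Node n}

instance decidableForallNode {p : Node m → Prop} [∀ x, Decidable (p x)] :
    Decidable (∀ x, p x) :=
  decidable_of_iff (p zero ∧ (∀ i, p (.pos i)) ∧ ∀ i, p (.neg i))
    ⟨fun h x => by cases x; exacts [h.1, h.2.1 _, h.2.2 _], fun h => ⟨h _, fun _ => h _, fun _ => h _⟩⟩

instance decidableAdm : (X : ClassicalType) → (x y : Node m) → Decidable (X.Adm x y)
  | B, x, y => inferInstanceAs (Decidable (y ≠ x.bar ∧ x ≠ y))
  | C, x, y => inferInstanceAs (Decidable (y ≠ x.bar ∧ x ≠ zero ∧ y ≠ zero))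
  | D, x, y => inferInstanceAs (Decidable (y ≠ x.bar ∧ x ≠ y ∧ x ≠ zero ∧ y ≠ zero))

/-- The action of a family of weights on weights. -/
def Node.map (u : Fin m → Node n) : Node m → Node n
  | zero => zero
  | .pos i => u i
  | .neg i => (u i).bar

theorem lin_wt (x : Node m) : lin u x.wt = (x.map u).wt := by
  rcases x with _ | i | i
  · simp [Node.map]
  · rw [wt, lin_single, one_smul]; rfl
  · rw [wt, lin_single, Node.map, wt_bar, neg_one_smul]

theorem lin_pr (x y : Node m) : lin u (x.pr y) = (x.map u).pr (y.map u) := by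
  rw [pr, map_add, lin_wt, lin_wt, pr]

theorem Frame.lin_mem_roots (hu : Frame u) {α : Fin m → ℚ} (hα : α ∈ X.roots m) :
    lin u α ∈ X.roots n :=
  map_mem_roots hu.lin_injective (fun z => ⟨_, lin_wt z⟩) hα

theorem roots_D_subset : D.roots n ⊆ X.roots n := by
  intro α hα
  obtain ⟨x, y, hxy, rfl⟩ := (mem_roots_iff _).1 hα
  rw [pr_mem_roots]
  cases X
  · exact ⟨hxy.1, hxy.2.1⟩
  · exact ⟨hxy.1, hxy.2.2⟩
  · exact hxy

/-- The sums of the pairs in a list. -/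
def pairSet (l : List (Node n × Node n)) : Set (Fin n → ℚ) :=
  {α | ∃ p ∈ l, α = p.1.pr p.2}

theorem lin_image_pairSet (u : Fin m → Node n) (l : List (Node m × Node m)) :
    lin u '' pairSet l = pairSet (l.map (Prod.map (Node.map u) (Node.map u))) := by
  ext α
  constructor
  · rintro ⟨_, ⟨p, hp, rfl⟩, rfl⟩
    exact ⟨_, List.mem_map_of_mem hp, lin_pr _ _⟩
  · rintro ⟨_, hq, rfl⟩
    obtain ⟨p, hp, rfl⟩ := List.mem_map.1 hq
    exact ⟨_, ⟨p, hp, rfl⟩, lin_pr _ _⟩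

/-- The pairs that arise from `l` by at most `k` reflections along pairs in `S`. -/
def orbit (S : List (Node n × Node n)) : ℕ → List (Node n × Node n) → List (Node n × Node n)
  | 0, l => l
  | k + 1, l => orbit S k (l ++ S.flatMap fun p => l.map fun q =>
      (p.1.reflectPair p.2 q.1, p.1.reflectPair p.2 q.2)).dedup

theorem pairSet_orbit_subset {S : List (Node n × Node n)} (hS : ∀ p ∈ S, p.2 ≠ p.1.bar)
    {T : Set (Fin n → ℚ)} (hT : ∀ x ∈ T, ∀ y ∈ T, reflect x y ∈ T) (hST : pairSet S ⊆ T)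
    (k : ℕ) {l : List (Node n × Node n)} (hl : pairSet l ⊆ T) : pairSet (orbit S k l) ⊆ T := by
  induction k generalizing l with
  | zero => exact hl
  | succ k ih =>
    apply ih
    rintro _ ⟨q, hq, rfl⟩
    rw [List.mem_dedup, List.mem_append, List.mem_flatMap] at hq
    rcases hq with hq | ⟨p, hp, hq⟩
    · exact hl ⟨q, hq, rfl⟩
    · obtain ⟨q, hq', rfl⟩ := List.mem_map.1 hq
      rw [← reflect_pr_pr (hS p hp)]
      exact hT _ (hST ⟨p, hp, rfl⟩) _ (hl ⟨q, hq', rfl⟩)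

/-- Reflections act on pairs of weights, so generation is certified by a finite search to depth k.
The two orders of a pair stand for the same root. -/
theorem generates_of_orbit {S : List (Node n × Node n)} (hS : ∀ p ∈ S, p.2 ≠ p.1.bar)
    (k : ℕ) {Q : Node n → Node n → Prop}
    (h : ∀ x y, Q x y → (x, y) ∈ orbit S k S ∨ (y, x) ∈ orbit S k S) :
    Generates (pairSet S) {α | ∃ x y, Q x y ∧ α = x.pr y} := by
  rintro T hT hST _ ⟨x, y, hxy, rfl⟩
  have := pairSet_orbit_subset hS hT hST k hST
  rcases h x y hxy with h | h
  · exact this ⟨_, h, rfl⟩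
  · exact this ⟨_, h, pr_comm x y⟩

theorem roots_eq : X.roots n = {α | ∃ x y : Node n, X.Adm x y ∧ α = x.pr y} :=
  Set.ext fun _ => mem_roots_iff _

/-- The subsystem generated by finitely many roots, when it is a full classical root system. -/
theorem Frame.generated_roots (hu : Frame u) {Y : ClassicalType} (hY : Y = D ∨ Y = X)
    {S : List (Node m × Node m)} (hS : ∀ p ∈ S, Y.Adm p.1 p.2) (k : ℕ)
    (h : ∀ x y, Y.Adm x y → (x, y) ∈ orbit S k S ∨ (y, x) ∈ orbit S k S) :
    generated (X.roots n) (lin u '' pairSet S) = lin u '' Y.roots m := by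
  refine hu.generated_eq (fun x hx => ?_) (fun x hx y hy => reflect_mem_roots hx hy) ?_ ?_
  · rcases hY with rfl | rfl
    · exact roots_D_subset (hu.lin_mem_roots hx)
    · exact hu.lin_mem_roots hx
  · rintro _ ⟨p, hp, rfl⟩
    exact pr_mem_roots.2 (hS p hp)
  · rw [roots_eq]
    exact generates_of_orbit (fun p hp => (hS p hp).ne_bar) k h

/-! ### The standard root systems -/

theorem stdD_eq : stdD m = D.roots m := by
  ext α
  rw [mem_roots_iff]
  constructor
  · rintro ⟨i, j, hij, s, t, hs | hs, ht | ht, rfl⟩ <;> subst hs ht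
    · exact ⟨.pos i, .pos j, by simp [Adm, bar, hij], rfl⟩
    · exact ⟨.pos i, .neg j, by simp [Adm, bar, hij.symm], rfl⟩
    · exact ⟨.neg i, .pos j, by simp [Adm, bar, hij.symm], rfl⟩
    · exact ⟨.neg i, .neg j, by simp [Adm, bar, hij], rfl⟩
  · rintro ⟨x, y, ⟨h1, h2, h3, h4⟩, rfl⟩
    rcases x with _ | i | i <;> rcases y with _ | j | j <;> simp [bar] at h1 h2 h3 h4
    · exact ⟨i, j, h2, 1, 1, by simp, by simp, rfl⟩
    · exact ⟨i, j, Ne.symm h1, 1, -1, by simp, by simp, rfl⟩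
    · exact ⟨i, j, Ne.symm h1, -1, 1, by simp, by simp, rfl⟩
    · exact ⟨i, j, h2, -1, -1, by simp, by simp, rfl⟩

theorem stdB_eq : stdB m = B.roots m := by
  ext α
  rw [stdB, stdD_eq, Set.mem_union, mem_roots_iff, mem_roots_iff]
  constructor
  · rintro (⟨x, y, h, rfl⟩ | ⟨i, s, hs | hs, rfl⟩)
    · exact ⟨x, y, ⟨h.1, h.2.1⟩, rfl⟩
    · exact ⟨.pos i, zero, by simp [Adm, bar], by simp [pr, wt, hs]⟩
    · exact ⟨.neg i, zero, by simp [Adm, bar], by simp [pr, wt, hs]⟩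
  · rintro ⟨x, y, ⟨h1, h2⟩, rfl⟩
    by_cases hx : x = zero
    · right
      subst hx
      rcases y with _ | j | j
      · exact absurd rfl h2
      · exact ⟨j, 1, by simp, by simp [pr, wt]⟩
      · exact ⟨j, -1, by simp, by simp [pr, wt]⟩
    · by_cases hy : y = zero
      · right
        subst hy
        rcases x with _ | j | j
        · exact absurd rfl h2
        · exact ⟨j, 1, by simp, by simp [pr, wt]⟩
        · exact ⟨j, -1, by simp, by simp [pr, wt]⟩
      · exact Or.inl ⟨x, y, ⟨h1, h2, hx, hy⟩, rfl⟩

theorem stdC_eq : stdC m = C.roots m := by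
  ext α
  rw [stdC, stdD_eq, Set.mem_union, mem_roots_iff, mem_roots_iff]
  constructor
  · rintro (⟨x, y, h, rfl⟩ | ⟨i, s, hs | hs, rfl⟩)
    · exact ⟨x, y, ⟨h.1, h.2.2⟩, rfl⟩
    · exact ⟨.pos i, .pos i, by simp [Adm, bar], by rw [hs, two_mul, Pi.single_add]; rfl⟩
    · exact ⟨.neg i, .neg i, by simp [Adm, bar], by rw [hs, two_mul, Pi.single_add]; rfl⟩
  · rintro ⟨x, y, ⟨h1, h2, h3⟩, rfl⟩
    by_cases hxy : x = y
    · right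
      subst hxy
      rcases x with _ | j | j
      · exact absurd rfl h2
      · exact ⟨j, 1, by simp, by rw [two_mul, Pi.single_add]; rfl⟩
      · exact ⟨j, -1, by simp, by rw [two_mul, Pi.single_add]; rfl⟩
    · exact Or.inl ⟨x, y, ⟨h1, hxy, h2, h3⟩, rfl⟩

/-- The pairs that give the roots of the standard root system of type `A`. -/
def AdmA (x y : Node m) : Prop := ∃ i j, i ≠ j ∧ x = .pos i ∧ y = .neg j

instance decidableAdmA (x y : Node m) : Decidable (AdmA x y) :=
  inferInstanceAs (Decidable (∃ i j, i ≠ j ∧ x = .pos i ∧ y = .neg j))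

theorem AdmA.adm {x y : Node m} (h : AdmA x y) : D.Adm x y := by
  obtain ⟨i, j, hij, rfl, rfl⟩ := h
  simp [Adm, bar, hij.symm]

theorem stdA_eq : stdA m = {α | ∃ x y : Node (m + 1), AdmA x y ∧ α = x.pr y} := by
  ext α
  constructor
  · rintro ⟨i, j, hij, rfl⟩
    exact ⟨_, _, ⟨i, j, hij, rfl, rfl⟩, by rw [pr, wt, wt, Pi.single_neg, sub_eq_add_neg]⟩
  · rintro ⟨_, _, ⟨i, j, hij, rfl, rfl⟩, rfl⟩
    exact ⟨i, j, hij, by rw [pr, wt, wt, Pi.single_neg, sub_eq_add_neg]⟩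

theorem stdA_subset : stdA m ⊆ D.roots (m + 1) := by
  rw [stdA_eq]
  rintro _ ⟨x, y, h, rfl⟩
  exact pr_mem_roots.2 h.adm

/-- Type A is cut out of type D by a linear equation, which makes its closedness under reflections
immediate. -/
theorem mem_stdA_iff {α : Fin (m + 1) → ℚ} : α ∈ stdA m ↔ α ∈ D.roots (m + 1) ∧ ∑ i, α i = 0 := by
  constructor
  · refine fun h => ⟨stdA_subset h, ?_⟩
    obtain ⟨i, j, -, rfl⟩ := h
    simp
  · rintro ⟨h, h0⟩
    rw [← stdD_eq] at h
    obtain ⟨i, j, hij, s, t, hs, ht, rfl⟩ := h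
    have h1 : s + t = 0 := by simpa [Finset.sum_add_distrib] using h0
    obtain rfl : t = -s := by linarith
    rcases hs with rfl | rfl
    · exact ⟨i, j, hij, by rw [Pi.single_neg, sub_eq_add_neg]⟩
    · exact ⟨j, i, hij.symm, by rw [neg_neg, Pi.single_neg]; abel⟩

theorem reflect_mem_stdA {α β : Fin (m + 1) → ℚ} (hα : α ∈ stdA m) (hβ : β ∈ stdA m) :
    reflect α β ∈ stdA m := by
  rw [mem_stdA_iff] at *
  refine ⟨reflect_mem_roots hα.1 hβ.1, ?_⟩
  simp [reflect, Finset.sum_sub_distrib, ← Finset.mul_sum, hα.2, hβ.2]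

theorem Frame.lin_stdA_mem {u : Fin (m + 1) → Node n} (hu : Frame u) :
    ∀ x ∈ stdA m, lin u x ∈ X.roots n :=
  fun _ hx => roots_D_subset (hu.lin_mem_roots (stdA_subset hx))

theorem Frame.generated_stdA {u : Fin (m + 1) → Node n} (hu : Frame u)
    {S : List (Node (m + 1) × Node (m + 1))} (hS : ∀ p ∈ S, AdmA p.1 p.2 ∨ AdmA p.2 p.1) (k : ℕ)
    (h : ∀ x y, AdmA x y → (x, y) ∈ orbit S k S ∨ (y, x) ∈ orbit S k S) :
    generated (X.roots n) (lin u '' pairSet S) = lin u '' stdA m := by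
  refine hu.generated_eq hu.lin_stdA_mem (fun x hx y hy => reflect_mem_stdA hx hy) ?_ ?_
  · rintro _ ⟨p, hp, rfl⟩
    rw [stdA_eq]
    rcases hS p hp with h | h
    · exact ⟨_, _, h, rfl⟩
    · exact ⟨_, _, h, pr_comm _ _⟩
  · rw [stdA_eq]
    refine generates_of_orbit (fun p hp => ?_) k h
    rcases hS p hp with h | h
    · exact h.adm.ne_bar
    · exact h.adm.symm.ne_bar

end

/-! ### Subsystems of type `A₃` and `A₄` -/

section

variable {X : ClassicalType} {m n : ℕ}

/-- The linear map that identifies `A₃` with `D₃`. -/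
def mapAD : (Fin 4 → ℚ) →ₗ[ℚ] (Fin 3 → ℚ) :=
  Matrix.mulVecLin !![1/2, 1/2, -1/2, -1/2; 1/2, -1/2, 1/2, -1/2; 1/2, -1/2, -1/2, 1/2]

theorem sum_eq_zero_of_mem_span {x : Fin (m + 1) → ℚ} (hx : x ∈ Submodule.span ℚ (stdA m)) :
    ∑ i, x i = 0 := by
  induction hx using Submodule.span_induction with
  | mem x h => exact (mem_stdA_iff.1 h).2
  | zero => simp
  | add x y _ _ h1 h2 => simp [Finset.sum_add_distrib, h1, h2]
  | smul c x _ h => simp [← Finset.mul_sum, h]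

theorem mapAD_injOn (x : Fin 4 → ℚ) (hx : x ∈ Submodule.span ℚ (stdA 3)) (h : mapAD x = 0) :
    x = 0 := by
  have h0 := sum_eq_zero_of_mem_span hx
  have h1 := congrFun h 0
  have h2 := congrFun h 1
  have h3 := congrFun h 2
  simp [mapAD, Matrix.mulVec, dotProduct, Fin.sum_univ_four] at h0 h1 h2 h3
  ext i
  fin_cases i <;> simp <;> linarith

/-- The basis vectors go to the vectors (±½, ±½, ±½) with an even number of minus signs, whose
differences are the roots ±ε_k ± ε_l. Doubling the matrix makes this a decidable statement over ℤ.
-/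
theorem mapAD_image : mapAD '' stdA 3 = D.roots 3 := by
  have hM : ∀ i j : Fin 4, i ≠ j → ∀ k l : Fin 3, ∀ s t : ℤ,
      (∀ c, (!![1, 1, -1, -1; 1, -1, 1, -1; 1, -1, -1, 1] : Matrix (Fin 3) (Fin 4) ℤ) c i
        - (!![1, 1, -1, -1; 1, -1, 1, -1; 1, -1, -1, 1] : Matrix (Fin 3) (Fin 4) ℤ) c j
        = 2 * ((if c = k then s else 0) + (if c = l then t else 0))) →
      mapAD (Pi.single i 1 - Pi.single j 1) = Pi.single k (s : ℚ) + Pi.single l (t : ℚ) := by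
    intro i j _ k l s t h
    have hc : ∀ (c : Fin 3) (i : Fin 4), (!![1/2, 1/2, -1/2, -1/2; 1/2, -1/2, 1/2, -1/2;
        1/2, -1/2, -1/2, 1/2] : Matrix (Fin 3) (Fin 4) ℚ) c i = ((!![1, 1, -1, -1; 1, -1, 1, -1;
        1, -1, -1, 1] : Matrix (Fin 3) (Fin 4) ℤ) c i : ℚ) / 2 := by
      intro c i
      fin_cases c <;> fin_cases i <;> norm_num
    ext c
    have := congrArg (Int.cast : ℤ → ℚ) (h c)
    simp only [mapAD, map_sub, Matrix.mulVecLin_apply, Matrix.mulVec_single_one, Pi.sub_apply,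
      Matrix.col_apply, hc, Pi.add_apply, Pi.single_apply]
    push_cast at this ⊢
    linarith
  have h1 : ∀ i j : Fin 4, i ≠ j → ∃ k l : Fin 3, k ≠ l ∧ ∃ s ∈ [(1 : ℤ), -1], ∃ t ∈ [(1 : ℤ), -1],
      ∀ c, (!![1, 1, -1, -1; 1, -1, 1, -1; 1, -1, -1, 1] : Matrix (Fin 3) (Fin 4) ℤ) c i
        - (!![1, 1, -1, -1; 1, -1, 1, -1; 1, -1, -1, 1] : Matrix (Fin 3) (Fin 4) ℤ) c j
        = 2 * ((if c = k then s else 0) + (if c = l then t else 0)) := by decide +kernel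
  have h2 : ∀ k l : Fin 3, k ≠ l → ∀ s ∈ [(1 : ℤ), -1], ∀ t ∈ [(1 : ℤ), -1], ∃ i j : Fin 4, i ≠ j ∧
      ∀ c, (!![1, 1, -1, -1; 1, -1, 1, -1; 1, -1, -1, 1] : Matrix (Fin 3) (Fin 4) ℤ) c i
        - (!![1, 1, -1, -1; 1, -1, 1, -1; 1, -1, -1, 1] : Matrix (Fin 3) (Fin 4) ℤ) c j
        = 2 * ((if c = k then s else 0) + (if c = l then t else 0)) := by decide +kernel
  rw [← stdD_eq]
  ext α
  constructor
  · rintro ⟨_, ⟨i, j, hij, rfl⟩, rfl⟩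
    obtain ⟨k, l, hkl, s, hs, t, ht, h⟩ := h1 i j hij
    refine ⟨k, l, hkl, s, t, ?_, ?_, hM i j hij k l s t h⟩
    · simp at hs
      exact_mod_cast hs
    · simp at ht
      exact_mod_cast ht
  · rintro ⟨k, l, hkl, s, t, hs, ht, rfl⟩
    obtain ⟨s, hs', rfl⟩ : ∃ s' : ℤ, s' ∈ [(1 : ℤ), -1] ∧ (s' : ℚ) = s := by
      rcases hs with rfl | rfl
      · exact ⟨1, by simp⟩
      · exact ⟨-1, by simp⟩
    obtain ⟨t, ht', rfl⟩ : ∃ t' : ℤ, t' ∈ [(1 : ℤ), -1] ∧ (t' : ℚ) = t := by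
      rcases ht with rfl | rfl
      · exact ⟨1, by simp⟩
      · exact ⟨-1, by simp⟩
    obtain ⟨i, j, hij, h⟩ := h2 k l hkl s hs' t ht'
    exact ⟨_, ⟨i, j, hij, rfl⟩, hM i j hij k l s t h⟩

theorem Frame.isoRoots_D3 {u : Fin 3 → Node n} (hu : Frame u) :
    IsoRoots (lin u '' D.roots 3) (stdA 3) := by
  rw [← mapAD_image, ← Set.image_comp]
  refine isoRoots_image ((lin u).comp mapAD) fun x hx h => mapAD_injOn x hx (hu.lin_injective ?_)
  rw [map_zero]
  exact h

theorem finrank_span_stdA_three : Module.finrank ℚ (Submodule.span ℚ (stdA 3)) ≤ 3 := by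
  have : Function.Injective (mapAD.comp (Submodule.span ℚ (stdA 3)).subtype) := by
    rw [← LinearMap.ker_eq_bot, LinearMap.ker_eq_bot']
    exact fun x hx => Subtype.ext (mapAD_injOn x x.2 hx)
  simpa using LinearMap.finrank_le_finrank_of_injective this

theorem le_finrank_span_stdA_four : 4 ≤ Module.finrank ℚ (Submodule.span ℚ (stdA 4)) := by
  let f : (Fin 4 → ℚ) →ₗ[ℚ] (Fin 5 → ℚ) := Fintype.linearCombination ℚ fun i =>
    Pi.single i.succ 1 - Pi.single 0 1
  have hf : ∀ x, f x ∈ Submodule.span ℚ (stdA 4) := by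
    intro x
    rw [Fintype.linearCombination_apply]
    exact sum_mem fun i _ => Submodule.smul_mem _ _
      (Submodule.subset_span ⟨_, _, Fin.succ_ne_zero i, rfl⟩)
  have : Function.Injective (f.codRestrict _ hf) := by
    rw [← LinearMap.ker_eq_bot, LinearMap.ker_eq_bot']
    intro x hx
    have h0 : f x = 0 := congrArg Subtype.val hx
    ext i
    have := congrFun h0 i.succ
    simpa [f, Fintype.linearCombination_apply, Finset.sum_apply, Pi.single_apply] using this
  simpa using LinearMap.finrank_le_finrank_of_injective this

/-- The spans have dimensions at most 3 and at least 4. -/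
theorem exists_not_mem_span {Φ Ψ : Set (Fin n → ℚ)} (hΦ : IsoRoots Φ (stdA 3))
    (hΨ : IsoRoots Ψ (stdA 4)) : ∃ γ ∈ Ψ, γ ∉ Submodule.span ℚ Φ := by
  by_contra! h
  obtain ⟨e, -⟩ := hΦ
  obtain ⟨e', -⟩ := hΨ
  have h1 := Submodule.finrank_mono (Submodule.span_le.2 h)
  rw [e.finrank_eq, e'.finrank_eq] at h1
  have := finrank_span_stdA_three
  have := le_finrank_span_stdA_four
  omega

/-- Neither the sum nor the difference of the two vectors vanishes or belongs to `Ψ`. -/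
def StronglyOrthogonal (Ψ : Set (Fin n → ℚ)) (r s : Fin n → ℚ) : Prop :=
  r + s ∉ Ψ ∧ r + s ≠ 0 ∧ r - s ∉ Ψ ∧ r - s ≠ 0

theorem StronglyOrthogonal.ne {i j k l : Fin (m + 1)} (hij : i ≠ j) (hkl : k ≠ l)
    (h : StronglyOrthogonal (stdA m) (Pi.single i 1 - Pi.single j 1)
      (Pi.single k 1 - Pi.single l 1)) : i ≠ k ∧ i ≠ l ∧ j ≠ k ∧ j ≠ l := by
  obtain ⟨h1, h2, h3, h4⟩ := h
  refine ⟨?_, ?_, ?_, ?_⟩ <;> rintro rfl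
  · refine h3 ⟨l, j, ?_, by abel⟩
    rintro rfl
    exact h4 (sub_self _)
  · refine h1 ⟨k, j, ?_, by abel⟩
    rintro rfl
    exact h2 (by abel)
  · refine h1 ⟨i, l, ?_, by abel⟩
    rintro rfl
    exact h2 (by abel)
  · refine h3 ⟨i, k, ?_, by abel⟩
    rintro rfl
    exact h4 (sub_self _)

/-- A root system of type `A₄` contains no three pairwise strongly orthogonal roots. -/
theorem IsoRoots.not_stronglyOrthogonal {Ψ : Set (Fin n → ℚ)} (h : IsoRoots Ψ (stdA 4))
    {r s t : Fin n → ℚ} (hr : r ∈ Ψ) (hs : s ∈ Ψ) (ht : t ∈ Ψ) (hrs : StronglyOrthogonal Ψ r s)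
    (hrt : StronglyOrthogonal Ψ r t) (hst : StronglyOrthogonal Ψ s t) : False := by
  obtain ⟨e, he⟩ := h
  have key : ∀ {x y} (hx : x ∈ Ψ) (hy : y ∈ Ψ), StronglyOrthogonal Ψ x y →
      StronglyOrthogonal (stdA 4) (e ⟨x, Submodule.subset_span hx⟩)
        (e ⟨y, Submodule.subset_span hy⟩) := by
    intro x y hx hy ⟨h1, h2, h3, h4⟩
    rw [StronglyOrthogonal, ← Submodule.coe_add, ← Submodule.coe_sub, ← map_add, ← map_sub, ← he,
      ← he]
    refine ⟨h1, fun h => h2 ?_, h3, fun h => h4 ?_⟩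
    · have := e.map_eq_zero_iff.1 (Subtype.ext h)
      exact congrArg Subtype.val this
    · have := e.map_eq_zero_iff.1 (Subtype.ext h)
      exact congrArg Subtype.val this
  have h1 := key hr hs hrs
  have h2 := key hr ht hrt
  have h3 := key hs ht hst
  obtain ⟨i, j, hij, e1⟩ := (he ⟨r, Submodule.subset_span hr⟩).1 hr
  obtain ⟨k, l, hkl, e2⟩ := (he ⟨s, Submodule.subset_span hs⟩).1 hs
  obtain ⟨p, q, hpq, e3⟩ := (he ⟨t, Submodule.subset_span ht⟩).1 ht
  rw [e1, e2] at h1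
  rw [e1, e3] at h2
  rw [e2, e3] at h3
  -- The indices i, j, k, l, p, q would be six distinct elements of `Fin 5`.
  have h1 := h1.ne hij hkl
  have h2 := h2.ne hij hpq
  have h3 := h3.ne hkl hpq
  omega

theorem stronglyOrthogonal_pr {Ψ : Set (Fin n → ℚ)} (hΨ : Ψ ⊆ X.roots n) {x y z w : Node n}
    (hxy : y ≠ x.bar) (hzw : w ≠ z.bar) (h1 : z ≠ x ∧ z ≠ x.bar) (h2 : z ≠ y ∧ z ≠ y.bar)
    (h3 : w ≠ x ∧ w ≠ x.bar) (h4 : w ≠ y ∧ w ≠ y.bar) :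
    StronglyOrthogonal Ψ (x.pr y) (z.pr w) := by
  have key : ∀ {z w : Node n}, w ≠ z.bar → z ≠ x ∧ z ≠ x.bar → z ≠ y ∧ z ≠ y.bar →
      w ≠ x ∧ w ≠ x.bar → w ≠ y ∧ w ≠ y.bar →
      x.pr y + z.pr w ∉ Ψ ∧ x.pr y + z.pr w ≠ 0 := by
    intro z w hzw h1 h2 h3 h4
    have h : ∀ u v : Node n, x.pr y + z.pr w ≠ u.pr v := by
      intro u v h
      have := exists_bar_of_pr_add_pr hxy hzw h
      tauto
    refine ⟨fun hmem => ?_, fun h0 => h zero zero (by rw [h0]; simp [pr])⟩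
    obtain ⟨u, v, -, huv⟩ := (mem_roots_iff _).1 (hΨ hmem)
    exact h u v huv
  have a := key hzw h1 h2 h3 h4
  have b := key (z := z.bar) (w := w.bar) (fun h => hzw (bar_inj.1 h))
    (by rw [Ne, bar_eq_comm, Ne, bar_inj]; exact h1.symm)
    (by rw [Ne, bar_eq_comm, Ne, bar_inj]; exact h2.symm)
    (by rw [Ne, bar_eq_comm, Ne, bar_inj]; exact h3.symm)
    (by rw [Ne, bar_eq_comm, Ne, bar_inj]; exact h4.symm)
  rw [pr_bar, ← sub_eq_add_neg] at b
  exact ⟨a.1, a.2, b.1, b.2⟩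

theorem not_adm_self (hX : X ≠ C) (x : Node n) : ¬ X.Adm x x := by
  intro h
  cases X
  · exact h.2 rfl
  · exact hX rfl
  · exact h.2.1 rfl

/-- Sum and difference are 2x and 2y, which are roots in type C only. -/
theorem stronglyOrthogonal_pr_bar (hX : X ≠ C) {Ψ : Set (Fin n → ℚ)} (hΨ : Ψ ⊆ X.roots n)
    {x y : Node n} (hx : x ≠ zero) (hy : y ≠ zero) :
    StronglyOrthogonal Ψ (x.pr y) (x.pr y.bar) := by
  have h1 : ∀ z : Node n, z.pr z ∉ X.roots n := fun z hz => not_adm_self hX z (pr_mem_roots.1 hz)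
  have e1 : x.pr y + x.pr y.bar = x.pr x := by simp [pr]; abel
  have e2 : x.pr y - x.pr y.bar = y.pr y := by simp [pr]
  rw [StronglyOrthogonal, e1, e2]
  refine ⟨fun h => h1 _ (hΨ h), ?_, fun h => h1 _ (hΨ h), ?_⟩ <;> rw [Ne, pr_eq_zero] <;>
    exact (bar_ne_self ‹_›).symm

theorem reflect_self {α : Fin n → ℚ} (hα : α ≠ 0) : reflect α α = -α := by
  rw [reflect, mul_div_assoc, div_self (dot_self_pos hα).ne', mul_one, two_smul]; abel

theorem Frame.exists_eq {u : Fin n → Node n} (hu : Frame u) {x : Node n} (hx : x ≠ zero) :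
    ∃ i, x = u i ∨ x = (u i).bar := by
  obtain ⟨k, hk, huk⟩ := hu.exists_index
  have hs := Finite.surjective_of_injective hk
  rcases x with _ | j | j
  · exact absurd rfl hx
  all_goals
    obtain ⟨i, rfl⟩ := hs j
    refine ⟨i, ?_⟩
    rcases huk i with h | h <;> simp [h, bar]

theorem Frame.ne_signed {u : Fin m → Node n} (hu : Frame u) {i j : Fin m} (hij : i ≠ j)
    {x y : Node n} (hx : x = u i ∨ x = (u i).bar) (hy : y = u j ∨ y = (u j).bar) :
    x ≠ y ∧ x ≠ y.bar := by
  have h := hu.ne hij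
  rcases hx with rfl | rfl <;> rcases hy with rfl | rfl
  · exact ⟨h.1.symm, fun e => h.2 (bar_eq_comm.1 e.symm)⟩
  · exact ⟨fun e => h.2 (bar_eq_comm.1 e.symm), fun e => h.1 (by rw [e, bar_bar])⟩
  · exact ⟨h.2.symm, fun e => h.1 (bar_inj.1 e).symm⟩
  · exact ⟨fun e => h.1 (bar_inj.1 e).symm, fun e => h.2 (by rw [e, bar_bar])⟩

/-- A root γ outside the span involves a weight other than the ±u_k. Its second weight meets at most
one of them, so for the two remaining indices u_i + u_j, u_i − u_j and γ are pairwise strongly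
orthogonal. -/
theorem not_extendsToA4_D3 (hX : X ≠ C) {u : Fin 3 → Node n} (hu : Frame u) :
    ¬ ExtendsToA4 (X.roots n) (lin u '' D.roots 3) := by
  rintro ⟨Ψ, hΨ, hsub, hiso⟩
  obtain ⟨γ, hγ, hspan⟩ := exists_not_mem_span hu.isoRoots_D3 hiso
  have hpr : ∀ {i j}, i ≠ j → (u i).pr (u j) ∈ lin u '' D.roots 3 ∧
      (u i).pr (u j).bar ∈ lin u '' D.roots 3 := fun {i j} hij =>
    ⟨⟨(Node.pos i).pr (.pos j), pr_mem_roots.2 (by simp [Adm, bar, hij]), lin_pr _ _⟩,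
      ⟨(Node.pos i).pr (.neg j), pr_mem_roots.2 (by simp [Adm, bar, hij.symm]), lin_pr _ _⟩⟩
  have hu_span : ∀ i, (u i).wt ∈ Submodule.span ℚ (lin u '' D.roots 3) := by
    intro i
    have hij : i ≠ i + 1 := by revert i; decide
    have h := Submodule.smul_mem _ (1 / 2 : ℚ) (add_mem (Submodule.subset_span (hpr hij).1)
      (Submodule.subset_span (hpr hij).2))
    convert h using 1
    simp only [pr, wt_bar]
    ext c
    simp only [Pi.add_apply, Pi.smul_apply, Pi.neg_apply, smul_eq_mul]; ring
  obtain ⟨x, y, hxy, rfl, hx⟩ : ∃ x y : Node n, X.Adm x y ∧ γ = x.pr y ∧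
      x.wt ∉ Submodule.span ℚ (lin u '' D.roots 3) := by
    obtain ⟨x, y, hxy, rfl⟩ := (mem_roots_iff _).1 (hΨ.1 hγ)
    by_cases hx : x.wt ∈ Submodule.span ℚ (lin u '' D.roots 3)
    · exact ⟨y, x, hxy.symm, pr_comm _ _, fun hy => hspan (add_mem hx hy)⟩
    · exact ⟨x, y, hxy, rfl, hx⟩
  have hxu : ∀ i, x ≠ u i ∧ x ≠ (u i).bar := by
    refine fun i => ⟨?_, ?_⟩ <;> rintro rfl
    · exact hx (hu_span i)
    · rw [wt_bar] at hx
      exact hx (neg_mem (hu_span i))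
  obtain ⟨i, j, hij, hi, hj⟩ : ∃ i j, i ≠ j ∧ (y ≠ u i ∧ y ≠ (u i).bar) ∧
      (y ≠ u j ∧ y ≠ (u j).bar) := by
    by_cases hk : ∃ k, y = u k ∨ y = (u k).bar
    · obtain ⟨k, hk⟩ := hk
      have h : ∀ {i}, i ≠ k → y ≠ u i ∧ y ≠ (u i).bar := by
        intro i hik
        have := hu.ne hik
        rcases hk with rfl | rfl
        · exact this
        · rw [Ne, bar_eq_comm, Ne, bar_inj]
          exact this.symm
      have h3 : ∀ k : Fin 3, k + 1 ≠ k + 2 ∧ k + 1 ≠ k ∧ k + 2 ≠ k := by decide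
      exact ⟨k + 1, k + 2, (h3 k).1, h (h3 k).2.1, h (h3 k).2.2⟩
    · push Not at hk
      exact ⟨0, 1, by decide, hk 0, hk 1⟩
  have h0 := hu.ne_zero
  refine hiso.not_stronglyOrthogonal (hsub (hpr hij).1) (hsub (hpr hij).2) hγ
    (stronglyOrthogonal_pr_bar hX hΨ.1 (h0 i) (h0 j))
    (stronglyOrthogonal_pr hΨ.1 (hu.ne hij).2 hxy.ne_bar (hxu i) (hxu j) hi hj)
    (stronglyOrthogonal_pr hΨ.1 (by rw [Ne, bar_inj]; exact (hu.ne hij).1) hxy.ne_bar (hxu i)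
      ?_ hi ?_)
  · rw [bar_bar]; exact (hxu j).symm
  · rw [bar_bar]; exact hj.symm

/-- For n = 4 a root outside the span is ±u_i or ±(u_i + u_j). In the first case reflecting u_{i+1}
− u_i along it, in the second a possible change of sign, puts some u_i + u_j into Ψ. With u_i − u_j
and u_k − u_l it forms a strongly orthogonal triple. -/
theorem not_extendsToA4_A3 (hX : X ≠ C) {u : Fin 4 → Node 4} (hu : Frame u) :
    ¬ ExtendsToA4 (X.roots 4) (lin u '' stdA 3) := by
  rintro ⟨Ψ, hΨ, hsub, hiso⟩
  obtain ⟨γ, hγ, hspan⟩ := exists_not_mem_span (hu.isoRoots (stdA 3)) hiso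
  have hpr : ∀ {i j}, i ≠ j → (u i).pr (u j).bar ∈ lin u '' stdA 3 := fun {i j} hij =>
    ⟨(Node.pos i).pr (.neg j), by rw [stdA_eq]; exact ⟨_, _, ⟨i, j, hij, rfl, rfl⟩, rfl⟩,
      lin_pr _ _⟩
  have hne : ∀ {i j}, i ≠ j → u i ≠ u j ∧ u i ≠ (u j).bar ∧ (u i).bar ≠ u j := fun {i j} hij =>
    ⟨(hu.ne hij).1.symm, fun h => (hu.ne hij).2 (bar_eq_comm.1 h.symm).symm.symm,
      (hu.ne hij).2.symm⟩
  obtain ⟨i, j, hij, hmem⟩ : ∃ i j, i ≠ j ∧ (u i).pr (u j) ∈ Ψ := by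
    obtain ⟨x, y, hxy, rfl⟩ := (mem_roots_iff _).1 (hΨ.1 hγ)
    have hzero : ∀ {y : Node 4}, y ≠ zero → zero.pr y ∈ Ψ → ∃ i j, i ≠ j ∧ (u i).pr (u j) ∈ Ψ := by
      intro y hy hyΨ
      obtain ⟨i, hi⟩ := hu.exists_eq hy
      have hij : i + 1 ≠ i := by clear hi; revert i; decide
      refine ⟨i + 1, i, hij, ?_⟩
      have h := hΨ.2 _ hyΨ _ (hsub (hpr hij))
      rw [reflect_pr_pr (by simpa using hy)] at h
      have h1 := hne hij
      have h2 := bar_ne_self (hu.ne_zero i)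
      rcases hi with rfl | rfl
      · simpa [reflectPair, reflectLoop, h1, h2] using h
      · simpa [reflectPair, reflectLoop, h1, h2] using h
    by_cases hx : x = zero
    · subst hx
      exact hzero (by simpa using hxy.ne_bar) hγ
    by_cases hy : y = zero
    · subst hy
      exact hzero hx (by rwa [pr_comm])
    obtain ⟨i, hi⟩ := hu.exists_eq hx
    obtain ⟨j, hj⟩ := hu.exists_eq hy
    have h1 := hxy.ne_bar
    have h2 : x ≠ y := by
      rintro rfl
      exact not_adm_self hX _ hxy
    have hij : i ≠ j := by
      rintro rfl
      rcases hi with rfl | rfl <;> rcases hj with rfl | rfl <;> simp at h1 h2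
    refine ⟨i, j, hij, ?_⟩
    rcases hi with rfl | rfl <;> rcases hj with rfl | rfl
    · exact hγ
    · exact absurd (Submodule.subset_span (hpr hij)) hspan
    · rw [pr_comm] at hspan
      exact absurd (Submodule.subset_span (hpr hij.symm)) hspan
    · have h := hΨ.2 _ hγ _ hγ
      rw [reflect_self (hΨ.1 hγ).1, pr_bar, neg_neg] at h
      exact h
  have h4 : ∀ i j : Fin 4, i ≠ j → ∃ k l, k ≠ l ∧ k ≠ i ∧ k ≠ j ∧ l ≠ i ∧ l ≠ j := by decide
  obtain ⟨k, l, hkl, hki, hkj, hli, hlj⟩ := h4 i j hij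
  have hort : ∀ {y : Node 4}, (y = u j ∨ y = (u j).bar) →
      StronglyOrthogonal Ψ ((u i).pr y) ((u k).pr (u l).bar) := fun hy =>
    stronglyOrthogonal_pr hΨ.1 (hu.ne_signed hij.symm hy (Or.inl rfl)).2
      (hu.ne_signed hkl.symm (Or.inr rfl) (Or.inr rfl)).1
      (hu.ne_signed hki (Or.inl rfl) (Or.inl rfl)) (hu.ne_signed hkj (Or.inl rfl) hy)
      (hu.ne_signed hli (Or.inr rfl) (Or.inl rfl)) (hu.ne_signed hlj (Or.inr rfl) hy)
  refine hiso.not_stronglyOrthogonal hmem (hsub (hpr hij)) (hsub (hpr hkl))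
    (stronglyOrthogonal_pr_bar hX hΨ.1 (hu.ne_zero i) (hu.ne_zero j)) (hort (Or.inl rfl))
    (hort (Or.inr rfl))

end

/-! ### Recognizing the rows of the table -/

section

variable {X Y : ClassicalType} {m n : ℕ} {r : Row} {L R : Multiset (Fin n → ℚ)}

/-- The integral coordinates of a weight. -/
def Node.coord : Node m → ℕ → ℤ
  | zero, _ => 0
  | .pos i, k => if k = i then 1 else 0
  | .neg i, k => if k = i then -1 else 0

/-- The integral scalar product of two weights. -/
def Node.intDot (x y : Node m) : ℤ := ∑ k : Fin m, x.coord k * y.coord k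

theorem coord_cast (x : Node m) (k : Fin m) : (x.coord k : ℚ) = x.wt k := by
  cases x <;> simp [coord, wt, Pi.single_apply, Fin.ext_iff]

theorem coord_of_le (x : Node m) {k : ℕ} (hk : m ≤ k) : x.coord k = 0 := by
  rcases x with _ | i | i
  · rfl
  all_goals
    have := i.2
    simp only [coord, ite_eq_right_iff]
    omega

theorem intDot_cast (x y : Node m) : (x.intDot y : ℚ) = x.dot y := by
  simp [intDot, dot, dotProduct, coord_cast]

/-- The integral scalar product of two sums of weights. -/
def pairDot (p q : Node m × Node m) : ℤ :=
  p.1.intDot q.1 + p.1.intDot q.2 + p.2.intDot q.1 + p.2.intDot q.2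

/-- The pairs `a`, `b` of weights give a representative of the row, up to automorphism. -/
def Row.RepBy (r : Row) (a : Fin r.p → Node m × Node m) (b : Fin r.q → Node m × Node m) : Prop :=
  (∃ ρ ∈ r.reps, (∀ i, ∀ k : Fin 4, (a i).1.coord k + (a i).2.coord k = ρ.1 i k) ∧
    ∀ j, ∀ k : Fin 4, (b j).1.coord k + (b j).2.coord k = ρ.2 j k) ∧
  (Matrix.of fun i j => (pairDot (a i) (a j) : ℚ)) = r.αα ∧
  (Matrix.of fun i j => (pairDot (a i) (b j) : ℚ)) = r.αβ ∧
  (Matrix.of fun i j => (pairDot (b i) (b j) : ℚ)) = r.ββ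

instance (r : Row) (a : Fin r.p → Node m × Node m) (b : Fin r.q → Node m × Node m) :
    Decidable (r.RepBy a b) := by
  unfold Row.RepBy
  infer_instance

/-- The subset `S` of the roots of type `Y` generates them in `k` steps. -/
def GeneratesRoots (Y : ClassicalType) (k : ℕ) (S : List (Node m × Node m)) : Prop :=
  (∀ p ∈ S, Y.Adm p.1 p.2) ∧
    ∀ x y : Node m, Y.Adm x y → (x, y) ∈ orbit S k S ∨ (y, x) ∈ orbit S k S

instance (k : ℕ) (S : List (Node m × Node m)) : Decidable (GeneratesRoots Y k S) := by
  unfold GeneratesRoots; infer_instance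

/-- The subset `S` of the roots of type `A` generates them in `k` steps. -/
def GeneratesA (k : ℕ) (S : List (Node m × Node m)) : Prop :=
  (∀ p ∈ S, AdmA p.1 p.2 ∨ AdmA p.2 p.1) ∧
    ∀ x y : Node m, AdmA x y → (x, y) ∈ orbit S k S ∨ (y, x) ∈ orbit S k S

instance (k : ℕ) (S : List (Node m × Node m)) : Decidable (GeneratesA k S) := by
  unfold GeneratesA; infer_instance

/-- The sum of a pair of weights, after a change of weights. -/
def imagePair (u : Fin m → Node n) (p : Node m × Node m) : Fin n → ℚ :=
  (p.1.map u).pr (p.2.map u)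

theorem Frame.imagePair_dot {u : Fin m → Node n} (hu : Frame u) (p q : Node m × Node m) :
    imagePair u p ⬝ᵥ imagePair u q = (pairDot p q : ℚ) := by
  rw [imagePair, imagePair, ← lin_pr, ← lin_pr, hu.lin_dot, pr_dot_pr, pairDot]
  push_cast
  simp only [intDot_cast]

/-- The map `lin u` is an isometry, so the scalar products may be computed for the standard frame;
`exists_aut` brings the relation to the representative. What the roots generate depends on the
ambient system and is left as a hypothesis. -/
theorem Frame.matches {u : Fin m → Node n} (hu : Frame u) (hm : m ≤ 4)
    (a : Fin r.p → Node m × Node m) (b : Fin r.q → Node m × Node m) (hrep : decide (r.RepBy a b) = true)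
    (hkind : r.kind.Holds (X.roots n)
      (generated (X.roots n) (lin u '' pairSet (List.ofFn a ++ List.ofFn b))))
    (hmin : r.minRank ≤ n) (hL : L = ∑ i, r.a i • {imagePair u (a i)})
    (hR : R = ∑ j, r.b j • {imagePair u (b j)}) : r.Matches (X.roots n) L R := by
  obtain ⟨⟨ρ, hρ, hρa, hρb⟩, h1, h2, h3⟩ := of_decide_eq_true hrep
  obtain ⟨φ, hφ, hφu⟩ := hu.exists_aut X
  have hcoord : ∀ (x : Node m) (j : Fin n), φ (x.map u).wt j = (x.coord j : ℚ) := by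
    intro x j
    rcases x with _ | i | i
    · simp [Node.map, coord]
    · rw [Node.map, hφu, coord]; push_cast; rfl
    · rw [Node.map, wt_bar, map_neg, Pi.neg_apply, hφu, coord]
      split_ifs <;> simp
  have hvec : ∀ (p : Node m × Node m) (c : Fin 4 → ℤ),
      (∀ k : Fin 4, p.1.coord k + p.2.coord k = c k) → φ (imagePair u p) = vec n c := by
    intro p c h
    ext j
    rw [imagePair, pr, map_add, Pi.add_apply, hcoord, hcoord, vec]
    split_ifs with hj
    · rw [← h]; push_cast; rfl
    · rw [coord_of_le _ (by omega), coord_of_le _ (by omega)]; simp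
  have hset : Set.range (fun i => imagePair u (a i)) ∪ Set.range (fun j => imagePair u (b j)) =
      lin u '' pairSet (List.ofFn a ++ List.ofFn b) := by
    rw [lin_image_pairSet]
    ext α
    simp [pairSet, imagePair, List.mem_ofFn, eq_comm, or_and_right, exists_or]
  refine ⟨_, _, hL, hR, fun i j => ?_, fun i j => ?_, fun i j => ?_, ?_, hmin, ρ, hρ, φ, hφ,
    fun i => hvec _ _ (hρa i), fun j => hvec _ _ (hρb j)⟩
  · rw [hu.imagePair_dot, ← h1]; rfl
  · rw [hu.imagePair_dot, ← h2]; rfl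
  · rw [hu.imagePair_dot, ← h3]; rfl
  · rwa [hset]

theorem Frame.matches_roots {u : Fin m → Node n} (hu : Frame u) (hm : m ≤ 4)
    (hY : Y = D ∨ Y = X) (k : ℕ)
    (a : Fin r.p → Node m × Node m) (b : Fin r.q → Node m × Node m) (hrep : decide (r.RepBy a b) = true)
    (hgen : decide (GeneratesRoots Y k (List.ofFn a ++ List.ofFn b)) = true)
    (hkind : r.kind.Holds (X.roots n) (lin u '' Y.roots m))
    (hmin : r.minRank ≤ m) (hL : L = ∑ i, r.a i • {imagePair u (a i)})
    (hR : R = ∑ j, r.b j • {imagePair u (b j)}) : r.Matches (X.roots n) L R := by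
  refine hu.matches hm a b hrep ?_ (hmin.trans hu.le) hL hR
  rwa [hu.generated_roots hY (of_decide_eq_true hgen).1 k (of_decide_eq_true hgen).2]

theorem Frame.isoRoots_B {u : Fin m → Node n} (hu : Frame u) :
    IsoRoots (lin u '' B.roots m) (stdB m) := by
  rw [stdB_eq]; exact hu.isoRoots _

theorem Frame.isoRoots_C {u : Fin m → Node n} (hu : Frame u) :
    IsoRoots (lin u '' C.roots m) (stdC m) := by
  rw [stdC_eq]; exact hu.isoRoots _

theorem Frame.isoRoots_D {u : Fin m → Node n} (hu : Frame u) :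
    IsoRoots (lin u '' D.roots m) (stdD m) := by
  rw [stdD_eq]; exact hu.isoRoots _

variable {a b c d : Node n}

theorem frame_two (ha : a ≠ zero) (hb : b ≠ zero) (hab : b ≠ a ∧ b ≠ a.bar) : Frame ![a, b] := by
  refine frame_of_ne ?_ ?_
  · simp [Fin.forall_fin_succ, *]
  · simp [Fin.forall_fin_succ, *]

theorem frame_three (ha : a ≠ zero) (hb : b ≠ zero) (hc : c ≠ zero) (hab : b ≠ a ∧ b ≠ a.bar)
    (hac : c ≠ a ∧ c ≠ a.bar) (hbc : c ≠ b ∧ c ≠ b.bar) : Frame ![a, b, c] := by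
  refine frame_of_ne ?_ ?_
  · simp [Fin.forall_fin_succ, *]
  · simp [Fin.forall_fin_succ, *]

theorem frame_four (ha : a ≠ zero) (hb : b ≠ zero) (hc : c ≠ zero) (hd : d ≠ zero)
    (hab : b ≠ a ∧ b ≠ a.bar) (hac : c ≠ a ∧ c ≠ a.bar) (had : d ≠ a ∧ d ≠ a.bar)
    (hbc : c ≠ b ∧ c ≠ b.bar) (hbd : d ≠ b ∧ d ≠ b.bar) (hcd : d ≠ c ∧ d ≠ c.bar) :
    Frame ![a, b, c, d] := by
  refine frame_of_ne ?_ ?_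
  · simp [Fin.forall_fin_succ, *]
  · simp [Fin.forall_fin_succ, *]

end

/-! ### The relations of the individual rows -/

section

variable {X : ClassicalType} {m n : ℕ} {a b c d : Node n}

theorem Frame.matches_rowB2 (hu : Frame ![a, c]) :
    rowB2.Matches (B.roots n) {a.pr zero, zero.pr c} {a.pr c} :=
  hu.matches_roots (by decide) (Or.inr rfl) 3 ![(.pos 0, zero), (zero, .pos 1)]
    ![(.pos 0, .pos 1)] (by decide +kernel) (by decide +kernel)
    hu.isoRoots_B le_rfl
    (by
      change _ = ∑ i : Fin 2, _
      simp [rowB2, imagePair, Node.map, Fin.sum_univ_succ])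
    (by
      change _ = ∑ i : Fin 1, _
      simp [rowB2, imagePair, Node.map])

theorem Frame.matches_rowB2' (hu : Frame ![b, c]) :
    rowB2'.Matches (B.roots n) {zero.pr b, b.bar.pr c} {zero.pr c} :=
  hu.matches_roots (by decide) (Or.inr rfl) 3 ![(zero, .pos 0), (.neg 0, .pos 1)]
    ![(zero, .pos 1)] (by decide +kernel) (by decide +kernel)
    hu.isoRoots_B le_rfl
    (by
      change _ = ∑ i : Fin 2, _
      simp [rowB2', imagePair, Node.map, Fin.sum_univ_succ])
    (by
      change _ = ∑ i : Fin 1, _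
      simp [rowB2', imagePair, Node.map])

theorem Frame.matches_rowB2'' (hu : Frame ![a, c]) :
    rowB2''.Matches (B.roots n) {a.pr zero, a.pr zero} {a.pr c, a.pr c.bar} :=
  hu.matches_roots (by decide) (Or.inr rfl) 3 ![(.pos 0, zero)]
    ![(.pos 0, .pos 1), (.pos 0, .neg 1)] (by decide +kernel) (by decide +kernel)
    hu.isoRoots_B le_rfl
    (by
      change _ = ∑ i : Fin 1, _
      simp [rowB2'', imagePair, Node.map]
      simp only [← Multiset.singleton_add]
      abel)
    (by
      change _ = ∑ i : Fin 2, _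
      simp [rowB2'', imagePair, Node.map, Fin.sum_univ_succ])

theorem Frame.matches_rowB2''' (hu : Frame ![a, b]) :
    rowB2'''.Matches (B.roots n) {a.pr b, a.pr b.bar} {a.pr zero, a.pr zero} :=
  hu.matches_roots (by decide) (Or.inr rfl) 3 ![(.pos 0, .pos 1), (.pos 0, .neg 1)]
    ![(.pos 0, zero)] (by decide +kernel) (by decide +kernel)
    hu.isoRoots_B le_rfl
    (by
      change _ = ∑ i : Fin 2, _
      simp [rowB2''', imagePair, Node.map, Fin.sum_univ_succ])
    (by
      change _ = ∑ i : Fin 1, _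
      simp [rowB2''', imagePair, Node.map]
      simp only [← Multiset.singleton_add]
      abel)

theorem Frame.matches_rowB3 (hu : Frame ![c, a, b]) :
    rowB3.Matches (B.roots n) {c.pr zero, a.pr b} {a.pr c, b.pr zero} :=
  hu.matches_roots (by decide) (Or.inr rfl) 3 ![(.pos 0, zero), (.pos 1, .pos 2)]
    ![(.pos 1, .pos 0), (.pos 2, zero)] (by decide +kernel) (by decide +kernel)
    hu.isoRoots_B le_rfl
    (by
      change _ = ∑ i : Fin 2, _
      simp [rowB3, imagePair, Node.map, Fin.sum_univ_succ])
    (by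
      change _ = ∑ i : Fin 2, _
      simp [rowB3, imagePair, Node.map, Fin.sum_univ_succ])

theorem Frame.matches_rowB3' (hu : Frame ![a, b, d]) :
    rowB3'.Matches (B.roots n) {a.pr b, a.pr d} {a.pr zero, a.pr zero, b.pr d} :=
  hu.matches_roots (by decide) (Or.inr rfl) 3 ![(.pos 0, .pos 1), (.pos 0, .pos 2)]
    ![(.pos 0, zero), (.pos 1, .pos 2)] (by decide +kernel) (by decide +kernel)
    hu.isoRoots_B le_rfl
    (by
      change _ = ∑ i : Fin 2, _
      simp [rowB3', imagePair, Node.map, Fin.sum_univ_succ])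
    (by
      change _ = ∑ i : Fin 2, _
      simp [rowB3', imagePair, Node.map, Fin.sum_univ_succ]
      simp only [← Multiset.singleton_add]
      abel)

theorem Frame.matches_rowB3'' (hu : Frame ![a, b, d]) :
    rowB3''.Matches (B.roots n) {a.pr b, a.pr b} {a.pr zero, a.pr zero, b.pr d, b.pr d.bar} :=
  hu.matches_roots (by decide) (Or.inr rfl) 3 ![(.pos 0, .pos 1)]
    ![(.pos 0, zero), (.pos 1, .pos 2), (.pos 1, .neg 2)] (by decide +kernel) (by decide +kernel)
    hu.isoRoots_B le_rfl
    (by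
      change _ = ∑ i : Fin 1, _
      simp [rowB3'', imagePair, Node.map]
      simp only [← Multiset.singleton_add]
      abel)
    (by
      change _ = ∑ i : Fin 3, _
      simp [rowB3'', imagePair, Node.map, Fin.sum_univ_succ]
      simp only [← Multiset.singleton_add]
      abel)

theorem Frame.matches_rowB3''' (hu : Frame ![a, d, c]) :
    rowB3'''.Matches (B.roots n) {a.pr zero, a.pr d} {a.pr c, a.pr c.bar, zero.pr d} :=
  hu.matches_roots (by decide) (Or.inr rfl) 3 ![(.pos 0, zero), (.pos 0, .pos 1)]
    ![(.pos 0, .pos 2), (.pos 0, .neg 2), (zero, .pos 1)] (by decide +kernel) (by decide +kernel)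
    hu.isoRoots_B le_rfl
    (by
      change _ = ∑ i : Fin 2, _
      simp [rowB3''', imagePair, Node.map, Fin.sum_univ_succ])
    (by
      change _ = ∑ i : Fin 3, _
      simp [rowB3''', imagePair, Node.map, Fin.sum_univ_succ]
      simp only [← Multiset.singleton_add]
      abel)

theorem Frame.matches_rowC2 (hu : Frame ![a, b]) :
    rowC2.Matches (C.roots n) {a.pr b, b.bar.pr a} {a.pr a} :=
  hu.matches_roots (by decide) (Or.inr rfl) 3 ![(.pos 0, .pos 1), (.neg 1, .pos 0)]
    ![(.pos 0, .pos 0)] (by decide +kernel) (by decide +kernel)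
    hu.isoRoots_C le_rfl
    (by
      change _ = ∑ i : Fin 2, _
      simp [rowC2, imagePair, Node.map, Fin.sum_univ_succ])
    (by
      change _ = ∑ i : Fin 1, _
      simp [rowC2, imagePair, Node.map])

theorem Frame.matches_rowC2' (hu : Frame ![a, c]) :
    rowC2'.Matches (C.roots n) {a.pr a, c.pr c} {a.pr c, a.pr c} :=
  hu.matches_roots (by decide) (Or.inr rfl) 3 ![(.pos 0, .pos 0), (.pos 1, .pos 1)]
    ![(.pos 0, .pos 1)] (by decide +kernel) (by decide +kernel)
    hu.isoRoots_C le_rfl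
    (by
      change _ = ∑ i : Fin 2, _
      simp [rowC2', imagePair, Node.map, Fin.sum_univ_succ])
    (by
      change _ = ∑ i : Fin 1, _
      simp [rowC2', imagePair, Node.map]
      simp only [← Multiset.singleton_add]
      abel)

theorem Frame.matches_rowC2'' (hu : Frame ![a, c]) :
    rowC2''.Matches (C.roots n) {a.pr a, a.bar.pr c} {a.pr c} :=
  hu.matches_roots (by decide) (Or.inr rfl) 3 ![(.pos 0, .pos 0), (.neg 0, .pos 1)]
    ![(.pos 0, .pos 1)] (by decide +kernel) (by decide +kernel)
    hu.isoRoots_C le_rfl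
    (by
      change _ = ∑ i : Fin 2, _
      simp [rowC2'', imagePair, Node.map, Fin.sum_univ_succ])
    (by
      change _ = ∑ i : Fin 1, _
      simp [rowC2'', imagePair, Node.map])

theorem Frame.matches_rowC2''' (hu : Frame ![a, b]) :
    rowC2'''.Matches (C.roots n) {a.pr b, a.pr b} {a.pr a, b.pr b} :=
  hu.matches_roots (by decide) (Or.inr rfl) 3 ![(.pos 0, .pos 1)]
    ![(.pos 0, .pos 0), (.pos 1, .pos 1)] (by decide +kernel) (by decide +kernel)
    hu.isoRoots_C le_rfl
    (by
      change _ = ∑ i : Fin 1, _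
      simp [rowC2''', imagePair, Node.map]
      simp only [← Multiset.singleton_add]
      abel)
    (by
      change _ = ∑ i : Fin 2, _
      simp [rowC2''', imagePair, Node.map, Fin.sum_univ_succ])

theorem Frame.matches_rowC3 (hu : Frame ![a, b, c]) :
    rowC3.Matches (C.roots n) {a.pr b, c.pr c} {a.pr c, b.pr c} :=
  hu.matches_roots (by decide) (Or.inr rfl) 3 ![(.pos 0, .pos 1), (.pos 2, .pos 2)]
    ![(.pos 0, .pos 2), (.pos 1, .pos 2)] (by decide +kernel) (by decide +kernel)
    hu.isoRoots_C le_rfl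
    (by
      change _ = ∑ i : Fin 2, _
      simp [rowC3, imagePair, Node.map, Fin.sum_univ_succ])
    (by
      change _ = ∑ i : Fin 2, _
      simp [rowC3, imagePair, Node.map, Fin.sum_univ_succ])

theorem Frame.matches_rowC3' (hu : Frame ![a, b, c]) :
    rowC3'.Matches (C.roots n) {a.pr b, c.pr b} {a.pr c, b.pr b} :=
  hu.matches_roots (by decide) (Or.inr rfl) 3 ![(.pos 0, .pos 1), (.pos 2, .pos 1)]
    ![(.pos 0, .pos 2), (.pos 1, .pos 1)] (by decide +kernel) (by decide +kernel)
    hu.isoRoots_C le_rfl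
    (by
      change _ = ∑ i : Fin 2, _
      simp [rowC3', imagePair, Node.map, Fin.sum_univ_succ])
    (by
      change _ = ∑ i : Fin 2, _
      simp [rowC3', imagePair, Node.map, Fin.sum_univ_succ])

theorem Frame.matches_rowD4 (hu : Frame ![a, b, c, d]) :
    rowD4.Matches (X.roots n) {a.pr b, a.pr d} {a.pr c, a.pr c.bar, b.pr d} :=
  hu.matches_roots (by decide) (Or.inl rfl) 4 ![(.pos 0, .pos 1), (.pos 0, .pos 3)]
    ![(.pos 0, .pos 2), (.pos 0, .neg 2), (.pos 1, .pos 3)] (by decide +kernel) (by decide +kernel)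
    hu.isoRoots_D le_rfl
    (by
      change _ = ∑ i : Fin 2, _
      simp [rowD4, imagePair, Node.map, Fin.sum_univ_succ])
    (by
      change _ = ∑ i : Fin 3, _
      simp [rowD4, imagePair, Node.map, Fin.sum_univ_succ]
      simp only [← Multiset.singleton_add]
      abel)

theorem Frame.matches_rowD4' (hu : Frame ![a, b, c, d]) :
    rowD4'.Matches (X.roots n) {a.pr b, a.pr b} {a.pr c, a.pr c.bar, b.pr d, b.pr d.bar} :=
  hu.matches_roots (by decide) (Or.inl rfl) 4 ![(.pos 0, .pos 1)]
    ![(.pos 0, .pos 2), (.pos 0, .neg 2), (.pos 1, .pos 3), (.pos 1, .neg 3)] (by decide +kernel) (by decide +kernel)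
    hu.isoRoots_D le_rfl
    (by
      change _ = ∑ i : Fin 1, _
      simp [rowD4', imagePair, Node.map]
      simp only [← Multiset.singleton_add]
      abel)
    (by
      change _ = ∑ i : Fin 4, _
      simp [rowD4', imagePair, Node.map, Fin.sum_univ_succ]
      simp only [← Multiset.singleton_add]
      abel)

theorem Frame.matches_rowD3_cross (hX : X ≠ C) (hu : Frame ![a, b, c]) :
    rowD3.Matches (X.roots n) {a.pr b, a.pr b.bar} {a.pr c, a.pr c.bar} :=
  hu.matches_roots (by decide) (Or.inl rfl) 3 ![(.pos 0, .pos 1), (.pos 0, .neg 1)]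
    ![(.pos 0, .pos 2), (.pos 0, .neg 2)] (by decide +kernel) (by decide +kernel)
    ⟨hu.isoRoots_D3, not_extendsToA4_D3 hX hu⟩ le_rfl
    (by
      change _ = ∑ i : Fin 2, _
      simp [rowD3, imagePair, Node.map, Fin.sum_univ_succ])
    (by
      change _ = ∑ i : Fin 2, _
      simp [rowD3, imagePair, Node.map, Fin.sum_univ_succ])

theorem Frame.signed {u v : Fin m → Node n} (hu : Frame u)
    (h : ∀ i, v i = u i ∨ v i = (u i).bar) : Frame v := by
  intro i j
  by_cases hij : i = j
  · subst hij
    rcases h i with h | h <;> rw [h]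
    · exact hu i i
    · simpa using hu i i
  · rw [if_neg hij]
    have := hu i j
    rw [if_neg hij] at this
    rcases h i with h1 | h1 <;> rcases h j with h2 | h2 <;> simp [h1, h2, this]

theorem Frame.exists_extend {u : Fin m → Node n} (hu : Frame u) (h : m < n) :
    ∃ e, e ≠ zero ∧ ∀ i, e ≠ u i ∧ e ≠ (u i).bar := by
  obtain ⟨k, -, huk⟩ := hu.exists_index
  obtain ⟨j, hj⟩ : ∃ j, ∀ i, k i ≠ j := by
    by_contra! hcon
    have := Fintype.card_le_of_surjective k hcon
    simp only [Fintype.card_fin] at this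
    omega
  refine ⟨.pos j, by simp, fun i => ?_⟩
  rcases huk i with h | h <;> simp [h, bar, (hj i).symm]

/-- Changing the signs of b and c turns the three roots into differences of weights. -/
theorem Frame.generated_A2 (hu : Frame ![a, b, c]) :
    IsoRoots (generated (X.roots n) (lin ![a, b, c] '' pairSet
      [(.pos 0, .pos 1), (.neg 1, .pos 2), (.pos 0, .pos 2)])) (stdA 2) := by
  have hv : Frame ![a, b.bar, c.bar] := hu.signed (by simp [Fin.forall_fin_succ])
  have h : lin ![a, b, c] '' pairSet [(.pos 0, .pos 1), (.neg 1, .pos 2), (.pos 0, .pos 2)] =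
      lin ![a, b.bar, c.bar] '' pairSet
        [(.pos 0, .neg 1), (.pos 1, .neg 2), (.pos 0, .neg 2)] := by
    rw [lin_image_pairSet, lin_image_pairSet]
    simp [Node.map]
  have hgen : GeneratesA 3 [((.pos 0, .neg 1) : Node 3 × Node 3), (.pos 1, .neg 2),
    (.pos 0, .neg 2)] := by decide +kernel
  rw [h, hv.generated_stdA hgen.1 3 hgen.2]
  exact hv.isoRoots _

theorem Frame.image_square : lin ![a, b, c, d] '' pairSet
      [(.pos 0, .pos 1), (.pos 2, .pos 3), (.pos 0, .pos 2), (.pos 1, .pos 3)] =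
    lin ![a, b.bar, c.bar, d] '' pairSet
      [(.pos 0, .neg 1), (.neg 2, .pos 3), (.pos 0, .neg 2), (.neg 1, .pos 3)] := by
  rw [lin_image_pairSet, lin_image_pairSet]
  simp [Node.map]

theorem Frame.generated_square (hu : Frame ![a, b, c, d]) :
    generated (X.roots n) (lin ![a, b, c, d] '' pairSet
      [(.pos 0, .pos 1), (.pos 2, .pos 3), (.pos 0, .pos 2), (.pos 1, .pos 3)]) =
    lin ![a, b.bar, c.bar, d] '' stdA 3 := by
  have hv : Frame ![a, b.bar, c.bar, d] := hu.signed (by simp [Fin.forall_fin_succ])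
  have hgen : GeneratesA 4 [((.pos 0, .neg 1) : Node 4 × Node 4), (.neg 2, .pos 3),
    (.pos 0, .neg 2), (.neg 1, .pos 3)] := by decide +kernel
  rw [Frame.image_square, hv.generated_stdA hgen.1 4 hgen.2]

theorem Frame.isoRoots_square (hu : Frame ![a, b, c, d]) :
    IsoRoots (generated (X.roots n) (lin ![a, b, c, d] '' pairSet
      [(.pos 0, .pos 1), (.pos 2, .pos 3), (.pos 0, .pos 2), (.pos 1, .pos 3)])) (stdA 3) := by
  rw [hu.generated_square]
  exact (hu.signed (v := ![a, b.bar, c.bar, d]) (by simp [Fin.forall_fin_succ])).isoRoots _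

/-- A fifth weight, available for n ≥ 5, enlarges the frame and with it the system of differences.
-/
theorem Frame.extendsToA4_square (hu : Frame ![a, b, c, d]) (hn : 5 ≤ n) :
    ExtendsToA4 (X.roots n) (generated (X.roots n) (lin ![a, b, c, d] '' pairSet
      [(.pos 0, .pos 1), (.pos 2, .pos 3), (.pos 0, .pos 2), (.pos 1, .pos 3)])) := by
  have hv : Frame ![a, b.bar, c.bar, d] := hu.signed (by simp [Fin.forall_fin_succ])
  obtain ⟨e, he, h⟩ := hv.exists_extend hn
  have hw : Frame ![a, b.bar, c.bar, d, e] := by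
    refine frame_of_ne ?_ ?_
    · have := hv.ne_zero
      simp [Fin.forall_fin_succ] at this ⊢
      tauto
    · have := fun i j (hij : i < j) => hv.ne (i := i) (j := j) hij.ne
      simp [Fin.forall_fin_succ] at this h ⊢
      tauto
  have hsub : IsSubsystem (X.roots n) (lin ![a, b.bar, c.bar, d, e] '' stdA 4) :=
    hw.isSubsystem hw.lin_stdA_mem fun x hx y hy => reflect_mem_stdA hx hy
  refine ⟨_, hsub, fun γ hγ => hγ _ hsub ?_, hw.isoRoots _⟩
  have e1 : lin ![a, b.bar, c.bar, d] '' pairSet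
      [(.pos 0, .neg 1), (.neg 2, .pos 3), (.pos 0, .neg 2), (.neg 1, .pos 3)] =
      lin ![a, b.bar, c.bar, d, e] '' pairSet
      [(.pos 0, .neg 1), (.neg 2, .pos 3), (.pos 0, .neg 2), (.neg 1, .pos 3)] := by
    rw [lin_image_pairSet, lin_image_pairSet]
    simp [Node.map]
  have hgen : ∀ p ∈ [((.pos 0, .neg 1) : Node 5 × Node 5), (.neg 2, .pos 3),
    (.pos 0, .neg 2), (.neg 1, .pos 3)], AdmA p.1 p.2 ∨ AdmA p.2 p.1 := by decide +kernel
  rw [Frame.image_square, e1]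
  apply Set.image_mono
  rintro _ ⟨p, hp, rfl⟩
  rw [stdA_eq]
  rcases hgen p hp with h | h
  · exact ⟨_, _, h, rfl⟩
  · exact ⟨_, _, h, pr_comm _ _⟩

theorem Frame.matches_rowA2 (hu : Frame ![a, b, c]) :
    rowA2.Matches (X.roots n) {a.pr b, b.bar.pr c} {a.pr c} :=
  hu.matches (by decide) ![(.pos 0, .pos 1), (.neg 1, .pos 2)] ![(.pos 0, .pos 2)]
    (by decide +kernel) hu.generated_A2 hu.le
    (by
      change _ = ∑ i : Fin 2, _
      simp [rowA2, imagePair, Node.map, Fin.sum_univ_succ])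
    (by
      change _ = ∑ i : Fin 1, _
      simp [rowA2, imagePair, Node.map])

theorem Frame.matches_rowA3 (hu : Frame ![a, b, c, d]) :
    rowA3.Matches (X.roots n) {a.pr b, c.pr d} {a.pr c, b.pr d} :=
  hu.matches (by decide) ![(.pos 0, .pos 1), (.pos 2, .pos 3)] ![(.pos 0, .pos 2), (.pos 1, .pos 3)]
    (by decide +kernel) hu.isoRoots_square hu.le
    (by
      change _ = ∑ i : Fin 2, _
      simp [rowA3, imagePair, Node.map, Fin.sum_univ_succ])
    (by
      change _ = ∑ i : Fin 2, _
      simp [rowA3, imagePair, Node.map, Fin.sum_univ_succ])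

theorem Frame.matches_rowA3inA4 (hn : 5 ≤ n) (hu : Frame ![a, b, c, d]) :
    rowA3inA4.Matches (X.roots n) {a.pr b, c.pr d} {a.pr c, b.pr d} :=
  hu.matches (by decide) ![(.pos 0, .pos 1), (.pos 2, .pos 3)] ![(.pos 0, .pos 2), (.pos 1, .pos 3)]
    (by decide +kernel) ⟨hu.isoRoots_square, hu.extendsToA4_square hn⟩ hn
    (by
      change _ = ∑ i : Fin 2, _
      simp [rowA3inA4, imagePair, Node.map, Fin.sum_univ_succ])
    (by
      change _ = ∑ i : Fin 2, _
      simp [rowA3inA4, imagePair, Node.map, Fin.sum_univ_succ])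

theorem Frame.matches_rowD3_square (hX : X ≠ C) {a b c d : Node 4} (hu : Frame ![a, b, c, d]) :
    rowD3.Matches (X.roots 4) {a.pr b, c.pr d} {a.pr c, b.pr d} := by
  have hnot : ¬ ExtendsToA4 (X.roots 4) (generated (X.roots 4) (lin ![a, b, c, d] '' pairSet
      [(.pos 0, .pos 1), (.pos 2, .pos 3), (.pos 0, .pos 2), (.pos 1, .pos 3)])) := by
    rw [hu.generated_square]
    exact not_extendsToA4_A3 hX (hu.signed (by simp [Fin.forall_fin_succ]))
  exact hu.matches (by decide) ![(.pos 0, .pos 1), (.pos 2, .pos 3)] ![(.pos 0, .pos 2), (.pos 1, .pos 3)]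
    (by decide +kernel) ⟨hu.isoRoots_square, hnot⟩ (by decide)
    (by
      change _ = ∑ i : Fin 2, _
      simp [rowD3, imagePair, Node.map, Fin.sum_univ_succ])
    (by
      change _ = ∑ i : Fin 2, _
      simp [rowD3, imagePair, Node.map, Fin.sum_univ_succ])

end

/-! ### The types of the minimal relations -/

theorem ClassicalType.Adm.distinct {X : ClassicalType} {n : ℕ} {x y : Node n} (hX : X ≠ C) (h : X.Adm x y) :
    y ≠ x ∧ y ≠ x.bar := by
  cases X
  · exact ⟨h.2.symm, h.1⟩
  · exact absurd rfl hX
  · exact ⟨h.2.1.symm, h.1⟩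

theorem ClassicalType.Adm.eq_B {X : ClassicalType} {n : ℕ} {x y : Node n} (hX : X ≠ C) (h : X.Adm x y)
    (h0 : x = zero ∨ y = zero) : X = B := by
  cases X
  · rfl
  · exact absurd rfl hX
  · exact absurd h0 (by simp [h.2.2.1, h.2.2.2])

theorem adm_C_self {n : ℕ} {x : Node n} (hx : x ≠ zero) : C.Adm x x :=
  ⟨(bar_ne_self hx).symm, hx, hx⟩

theorem mem_table_of_mem_tableD {X : ClassicalType} (hX : X ≠ C) {r : Row} (hr : r ∈ tableD) :
    r ∈ X.table := by
  cases X
  · exact List.mem_append_left _ hr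
  · exact absurd rfl hX
  · exact hr

theorem not_eq_symm {n : ℕ} {x y : Node n} (h : y ≠ x ∧ y ≠ x.bar) : x ≠ y ∧ x ≠ y.bar :=
  ⟨h.1.symm, fun e => h.2 (by rw [e, bar_bar])⟩

theorem not_eq_bar {n : ℕ} {x y : Node n} (h : y ≠ x ∧ y ≠ x.bar) : y ≠ x.bar ∧ y ≠ x.bar.bar :=
  ⟨h.2, by rw [bar_bar]; exact h.1⟩

namespace IsMinimalRelation

variable {X : ClassicalType} {n : ℕ} {P : Set (Fin n → ℚ)} {𝔩 : LieSubalgebra ℂ (X.algebra n)}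
  {L R : Multiset (Fin n → ℚ)} {a b c d : Node n}

theorem matches_path (h : IsMinimalRelation P 𝔩 {a.pr b, b.bar.pr c} {a.pr c}) :
    ∃ r ∈ X.table, r.Matches (X.roots n) {a.pr b, b.bar.pr c} {a.pr c} := by
  have hab : X.Adm a b := h.adm_left (by simp)
  have hbc : X.Adm b.bar c := h.adm_left (by simp)
  have hac : X.Adm a c := h.adm_right (by simp)
  clear h
  by_cases hX : X = C
  · subst hX
    have ha := hab.2.1
    have hb := hab.2.2
    have hc := hac.2.2
    have hcb : c ≠ b := by simpa using hbc.1
    by_cases h1 : a = b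
    · subst h1
      exact ⟨rowC2'', by simp [table], (frame_two ha hc ⟨hcb, hac.1⟩).matches_rowC2''⟩
    by_cases h2 : c = b.bar
    · subst h2
      refine ⟨rowC2'', by simp [table], ?_⟩
      have := (frame_two hc ha ⟨fun e => hab.1 (by simp [e]), by simpa using h1⟩).matches_rowC2''
      rwa [bar_bar, Multiset.pair_comm, pr_comm b a, pr_comm b.bar a] at this
    by_cases h3 : a = c
    · subst h3
      exact ⟨rowC2, by simp [table], (frame_two ha hb ⟨fun e => h1 e.symm, hab.1⟩).matches_rowC2⟩
    exact ⟨rowA2, by simp [table], (frame_three ha hb hc ⟨fun e => h1 e.symm, hab.1⟩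
      ⟨fun e => h3 e.symm, hac.1⟩ ⟨hcb, h2⟩).matches_rowA2⟩
  · have hab' := hab.distinct hX
    have hac' := hac.distinct hX
    have hbc' := not_eq_bar (hbc.distinct hX)
    rw [bar_bar] at hbc'
    have hbc' : c ≠ b ∧ c ≠ b.bar := ⟨by simpa using hbc'.1, by simpa using hbc'.2⟩
    by_cases ha : a = zero
    · subst ha
      obtain rfl := hab.eq_B hX (by simp)
      exact ⟨rowB2', by simp [table], (frame_two hab'.1 hac'.1 hbc').matches_rowB2'⟩
    by_cases hb : b = zero
    · subst hb
      obtain rfl := hab.eq_B hX (by simp)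
      exact ⟨rowB2, by simp [table], (frame_two ha hbc'.1 hac').matches_rowB2⟩
    by_cases hc : c = zero
    · subst hc
      obtain rfl := hac.eq_B hX (by simp)
      refine ⟨rowB2', by simp [table], ?_⟩
      have := (frame_two (a := b.bar) (by simpa using hb) ha
        (not_eq_bar (not_eq_symm hab'))).matches_rowB2'
      rwa [bar_bar, Multiset.pair_comm, pr_comm b a, pr_comm zero b.bar, pr_comm zero a] at this
    · exact ⟨rowA2, mem_table_of_mem_tableD hX (by simp [tableD]),
        (frame_three ha hb hc hab' hac' hbc').matches_rowA2⟩

/-- For d = a the root a + b is on both sides. For d = −a the right roots c + a and −a + b contain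
opposite weights, so b = c and again a + b is on both sides. -/
theorem distinct_square (h : IsMinimalRelation P 𝔩 {a.pr b, c.pr d} {a.pr c, b.pr d}) :
    d ≠ a ∧ d ≠ a.bar := by
  have h1 : d ≠ a := by
    rintro rfl
    exact h.not_mem_right (α := d.pr b) (by simp) (by simp [pr_comm])
  refine ⟨h1, ?_⟩
  rintro rfl
  have h2 := (h.eq_of_bar_right (u := c) (y := a) (z := b) (by simp [pr_comm])
    (by simp [pr_comm])).1
  subst h2
  exact h.not_mem_right (α := a.pr b) (by simp) (by simp)

theorem matches_square (h : IsMinimalRelation P 𝔩 {a.pr b, c.pr d} {a.pr c, b.pr d}) :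
    ∃ r ∈ X.table, r.Matches (X.roots n) {a.pr b, c.pr d} {a.pr c, b.pr d} := by
  have hab : X.Adm a b := h.adm_left (by simp)
  have hcd : X.Adm c d := h.adm_left (by simp)
  have hac : X.Adm a c := h.adm_right (by simp)
  have hbd : X.Adm b d := h.adm_right (by simp)
  have had := h.distinct_square
  have hbc : c ≠ b ∧ c ≠ b.bar := by
    rw [pr_comm a b, pr_comm c d, Multiset.pair_comm (a.pr c)] at h
    exact h.distinct_square
  clear h
  by_cases hX : X = C
  · subst hX
    have ha := hab.2.1
    have hb := hab.2.2
    have hc := hac.2.2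
    have hd := hbd.2.2
    by_cases h1 : b = a
    · subst h1
      by_cases h2 : d = c
      · subst h2
        exact ⟨rowC2', by simp [table], (frame_two ha hc hbc).matches_rowC2'⟩
      · refine ⟨rowC3, by simp [table], ?_⟩
        have := (frame_three hc hd ha ⟨h2, hcd.1⟩ (not_eq_symm hbc)
          (not_eq_symm had)).matches_rowC3
        rwa [Multiset.pair_comm, pr_comm c b, pr_comm d b] at this
    by_cases h2 : d = c
    · subst h2
      exact ⟨rowC3, by simp [table], (frame_three ha hb hc ⟨h1, hab.1⟩ had hbc).matches_rowC3⟩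
    by_cases h3 : c = a
    · subst h3
      by_cases h4 : d = b
      · subst h4
        exact ⟨rowC2''', by simp [table], (frame_two ha hb ⟨h1, hab.1⟩).matches_rowC2'''⟩
      · refine ⟨rowC3', by simp [table], ?_⟩
        have := (frame_three hb ha hd (not_eq_symm ⟨h1, hab.1⟩) ⟨h4, hbd.1⟩
          had).matches_rowC3'
        rwa [Multiset.pair_comm (b.pr d), pr_comm b c, pr_comm d c] at this
    by_cases h4 : d = b
    · subst h4
      exact ⟨rowC3', by simp [table], (frame_three ha hb hc ⟨h1, hab.1⟩ ⟨h3, hac.1⟩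
        hbc).matches_rowC3'⟩
    exact ⟨rowA3, by simp [table], (frame_four ha hb hc hd ⟨h1, hab.1⟩ ⟨h3, hac.1⟩ had hbc
      ⟨h4, hbd.1⟩ ⟨h2, hcd.1⟩).matches_rowA3⟩
  · have hab' := hab.distinct hX
    have hac' := hac.distinct hX
    have hbd' := hbd.distinct hX
    have hcd' := hcd.distinct hX
    by_cases ha : a = zero
    · subst ha
      obtain rfl := hab.eq_B hX (by simp)
      refine ⟨rowB3, by simp [table], ?_⟩
      have := (frame_three (not_eq_symm hab').1.symm had.1 hac'.1 hbd' hbc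
        (not_eq_symm hcd')).matches_rowB3
      rwa [pr_comm b zero, pr_comm c zero, pr_comm d b, pr_comm d c,
        Multiset.pair_comm (b.pr d)] at this
    by_cases hb : b = zero
    · subst hb
      obtain rfl := hab.eq_B hX (by simp)
      refine ⟨rowB3, by simp [table], ?_⟩
      have := (frame_three ha hbc.1 hbd'.1 hac' had hcd').matches_rowB3
      rwa [pr_comm c a, pr_comm d zero] at this
    by_cases hc : c = zero
    · subst hc
      obtain rfl := hac.eq_B hX (by simp)
      refine ⟨rowB3, by simp [table], ?_⟩
      have := (frame_three hcd'.1 hb ha (not_eq_symm hbd') (not_eq_symm had)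
        (not_eq_symm hab')).matches_rowB3
      rwa [pr_comm d zero, pr_comm b a, Multiset.pair_comm, Multiset.pair_comm (b.pr d)] at this
    by_cases hd : d = zero
    · subst hd
      obtain rfl := hbd.eq_B hX (by simp)
      refine ⟨rowB3, by simp [table], ?_⟩
      have := (frame_three hc ha hb (not_eq_symm hac') (not_eq_symm hbc) hab').matches_rowB3
      rwa [Multiset.pair_comm (c.pr zero)] at this
    have hu := frame_four ha hb hc hd hab' hac' had hbc hbd' hcd'
    -- For n = 4 there is no fifth weight, and the A₃ lies in no A₄.
    rcases hu.le.eq_or_lt with hn | hn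
    · subst hn
      exact ⟨rowD3, mem_table_of_mem_tableD hX (by simp [tableD]), hu.matches_rowD3_square hX⟩
    · exact ⟨rowA3inA4, mem_table_of_mem_tableD hX (by simp [tableD]), hu.matches_rowA3inA4 hn⟩

/-- The two right roots sum up to 2a, which must be neither 0 nor a root. -/
theorem ne_zero_of_pair (h : IsMinimalRelation P 𝔩 L R) (h1 : a.pr c ∈ R) (h2 : a.pr c.bar ∈ R) :
    a ≠ zero ∧ X ≠ C := by
  have ha : a ≠ zero := by
    rintro rfl
    exact h.add_ne_zero_right h1 h2 (by simp [pr])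
  refine ⟨ha, ?_⟩
  rintro rfl
  rw [pr_comm] at h2
  exact (h.eq_of_bar_right h1 h2).2 (adm_C_self ha)

theorem matches_cross (h : IsMinimalRelation P 𝔩 {a.pr b, a.pr b.bar} {a.pr c, a.pr c.bar}) :
    ∃ r ∈ X.table, r.Matches (X.roots n) {a.pr b, a.pr b.bar} {a.pr c, a.pr c.bar} := by
  have hab : X.Adm a b := h.adm_left (by simp)
  have hac : X.Adm a c := h.adm_right (by simp)
  obtain ⟨ha, hX⟩ := h.ne_zero_of_pair (a := a) (c := c) (by simp) (by simp)
  have hbc : c ≠ b ∧ c ≠ b.bar := by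
    refine ⟨?_, ?_⟩ <;> rintro rfl
    · exact h.not_mem_right (α := a.pr c) (by simp) (by simp)
    · exact h.not_mem_right (α := a.pr b.bar) (by simp) (by simp)
  clear h
  have hab' := hab.distinct hX
  have hac' := hac.distinct hX
  by_cases hb : b = zero
  · subst hb
    obtain rfl := hab.eq_B hX (by simp)
    exact ⟨rowB2'', by simp [table], (frame_two ha hbc.1 hac').matches_rowB2''⟩
  by_cases hc : c = zero
  · subst hc
    obtain rfl := hac.eq_B hX (by simp)
    exact ⟨rowB2''', by simp [table], (frame_two ha hb hab').matches_rowB2'''⟩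
  · exact ⟨rowD3, mem_table_of_mem_tableD hX (by simp [tableD]),
      (frame_three ha hb hc hab' hac' hbc).matches_rowD3_cross hX⟩

theorem matches_fork (h : IsMinimalRelation P 𝔩 {a.pr b, a.pr d} {a.pr c, a.pr c.bar, b.pr d}) :
    ∃ r ∈ X.table, r.Matches (X.roots n) {a.pr b, a.pr d} {a.pr c, a.pr c.bar, b.pr d} := by
  have hab : X.Adm a b := h.adm_left (by simp)
  have had : X.Adm a d := h.adm_left (by simp)
  have hac : X.Adm a c := h.adm_right (by simp)
  have hbd : X.Adm b d := h.adm_right (by simp)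
  obtain ⟨ha, hX⟩ := h.ne_zero_of_pair (a := a) (c := c) (by simp) (by simp)
  have hbc : c ≠ b ∧ c ≠ b.bar := by
    refine ⟨?_, ?_⟩ <;> rintro rfl
    · exact h.not_mem_right (α := a.pr c) (by simp) (by simp)
    · exact h.not_mem_right (α := a.pr b) (by simp) (by simp)
  have hdc : c ≠ d ∧ c ≠ d.bar := by
    refine ⟨?_, ?_⟩ <;> rintro rfl
    · exact h.not_mem_right (α := a.pr c) (by simp) (by simp)
    · exact h.not_mem_right (α := a.pr d) (by simp) (by simp)
  clear h
  have hab' := hab.distinct hX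
  have hac' := hac.distinct hX
  have had' := had.distinct hX
  have hbd' := hbd.distinct hX
  by_cases hb : b = zero
  · subst hb
    obtain rfl := hab.eq_B hX (by simp)
    exact ⟨rowB3''', by simp [table],
      (frame_three ha hbd'.1 hbc.1 had' hac' hdc).matches_rowB3'''⟩
  by_cases hd : d = zero
  · subst hd
    obtain rfl := had.eq_B hX (by simp)
    refine ⟨rowB3''', by simp [table], ?_⟩
    have := (frame_three ha hb hdc.1 hab' hac' hbc).matches_rowB3'''
    rwa [Multiset.pair_comm, pr_comm zero b] at this
  by_cases hc : c = zero
  · subst hc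
    obtain rfl := hac.eq_B hX (by simp)
    exact ⟨rowB3', by simp [table], (frame_three ha hb hd hab' had' hbd').matches_rowB3'⟩
  · exact ⟨rowD4, mem_table_of_mem_tableD hX (by simp [tableD]),
      (frame_four ha hb hc hd hab' hac' had' hbc hbd' (not_eq_symm hdc)).matches_rowD4⟩

theorem matches_double
    (h : IsMinimalRelation P 𝔩 {a.pr b, a.pr b} {a.pr c, a.pr c.bar, b.pr d, b.pr d.bar}) :
    ∃ r ∈ X.table, r.Matches (X.roots n) {a.pr b, a.pr b}
      {a.pr c, a.pr c.bar, b.pr d, b.pr d.bar} := by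
  have hab : X.Adm a b := h.adm_left (by simp)
  have hac : X.Adm a c := h.adm_right (by simp)
  have hbd : X.Adm b d := h.adm_right (by simp)
  obtain ⟨ha, hX⟩ := h.ne_zero_of_pair (a := a) (c := c) (by simp) (by simp)
  obtain ⟨hb, -⟩ := h.ne_zero_of_pair (a := b) (c := d) (by simp) (by simp)
  have hbc : c ≠ b ∧ c ≠ b.bar := by
    refine ⟨?_, ?_⟩ <;> rintro rfl
    · exact h.not_mem_right (α := a.pr c) (by simp) (by simp)
    · exact h.not_mem_right (α := a.pr b) (by simp) (by simp)
  have had : d ≠ a ∧ d ≠ a.bar := by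
    refine ⟨?_, ?_⟩ <;> rintro rfl
    · exact h.not_mem_right (α := d.pr b) (by simp) (by simp [pr_comm])
    · exact h.not_mem_right (α := a.pr b) (by simp) (by simp [pr_comm])
  have hab' := hab.distinct hX
  -- Otherwise the right side contains a root with weight a and one with weight b whose other
  -- weights are opposite, and `eq_of_bar_right` gives b = a.
  have hcd : d ≠ c ∧ d ≠ c.bar := by
    refine ⟨?_, ?_⟩ <;> rintro rfl
    · exact hab'.1 (h.eq_of_bar_right (u := a) (y := d) (z := b) (by simp)
        (by rw [pr_comm d.bar b]; simp)).1
    · exact hab'.1 (h.eq_of_bar_right (u := a) (y := c) (z := b) (by simp)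
        (by rw [pr_comm c.bar b]; simp)).1
  clear h
  have hac' := hac.distinct hX
  have hbd' := hbd.distinct hX
  by_cases hc : c = zero
  · subst hc
    obtain rfl := hac.eq_B hX (by simp)
    exact ⟨rowB3'', by simp [table], (frame_three ha hb hcd.1 hab' had hbd').matches_rowB3''⟩
  by_cases hd : d = zero
  · subst hd
    obtain rfl := hbd.eq_B hX (by simp)
    refine ⟨rowB3'', by simp [table], ?_⟩
    have := (frame_three hb ha hc (not_eq_symm hab') hbc hac').matches_rowB3''
    rw [pr_comm b a] at this
    convert this using 1
    simp only [Multiset.insert_eq_cons, ← Multiset.singleton_add, bar_zero]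
    abel
  · exact ⟨rowD4', mem_table_of_mem_tableD hX (by simp [tableD]),
      (frame_four ha hb hc hd hab' hac' had hbc hbd' hcd).matches_rowD4'⟩

theorem exists_row_matches (h : IsMinimalRelation P 𝔩 L R)
    (hL : L.card = 2) : ∃ r ∈ X.table, r.Matches (X.roots n) L R := by
  cases h.shape hL with
  | path a b c => exact h.matches_path
  | square a b c d => exact h.matches_square
  | cross a b c => exact h.matches_cross
  | fork a b c d => exact h.matches_fork
  | double a b c d => exact h.matches_double

end IsMinimalRelation

end ConeRelations

theorem mainTheorem7 (X : ConeRelations.ClassicalType) (n : ℕ)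
    (P : Set (Fin n → ℚ)) (hP : ConeRelations.IsPositiveSystem (X.roots n) P)
    (𝔩 : LieSubalgebra ℂ (X.algebra n)) (h𝔩 : X.cartan n ≤ 𝔩.toSubmodule)
    (hcone : ¬ ConeRelations.ConeCondition P 𝔩) :
    (∃ A B, ConeRelations.IsMinimalRelation P 𝔩 A B) ∧
    (∀ A B, ConeRelations.IsMinimalRelation P 𝔩 A B → A.card = 2) ∧
    (∀ A B, ConeRelations.IsMinimalRelation P 𝔩 A B →
      ∃ r ∈ X.table, r.Matches (X.roots n) A B) :=
  ⟨ConeRelations.exists_isMinimalRelation hcone, fun _ _ h => h.card_eq_two hP,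
    fun _ _ h => h.exists_row_matches (h.card_eq_two hP)⟩
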